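/- There are an absolute constant $c$ and constants $C_\ell$, one for each prime $\ell$, such that the following holds. Let $\varepsilon>0$ and $\alpha=1/(e^{\varepsilon}+1)$. Let $K$ be a finite field of characteristic $\ell$, let $U\subseteq K$ be a universe (every finite universe embeds in a large enough finite field), let $k\ge 0$, and let $A\subseteq K$ be a non-empty set with $|A|=\alpha|K|$. (The case $A=\{0\}$, $|K|=e^{\varepsilon}+1$ is the basic one.) Consider the following mechanism for representing sets $S\subseteq U$ with $|S|\le k$. To encode $S$, draw a uniformly random hash function $h:U\to K$; draw $T\subseteq S$ by keeping each element of $S$ independently with probability $1-p$, where $p=\alpha/(1-\alpha)$; draw independent uniform elements $a_s\in A$ for $s\in T$; if the vectors $\mathrm{Row}(s)=(1,s,s^2,\dots,s^{k-1})$, $s\in T$, are linearly independent over $K$, let $x$ be a uniformly random solution in $K^k$ of the system $\mathrm{Row}(s)\cdot x=h(s)+a_s$, $s\in T$, and output $(x,h)$; otherwise output $S$ itself (failure). To decode a query $u\in U$, answer "$u\in S$" if and only if $\mathrm{Row}(u)\cdot x-h(u)\in A$ (on a failure, if and only if $u\in S$). Then: 1. (Solvability.) For every $T\subseteq U$ with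 $|T|\le k$ the rows $\mathrm{Row}(s)$, $s\in T$, are linearly independent, and for $|S|\le k$ the encoder never fails; so the encoding always consists of $k$ elements of $K$ and the hash function $h$. 2. (Privacy.) The mechanism is $\varepsilon$-differentially private: $\Pr[\mathrm{Encode}(S)\in R]\le e^{\varepsilon}\Pr[\mathrm{Encode}(S')\in R]$ for every set $R$ of encodings and all $S,S'\subseteq U$ of size at most $k$ whose symmetric difference has exactly one element. 3. (Utility.) It has error probability at most $\alpha=1/(e^\varepsilon+1)$: for all $S,Q\subseteq U$ with $|S|\le k$, the probability that all queries $q\in Q$ are answered incorrectly is at most $\alpha^{|Q|}$. 4. (Time.) For every $j\le k$, the encoding of sets of $j$ elements can be computed in at most $C_\ell\,(k\log_2^2 k+1)$ steps, and decoding can be computed in at most $c\,(k+1)$ steps. (The prime $\ell$, and hence $C_\ell$, is determined by $\varepsilon$, because $|K|/|A|=e^\varepsilon+1$.) Running time is the worst-case number of steps of a randomized algebraic computation tree over $K$; a step is an arithmetic operation or inversion in $K$, loading a constant, a comparison of two field elements for equality, a test of membership in $A$, an evaluation of $h$, drawing a uniformly random element of $K$ or of $A$, or a coin toss of prescribed bias.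 The trees may depend on $K$, $U$, $A$, $p$, $k$ and, for encoding, on $j$. -/

import Mathlib

open scoped ENNReal NNReal

noncomputable section

/-! ### Set mechanisms, differential privacy, utility -/

/-- An algorithm for representing subsets of `U`, with encodings in `E`: a randomized encoding
and a (deterministic) membership query on encodings. -/
structure SetMechanism (U E : Type*) where
  encode : Finset U → PMF E
  decode : E → U → Bool

namespace SetMechanism

variable {U E : Type*}

open Classical in
/-- `(ε, δ)`-differential privacy on the input sets of size at most `k`; two sets are neighbouring
when their symmetric difference has exactly one element. -/
def IsDP (M : SetMechanism U E) (k : ℕ) (ε δ : ℝ) : Prop :=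
  ∀ S T : Finset U, S.card ≤ k → T.card ≤ k → (symmDiff S T).card = 1 → ∀ R : Set E,
    (M.encode S).toOuterMeasure R ≤
      ENNReal.ofReal (Real.exp ε) * (M.encode T).toOuterMeasure R + ENNReal.ofReal δ

open Classical in
/-- Error probability at most `α` on the input sets of size at most `k`: for every finite set of
queries `Q`, all of them are answered wrongly with probability at most `α ^ |Q|`. -/
def HasError (M : SetMechanism U E) (k : ℕ) (α : ℝ) : Prop :=
  ∀ S : Finset U, S.card ≤ k → ∀ Q : Finset U,
    (M.encode S).toOuterMeasure {e | ∀ q ∈ Q, M.decode e q ≠ decide (q ∈ S)} ≤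
      ENNReal.ofReal α ^ Q.card

end SetMechanism

/-! ### The mechanism from linear systems -/

namespace DPSet

open Classical in
/-- The random subset of `S` that keeps every element independently with probability `1 - p`. -/
def subsample {U : Type*} (p : ℝ≥0) (hp : p ≤ 1) (S : Finset U) : PMF (Finset U) :=
  PMF.ofFinset
    (fun T => if T ∈ S.powerset then
      (((1 - p) ^ T.card * p ^ (S.card - T.card) : ℝ≥0) : ℝ≥0∞) else 0) S.powerset
    (by
      rw [Finset.sum_congr rfl (fun T hT => if_pos hT), ← ENNReal.ofNNReal_finsetSum,
        Finset.sum_pow_mul_eq_add_pow, tsub_add_cancel_of_le hp]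
      simp)
    (fun _ hT => if_neg hT)

open Classical in
/-- The solver for the linear system `row s ⬝ᵥ x = b s`, `s ∈ T`. It fails (`none`) if the matrix
with the rows `row s`, `s ∈ T`, does not have full row rank; otherwise it returns a uniformly random
solution. (With full row rank a solution always exists, so the second condition is only there to
supply the non-emptiness that the uniform distribution needs.) -/
def solve {K U : Type*} [Field K] [Fintype K] {m : ℕ} (row : U → Fin m → K)
    (T : Finset U) (b : U → K) : PMF (Option (Fin m → K)) :=
  let sols : Finset (Fin m → K) := Finset.univ.filter fun x => ∀ s ∈ T, row s ⬝ᵥ x = b s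
  if h : LinearIndependent K (fun s : T => row s) ∧ sols.Nonempty then
    (PMF.uniformOfFinset sols h.2).map some
  else PMF.pure none

/-- Encodings: the solution `x` (that is, `m` field elements) together with the hash function `h`,
or, if the solver failed, the input set itself. -/
abbrev Encoding (K U : Type*) (m : ℕ) : Type _ := ((Fin m → K) × (U → K)) ⊕ Finset U

open Classical in
/-- Encoding. Draw a uniformly random hash function `h`, subsample `S` to `T`, draw for every
element `s` an independent uniform target offset `a s ∈ A`, and solve
`row s ⬝ᵥ x = h s + a s`, `s ∈ T`. For `A = {0}` the right-hand side is just `h s`. -/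
def encode {K U : Type*} [Field K] [Fintype K] [Fintype U] {m : ℕ} (A : Finset K)
    (hA : A.Nonempty) (p : ℝ≥0) (hp : p ≤ 1) (row : U → Fin m → K) (S : Finset U) :
    PMF (Encoding K U m) :=
  (PMF.uniformOfFintype (U → K)).bind fun h =>
  (subsample p hp S).bind fun T =>
  (PMF.uniformOfFinset (Fintype.piFinset fun _ : U => A)
    (Fintype.piFinset_nonempty.2 fun _ => hA)).bind fun a =>
  (solve row T (fun s => h s + a s)).map fun r =>
    match r with
    | some x => Sum.inl (x, h)
    | none => Sum.inr S

open Classical in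
/-- Decoding: is `row u ⬝ᵥ x - h u` in `A`? For `A = {0}` this is the test `row u ⬝ᵥ x = h u`. -/
def decode {K U : Type*} [Field K] {m : ℕ} (A : Finset K) (row : U → Fin m → K) :
    Encoding K U m → U → Bool
  | Sum.inl (x, h), u => decide (row u ⬝ᵥ x - h u ∈ A)
  | Sum.inr S, u => decide (u ∈ S)

/-- The mechanism given by the rows `row`, the target set `A` and the exclusion probability `p`. -/
def mechanism {K U : Type*} [Field K] [Fintype K] [Fintype U] {m : ℕ} (A : Finset K)
    (hA : A.Nonempty) (p : ℝ≥0) (hp : p ≤ 1) (row : U → Fin m → K) :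
    SetMechanism U (Encoding K U m) where
  encode := encode A hA p hp row
  decode := decode A row

/-- Vandermonde rows `(1, u, u², …, u^(k-1))`, for a universe `U` embedded in `K` by `ι`. -/
def vandermondeRow {K U : Type*} [Field K] (ι : U ↪ K) (k : ℕ) : U → Fin k → K :=
  fun u i => ι u ^ (i : ℕ)

end DPSet

/-! ### Randomized algebraic computation trees and their running time -/

/-- Instructions that compute one field element. The registers are numbered by `ℕ`. -/
inductive Instr (K : Type*)
  /-- load a constant -/
  | const (c : K)
  /-- arithmetic on the contents of registers -/
  | add (i j : ℕ)
  | sub (i j : ℕ)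
  | mul (i j : ℕ)
  | inv (i : ℕ)
  /-- evaluate the hash function at the content of a register -/
  | hash (i : ℕ)
  /-- draw a uniformly random field element -/
  | rand
  /-- draw a uniformly random element of the target set -/
  | randTarget

/-- Computation trees over `K` with results in `β`. -/
inductive CompTree (K : Type*) (β : Type*)
  /-- stop with the result `b` -/
  | ret (b : β)
  /-- execute an instruction, store its value in register `d`, continue -/
  | exec (d : ℕ) (ins : Instr K) (t : CompTree K β)
  /-- branch on the equality of the contents of two registers -/
  | ifEq (i j : ℕ) (t₁ t₂ : CompTree K β)
  /-- branch on the membership of the content of a register in the target set -/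
  | ifTarget (i : ℕ) (t₁ t₂ : CompTree K β)
  /-- toss a coin: `t₁` with probability `p`, `t₂` with probability `1 - p` -/
  | coin (p : ℝ≥0) (hp : p ≤ 1) (t₁ t₂ : CompTree K β)

/-- The distribution of the value of an instruction, for the target set `A`, the hash oracle `H`
and the register contents `μ`. -/
def Instr.eval {K : Type*} [Field K] [Fintype K] (A : Finset K) (hA : A.Nonempty) (H : K → K)
    (μ : ℕ → K) : Instr K → PMF K
  | .const c => PMF.pure c
  | .add i j => PMF.pure (μ i + μ j)
  | .sub i j => PMF.pure (μ i - μ j)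
  | .mul i j => PMF.pure (μ i * μ j)
  | .inv i => PMF.pure (μ i)⁻¹
  | .hash i => PMF.pure (H (μ i))
  | .rand => PMF.uniformOfFintype K
  | .randTarget => PMF.uniformOfFinset A hA

namespace CompTree

variable {K β : Type*}

open Classical in
/-- The joint distribution of the result and the final register contents, when the tree is run
from the register contents `μ`. -/
def run [Field K] [Fintype K] (A : Finset K) (hA : A.Nonempty) (H : K → K) :
    CompTree K β → (ℕ → K) → PMF (β × (ℕ → K))
  | ret b, μ => PMF.pure (b, μ)
  | exec d ins t, μ =>
      (ins.eval A hA H μ).bind fun v => run A hA H t (Function.update μ d v)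
  | ifEq i j t₁ t₂, μ => if μ i = μ j then run A hA H t₁ μ else run A hA H t₂ μ
  | ifTarget i t₁ t₂, μ => if μ i ∈ A then run A hA H t₁ μ else run A hA H t₂ μ
  | coin p hp t₁ t₂, μ =>
      (PMF.ofFintype (fun b : Bool => ((cond b p (1 - p) : ℝ≥0) : ℝ≥0∞)) (by
        simp only [Fintype.sum_bool, cond_true, cond_false]
        rw [← ENNReal.coe_add, add_tsub_cancel_of_le hp, ENNReal.coe_one])).bind fun b =>
      if b = true then run A hA H t₁ μ else run A hA H t₂ μ

/-- Worst-case running time: instructions, comparisons and coin tosses cost one step each. -/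
def cost : CompTree K β → ℕ
  | ret _ => 0
  | exec _ _ t => t.cost + 1
  | ifEq _ _ t₁ t₂ => max t₁.cost t₂.cost + 1
  | ifTarget _ t₁ t₂ => max t₁.cost t₂.cost + 1
  | coin _ _ t₁ t₂ => max t₁.cost t₂.cost + 1

end CompTree

namespace DPSet

/-- Register contents that hold the listed field elements in registers `0, …, j - 1` and zero
elsewhere. -/
def load {K : Type*} [Field K] {j : ℕ} (v : Fin j → K) : ℕ → K :=
  fun i => if h : i < j then v ⟨i, h⟩ else 0

/-- The hash function `h : U → K` as an oracle on field elements: the element `ι u` is mapped to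
`h u`, everything outside the embedded universe to `0`. -/
def oracle {K U : Type*} [Field K] (ι : U ↪ K) (h : U → K) : K → K :=
  Function.extend ι h 0

open Classical in
/-- The tree `t` computes the encoding of all sets of size `j`: given the elements of
such a set in any order in registers `0, …, j - 1`, and oracle access to a uniformly random hash
function `h`, it ends with the `m` coordinates of `x` in the registers that it returns, and `(x, h)`
has the distribution of the encoding. -/
def ComputesEncode {K U : Type*} [Field K] [Fintype K] [Fintype U] {m : ℕ} (A : Finset K)
    (hA : A.Nonempty) (ι : U ↪ K) (M : SetMechanism U (Encoding K U m)) (j : ℕ)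
    (t : CompTree K (Fin m → ℕ)) : Prop :=
  ∀ s : Fin j ↪ U,
    ((PMF.uniformOfFintype (U → K)).bind fun h =>
      (t.run A hA (oracle ι h) (load fun i => ι (s i))).map fun r =>
        (Sum.inl (fun i => r.2 (r.1 i), h) : Encoding K U m)) =
      M.encode (Finset.univ.map s)

/-- The tree `t` computes the membership queries: given `x` in registers `0, …, m - 1`, the queried
element in register `m`, and oracle access to `h`, it returns (with certainty) the answer of the
mechanism on the encoding `(x, h)`. -/
def ComputesDecode {K U : Type*} [Field K] [Fintype K] {m : ℕ} (A : Finset K)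
    (hA : A.Nonempty) (ι : U ↪ K) (M : SetMechanism U (Encoding K U m))
    (t : CompTree K Bool) : Prop :=
  ∀ (x : Fin m → K) (h : U → K) (u : U),
    (t.run A hA (oracle ι h) (load (Fin.snoc (α := fun _ => K) x (ι u)))).map Prod.fst =
      PMF.pure (M.decode (Sum.inl (x, h)) u)

end DPSet

end

/-! ### Straight-line cost of families of functions -/

namespace StraightLine

open Set Matrix

set_option linter.unusedSectionVars false

section Calculus

variable {F X : Type*} [Field F]

/-- The functions that one arithmetic step computes from functions in `H`. -/
inductive Step (H : Set (X → F)) : (X → F) → Prop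
  | const (c : F) : Step H (Function.const X c)
  | add {f g : X → F} : f ∈ H → g ∈ H → Step H (f + g)
  | sub {f g : X → F} : f ∈ H → g ∈ H → Step H (f - g)
  | mul {f g : X → F} : f ∈ H → g ∈ H → Step H (f * g)
  | inv {f : X → F} : f ∈ H → Step H f⁻¹

/-- `Reach G c H`: starting from the functions in `G`, the functions in `H` are those available
after some `c` arithmetic steps. -/
inductive Reach (G : Set (X → F)) : ℕ → Set (X → F) → Prop
  | refl : Reach G 0 G
  | step {c : ℕ} {H : Set (X → F)} {f : X → F} :
      Reach G c H → Step H f → Reach G (c + 1) (insert f H)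

/-- The functions in `T` can all be computed from those in `G` in at most `c` arithmetic steps. -/
def Cost (G : Set (X → F)) (c : ℕ) (T : Set (X → F)) : Prop :=
  ∃ c' ≤ c, ∃ H, Reach G c' H ∧ T ⊆ H

theorem Step.mono {H H' : Set (X → F)} (h : H ⊆ H') {f : X → F} (hf : Step H f) : Step H' f := by
  cases hf with
  | const c => exact .const c
  | add a b => exact .add (h a) (h b)
  | sub a b => exact .sub (h a) (h b)
  | mul a b => exact .mul (h a) (h b)
  | inv a => exact .inv (h a)

theorem Reach.subset {G H : Set (X → F)} {c : ℕ} (h : Reach G c H) : G ⊆ H := by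
  induction h with
  | refl => exact subset_rfl
  | step _ _ ih => exact ih.trans (subset_insert _ _)

theorem Reach.union {G H : Set (X → F)} {c : ℕ} (h : Reach G c H) (G' : Set (X → F)) :
    Reach (G ∪ G') c (H ∪ G') := by
  induction h with
  | refl => exact .refl
  | step _ hf ih =>
    rw [insert_union]
    exact .step ih (hf.mono subset_union_left)

theorem Reach.trans {G H H' : Set (X → F)} {c c' : ℕ} (h : Reach G c H) (h' : Reach H c' H') :
    Reach G (c + c') H' := by
  induction h' with
  | refl => exact h
  | step _ hf ih => exact .step ih hf

namespace Cost

variable {G G' T T' : Set (X → F)} {c c' : ℕ}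

theorem of_subset (h : T ⊆ G) : Cost G c T := ⟨0, Nat.zero_le _, G, .refl, h⟩

theorem mono_cost (h : Cost G c T) (hc : c ≤ c') : Cost G c' T := by
  obtain ⟨d, hd, H, hH, hT⟩ := h
  exact ⟨d, hd.trans hc, H, hH, hT⟩

theorem mono_left (h : Cost G c T) (hG : G ⊆ G') : Cost G' c T := by
  obtain ⟨d, hd, H, hH, hT⟩ := h
  refine ⟨d, hd, H ∪ G', ?_, hT.trans subset_union_left⟩
  simpa [union_eq_self_of_subset_left hG] using hH.union G'

theorem mono_right (h : Cost G c T) (hT : T' ⊆ T) : Cost G c T' := by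
  obtain ⟨d, hd, H, hH, hT'⟩ := h
  exact ⟨d, hd, H, hH, hT.trans hT'⟩

theorem union_trans (h : Cost G c T) (h' : Cost (G ∪ T) c' T') : Cost G (c + c') (T ∪ T') := by
  obtain ⟨d, hd, H, hH, hT⟩ := h
  obtain ⟨d', hd', H', hH', hT'⟩ := h'
  refine ⟨d + d', add_le_add hd hd', H' ∪ H, hH.trans ?_, ?_⟩
  · have := hH'.union H
    rwa [union_eq_self_of_subset_left (union_subset hH.subset hT)] at this
  · exact union_subset (hT.trans subset_union_right) (hT'.trans subset_union_left)

theorem trans (h : Cost G c T) (h' : Cost (G ∪ T) c' T') : Cost G (c + c') T' :=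
  (h.union_trans h').mono_right subset_union_right

theorem union (h : Cost G c T) (h' : Cost G c' T') : Cost G (c + c') (T ∪ T') :=
  h.union_trans (h'.mono_left subset_union_left)

theorem biUnion {ι : Type*} {T : ι → Set (X → F)} {c : ι → ℕ} (s : Finset ι)
    (h : ∀ i ∈ s, Cost G (c i) (T i)) : Cost G (∑ i ∈ s, c i) (⋃ i ∈ s, T i) := by
  classical
  induction s using Finset.induction_on with
  | empty => simpa using of_subset (empty_subset G)
  | insert a s ha ih =>
    rw [Finset.sum_insert ha, Finset.set_biUnion_insert]
    exact (h a (Finset.mem_insert_self a s)).union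
      (ih fun i hi => h i (Finset.mem_insert_of_mem hi))

theorem iUnion {ι : Type*} [Fintype ι] {T : ι → Set (X → F)}
    (h : ∀ i, Cost G c (T i)) : Cost G (Fintype.card ι * c) (⋃ i, T i) := by
  simpa using biUnion (c := fun _ => c) Finset.univ fun i _ => h i

theorem range {ι : Type*} [Fintype ι] {f : ι → X → F} (h : ∀ i, Cost G c {f i}) :
    Cost G (Fintype.card ι * c) (range f) := by
  simpa using iUnion h

theorem mem {f : X → F} (h : f ∈ G) : Cost G 0 {f} := of_subset (singleton_subset_iff.2 h)

theorem of_step {f : X → F} (h : Step G f) : Cost G 1 {f} :=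
  ⟨1, le_rfl, _, .step .refl h, singleton_subset_iff.2 (mem_insert _ _)⟩

theorem const (a : F) : Cost G 1 {Function.const X a} := of_step (.const a)

variable {f g : X → F}

theorem add (hf : Cost G c {f}) (hg : Cost G c' {g}) : Cost G (c + c' + 1) {f + g} :=
  (hf.union hg).trans (of_step (.add (by simp) (by simp)))

theorem sub (hf : Cost G c {f}) (hg : Cost G c' {g}) : Cost G (c + c' + 1) {f - g} :=
  (hf.union hg).trans (of_step (.sub (by simp) (by simp)))

theorem mul (hf : Cost G c {f}) (hg : Cost G c' {g}) : Cost G (c + c' + 1) {f * g} :=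
  (hf.union hg).trans (of_step (.mul (by simp) (by simp)))

theorem inv (hf : Cost G c {f}) : Cost G (c + 1) {f⁻¹} :=
  hf.trans (of_step (.inv (by simp)))

theorem sum {ι : Type*} {f : ι → X → F} (s : Finset ι) (h : ∀ i ∈ s, Cost G c {f i}) :
    Cost G (s.card * (c + 1) + 1) {∑ i ∈ s, f i} := by
  classical
  induction s using Finset.induction_on with
  | empty => simpa using const (G := G) 0
  | insert a s ha ih =>
    rw [Finset.sum_insert ha, Finset.card_insert_of_notMem ha]
    refine ((h a (Finset.mem_insert_self a s)).add
      (ih fun i hi => h i (Finset.mem_insert_of_mem hi))).mono_cost (le_of_eq ?_)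
    ring

theorem prod {ι : Type*} {f : ι → X → F} (s : Finset ι) (h : ∀ i ∈ s, Cost G c {f i}) :
    Cost G (s.card * (c + 1) + 1) {∏ i ∈ s, f i} := by
  classical
  induction s using Finset.induction_on with
  | empty => simpa using const (G := G) 1
  | insert a s ha ih =>
    rw [Finset.prod_insert ha, Finset.card_insert_of_notMem ha]
    refine ((h a (Finset.mem_insert_self a s)).mul
      (ih fun i hi => h i (Finset.mem_insert_of_mem hi))).mono_cost (le_of_eq ?_)
    ring

end Cost

end Calculus

/-! ### Cost of matrix-vector products -/

section Matrices

variable {F X : Type*} [Field F] {m n o : Type*} [Fintype m] [Fintype n] [Fintype o]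

/-- Given the functions in `G`, the product of `M` with any vector takes at most `c` steps. -/
def MulVecCost (G : Set (X → F)) (M : Matrix m n (X → F)) (c : ℕ) : Prop :=
  ∀ v : n → X → F, Cost (G ∪ range v) c (range (M *ᵥ v))

/-- Given the functions in `G`, the products of `M` and of `Mᵀ` with any vector take at most `c`
steps. -/
structure BiCost (G : Set (X → F)) (M : Matrix m n (X → F)) (c : ℕ) : Prop where
  fwd : MulVecCost G M c
  bwd : MulVecCost G Mᵀ c

/-- The matrix with the blocks `T a b`. -/
def blocks {m n o p R : Type*} (T : o → p → Matrix m n R) : Matrix (m × o) (n × p) R :=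
  Matrix.of fun i j => T i.2 j.2 i.1 j.1

theorem blocks_transpose {m n o p R : Type*} (T : o → p → Matrix m n R) :
    (blocks T)ᵀ = blocks fun a b => (T b a)ᵀ := rfl

theorem blocks_mulVec {m n o p R : Type*} [Fintype n] [Fintype p] [CommRing R]
    (T : o → p → Matrix m n R) (v : n × p → R) (i : m) (a : o) :
    (blocks T *ᵥ v) (i, a) = ∑ b, (T a b *ᵥ fun j => v (j, b)) i := by
  simp only [mulVec, dotProduct, blocks, of_apply, Fintype.sum_prod_type]
  exact Finset.sum_comm

theorem blockDiagonal_mulVec {m n o R : Type*} [Fintype n] [Fintype o] [DecidableEq o]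
    [CommRing R] (T : o → Matrix m n R) (v : n × o → R) (i : m) (a : o) :
    (blockDiagonal T *ᵥ v) (i, a) = (T a *ᵥ fun j => v (j, a)) i := by
  simp only [mulVec, dotProduct, blockDiagonal_apply, Fintype.sum_prod_type, ite_mul, zero_mul]
  simp

namespace MulVecCost

variable {G G' : Set (X → F)} {c c' : ℕ}

theorem mono_left {M : Matrix m n (X → F)} (h : MulVecCost G M c) (hG : G ⊆ G') :
    MulVecCost G' M c :=
  fun v => (h v).mono_left (union_subset_union_left _ hG)

theorem mono_cost {M : Matrix m n (X → F)} (h : MulVecCost G M c) (hc : c ≤ c') :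
    MulVecCost G M c' :=
  fun v => (h v).mono_cost hc

theorem apply {M : Matrix m n (X → F)} (h : MulVecCost G M c) {v : n → X → F}
    (hG : G ⊆ G') (hv : ∀ i, v i ∈ G') : Cost G' c (range (M *ᵥ v)) :=
  (h v).mono_left (union_subset hG (range_subset_iff.2 hv))

theorem mul {M : Matrix m n (X → F)} {N : Matrix n o (X → F)} (hM : MulVecCost G M c)
    (hN : MulVecCost G N c') : MulVecCost G (M * N) (c + c') := by
  intro v
  rw [← mulVec_mulVec, add_comm c]
  refine (hN v).trans (hM.apply (fun f hf => Or.inl (Or.inl hf)) fun i => Or.inr ⟨i, rfl⟩)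

theorem diagonal [DecidableEq m] {d : m → X → F} (h : ∀ i, d i ∈ G) :
    MulVecCost G (Matrix.diagonal d) (Fintype.card m) := by
  intro v
  rw [← mul_one (Fintype.card m)]
  refine Cost.range fun i => ?_
  rw [mulVec_diagonal]
  exact (Cost.mem (Or.inl (h i))).mul (Cost.mem (Or.inr ⟨i, rfl⟩))

theorem diagonal_const [DecidableEq m] (d : m → F) :
    MulVecCost G (Matrix.diagonal fun i => Function.const X (d i)) (Fintype.card m * 2) := by
  intro v
  refine Cost.range fun i => ?_
  rw [mulVec_diagonal]
  exact (Cost.const (d i)).mul (Cost.mem (Or.inr ⟨i, rfl⟩))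

theorem blockDiagonal [DecidableEq o] {T : o → Matrix m n (X → F)}
    (h : ∀ a, MulVecCost G (T a) c) :
    MulVecCost G (Matrix.blockDiagonal T) (Fintype.card o * c) := by
  intro v
  refine (Cost.iUnion (T := fun a => Set.range (T a *ᵥ fun j => v (j, a))) fun a =>
    (h a).apply subset_union_left fun i => Or.inr (mem_range_self (_, _))).mono_right ?_
  rintro _ ⟨⟨i, a⟩, rfl⟩
  exact mem_iUnion.2 ⟨a, i, (blockDiagonal_mulVec T v i a).symm⟩

theorem blocks {p : Type*} [Fintype p] {T : o → p → Matrix m n (X → F)}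
    (h : ∀ a b, MulVecCost G (T a b) c) :
    MulVecCost G (StraightLine.blocks T) (Fintype.card o * (Fintype.card p * c) +
      Fintype.card m * Fintype.card o * (Fintype.card p + 1)) := by
  intro v
  refine (Cost.iUnion (T := fun a => ⋃ b, Set.range (T a b *ᵥ fun j => v (j, b))) fun a =>
    Cost.iUnion fun b => (h a b).apply subset_union_left fun i =>
      Or.inr (mem_range_self (_, _))).trans ?_
  rw [← Fintype.card_prod]
  refine Cost.range fun ⟨i, a⟩ => ?_
  rw [blocks_mulVec]
  refine (Cost.sum (c := 0) Finset.univ fun b _ => Cost.mem (Or.inr ?_)).mono_cost (by simp)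
  exact mem_iUnion.2 ⟨a, mem_iUnion.2 ⟨b, mem_range_self i⟩⟩

end MulVecCost

namespace BiCost

variable {G G' : Set (X → F)} {c c' : ℕ}

theorem mono_left {M : Matrix m n (X → F)} (h : BiCost G M c) (hG : G ⊆ G') : BiCost G' M c :=
  ⟨h.1.mono_left hG, h.2.mono_left hG⟩

theorem mono_cost {M : Matrix m n (X → F)} (h : BiCost G M c) (hc : c ≤ c') : BiCost G M c' :=
  ⟨h.1.mono_cost hc, h.2.mono_cost hc⟩

theorem mul {M : Matrix m n (X → F)} {N : Matrix n o (X → F)} (hM : BiCost G M c)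
    (hN : BiCost G N c') : BiCost G (M * N) (c + c') := by
  refine ⟨hM.1.mul hN.1, ?_⟩
  rw [transpose_mul, add_comm]
  exact hN.2.mul hM.2

theorem diagonal [DecidableEq m] {d : m → X → F} (h : ∀ i, d i ∈ G) :
    BiCost G (Matrix.diagonal d) (Fintype.card m) := by
  refine ⟨.diagonal h, ?_⟩
  rw [diagonal_transpose]
  exact .diagonal h

theorem diagonal_const [DecidableEq m] (d : m → F) :
    BiCost G (Matrix.diagonal fun i => Function.const X (d i)) (Fintype.card m * 2) := by
  refine ⟨.diagonal_const d, ?_⟩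
  rw [diagonal_transpose]
  exact .diagonal_const d

theorem blockDiagonal [DecidableEq o] {T : o → Matrix m n (X → F)}
    (h : ∀ a, BiCost G (T a) c) :
    BiCost G (Matrix.blockDiagonal T) (Fintype.card o * c) := by
  refine ⟨.blockDiagonal fun a => (h a).1, ?_⟩
  rw [blockDiagonal_transpose]
  exact .blockDiagonal fun a => (h a).2

theorem blocks {T : o → o → Matrix m m (X → F)} (h : ∀ a b, BiCost G (T a b) c) :
    BiCost G (StraightLine.blocks T)
      (Fintype.card o ^ 2 * (c + 2 * Fintype.card m)) := by
  have key : Fintype.card o * (Fintype.card o * c) +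
      Fintype.card m * Fintype.card o * (Fintype.card o + 1) ≤
      Fintype.card o ^ 2 * (c + 2 * Fintype.card m) := by
    have : Fintype.card o ≤ Fintype.card o ^ 2 := Nat.le_self_pow (by norm_num) _
    nlinarith [Nat.mul_le_mul_left (Fintype.card m) this]
  refine ⟨(MulVecCost.blocks fun a b => (h a b).1).mono_cost key, ?_⟩
  rw [blocks_transpose]
  exact (MulVecCost.blocks fun a b => (h b a).2).mono_cost key

end BiCost

end Matrices

end StraightLine

/-! ### The additive Fourier transform -/

namespace AdditiveFFT

open StraightLine Matrix Polynomial

set_option linter.unusedSectionVars false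
open scoped Kronecker

/-- Words of `i` digits below `ℓ`. -/
abbrev Idx (ℓ : ℕ) : ℕ → Type
  | 0 => Unit
  | i + 1 => Idx ℓ i × Fin ℓ

namespace Idx

variable {ℓ : ℕ}

instance fintype : ∀ i, Fintype (Idx ℓ i)
  | 0 => inferInstanceAs (Fintype Unit)
  | i + 1 => @instFintypeProd _ _ (fintype i) _

instance decidableEq : ∀ i, DecidableEq (Idx ℓ i)
  | 0 => inferInstanceAs (DecidableEq Unit)
  | i + 1 => @instDecidableEqProd _ _ (decidableEq i) _

/-- The word of zeros. -/
def zeros [NeZero ℓ] : ∀ i, Idx ℓ i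
  | 0 => ()
  | i + 1 => (zeros i, 0)

theorem card (i : ℕ) : Fintype.card (Idx ℓ i) = ℓ ^ i := by
  induction i with
  | zero => rfl
  | succ i ih =>
    rw [pow_succ, ← ih]
    exact (Fintype.card_prod (Idx ℓ i) (Fin ℓ)).trans (by simp)

/-- The number with the given digits in base `ℓ`. -/
def num : ∀ {i : ℕ}, Idx ℓ i → ℕ
  | 0, _ => 0
  | i + 1, w => num (i := i) w.1 + ℓ ^ i * (w.2 : ℕ)

theorem num_lt {i : ℕ} (w : Idx ℓ i) : num w < ℓ ^ i := by
  induction i with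
  | zero => exact Nat.one_pos
  | succ i ih =>
    obtain ⟨w, u⟩ := w
    have h1 := ih w
    have h2 : ℓ ^ i * ((u : ℕ) + 1) ≤ ℓ ^ i * ℓ := Nat.mul_le_mul_left _ u.2
    change num w + ℓ ^ i * (u : ℕ) < _
    rw [pow_succ]
    linarith

theorem num_injective {i : ℕ} : Function.Injective (num : Idx ℓ i → ℕ) := by
  induction i with
  | zero => exact fun _ _ _ => rfl
  | succ i ih =>
    rintro ⟨w, u⟩ ⟨w', u'⟩ h
    change num w + ℓ ^ i * (u : ℕ) = num w' + ℓ ^ i * (u' : ℕ) at h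
    have h1 := congrArg (· % ℓ ^ i) h
    simp only [Nat.add_mul_mod_self_left, Nat.mod_eq_of_lt (num_lt _)] at h1
    have h2 := ih h1
    subst h2
    have hpos : 0 < ℓ ^ i := (Nat.zero_le _).trans_lt (num_lt w)
    have h3 : (u : ℕ) = u' := Nat.eq_of_mul_eq_mul_left hpos (Nat.add_left_cancel h)
    exact Prod.ext rfl (Fin.ext h3)

theorem exists_num_eq {i n : ℕ} (h : n < ℓ ^ i) : ∃ w : Idx ℓ i, num w = n := by
  have hbij : Function.Bijective fun w : Idx ℓ i => (⟨num w, num_lt w⟩ : Fin (ℓ ^ i)) := by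
    rw [Fintype.bijective_iff_injective_and_card]
    exact ⟨fun a b hab => num_injective (Fin.ext_iff.1 hab), by simp [card]⟩
  obtain ⟨w, hw⟩ := hbij.2 ⟨n, h⟩
  exact ⟨w, Fin.ext_iff.1 hw⟩

end Idx

section Vanishing

variable {L : Type*} [Field L] (ℓ : ℕ) (β : ℕ → L)

/-- The monic linearized polynomials that vanish on the span of `β 0, …, β (i - 1)` over the prime
field. -/
noncomputable def vanishing : ℕ → L[X]
  | 0 => X
  | i + 1 => vanishing i ^ ℓ - C ((vanishing i).eval (β i) ^ (ℓ - 1)) * vanishing i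

/-- The elements of the span of `β 0, …, β (i - 1)` over the prime field. -/
def pt : ∀ i : ℕ, Idx ℓ i → L
  | 0, _ => 0
  | i + 1, w => pt i w.1 + ((w.2 : ℕ) : L) * β i

/-- The basis of the polynomials of degree below `ℓ ^ i` formed by the products of powers of the
polynomials `vanishing ℓ β 0, …, vanishing ℓ β (i - 1)`. -/
noncomputable def basis : ∀ i : ℕ, Idx ℓ i → L[X]
  | 0, _ => 1
  | i + 1, w => basis i w.1 * vanishing ℓ β i ^ (w.2 : ℕ)

/-- The matrix that evaluates a polynomial, given by its coefficients in `basis`, on a coset. -/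
noncomputable def evalMatrix (i : ℕ) (v : L) : Matrix (Idx ℓ i) (Idx ℓ i) L :=
  Matrix.of fun w m => (basis ℓ β i m).eval (v + pt ℓ β i w)

variable {ℓ β}

theorem eval_vanishing_succ (i : ℕ) (x : L) :
    (vanishing ℓ β (i + 1)).eval x = (vanishing ℓ β i).eval x ^ ℓ -
      (vanishing ℓ β i).eval (β i) ^ (ℓ - 1) * (vanishing ℓ β i).eval x := by
  simp [vanishing]

variable [Fact ℓ.Prime]

theorem vanishing_monic_natDegree (i : ℕ) :
    (vanishing ℓ β i).Monic ∧ (vanishing ℓ β i).natDegree = ℓ ^ i := by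
  have hℓ : 1 < ℓ := (Fact.out : ℓ.Prime).one_lt
  induction i with
  | zero => exact ⟨monic_X, by simp [vanishing]⟩
  | succ i ih =>
    obtain ⟨hm, hd⟩ := ih
    have hm' : (vanishing ℓ β i ^ ℓ).Monic := hm.pow ℓ
    have hd' : (vanishing ℓ β i ^ ℓ).natDegree = ℓ ^ (i + 1) := by
      rw [hm.natDegree_pow, hd, pow_succ, mul_comm]
    have hlt : (C ((vanishing ℓ β i).eval (β i) ^ (ℓ - 1)) * vanishing ℓ β i).degree <
        (vanishing ℓ β i ^ ℓ).degree := by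
      rw [← smul_eq_C_mul]
      refine (degree_smul_le _ _).trans_lt ?_
      rw [degree_eq_natDegree hm.ne_zero, degree_eq_natDegree hm'.ne_zero, hd, hd']
      exact_mod_cast Nat.pow_lt_pow_right hℓ (Nat.lt_succ_self i)
    refine ⟨hm'.sub_of_left hlt, ?_⟩
    rw [vanishing, natDegree_sub_eq_left_of_natDegree_lt, hd']
    by_cases h : C ((vanishing ℓ β i).eval (β i) ^ (ℓ - 1)) * vanishing ℓ β i = 0
    · rw [h, natDegree_zero, hd']
      positivity
    · exact natDegree_lt_natDegree h hlt

theorem basis_monic_natDegree (i : ℕ) (w : Idx ℓ i) :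
    (basis ℓ β i w).Monic ∧ (basis ℓ β i w).natDegree = w.num := by
  induction i with
  | zero => exact ⟨monic_one, by simp [basis, Idx.num]⟩
  | succ i ih =>
    obtain ⟨hm, hd⟩ := ih w.1
    obtain ⟨hm', hd'⟩ := vanishing_monic_natDegree (ℓ := ℓ) (β := β) i
    refine ⟨hm.mul (hm'.pow _), ?_⟩
    rw [basis, hm.natDegree_mul (hm'.pow _), hm'.natDegree_pow, hd, hd', mul_comm]
    rfl

variable [CharP L ℓ]

theorem eval_vanishing_add (i : ℕ) (x y : L) : (vanishing ℓ β i).eval (x + y) =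
    (vanishing ℓ β i).eval x + (vanishing ℓ β i).eval y := by
  induction i with
  | zero => simp [vanishing]
  | succ i ih =>
    rw [eval_vanishing_succ, eval_vanishing_succ, eval_vanishing_succ, ih,
      add_pow_char]
    ring

theorem eval_vanishing_natCast_mul (i n : ℕ) (x : L) : (vanishing ℓ β i).eval (n * x) =
    n * (vanishing ℓ β i).eval x := by
  have := map_nsmul (AddMonoidHom.mk' (fun x => (vanishing ℓ β i).eval x)
    (eval_vanishing_add i)) n x
  simpa using this

theorem eval_vanishing_pt (i : ℕ) (w : Idx ℓ i) : (vanishing ℓ β i).eval (pt ℓ β i w) = 0 := by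
  have hℓ : ℓ ≠ 0 := (Fact.out : ℓ.Prime).ne_zero
  induction i with
  | zero => simp [vanishing, pt]
  | succ i ih =>
    rw [pt, eval_vanishing_add, eval_vanishing_natCast_mul, eval_vanishing_succ, ih,
      eval_vanishing_succ, pow_sub_one_mul hℓ, zero_pow hℓ]
    simp

theorem natCast_fin_injective : Function.Injective fun u : Fin ℓ => ((u : ℕ) : L) := by
  intro u u' h
  have h1 := (CharP.natCast_eq_natCast L ℓ).1 h
  rw [Nat.ModEq, Nat.mod_eq_of_lt u.2, Nat.mod_eq_of_lt u'.2] at h1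
  exact Fin.ext h1

theorem pt_injective (i : ℕ) (hβ : ∀ k < i, (vanishing ℓ β k).eval (β k) ≠ 0) :
    Function.Injective (pt ℓ β i) := by
  induction i with
  | zero => exact fun _ _ _ => rfl
  | succ i ih =>
    rintro ⟨w, u⟩ ⟨w', u'⟩ h
    simp only [pt] at h
    have h1 := congrArg (fun x => (vanishing ℓ β i).eval x) h
    simp only [eval_vanishing_add, eval_vanishing_pt, eval_vanishing_natCast_mul, zero_add] at h1
    have h2 := natCast_fin_injective (mul_right_cancel₀ (hβ i (Nat.lt_succ_self i)) h1)
    subst h2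
    exact Prod.ext (ih (fun k hk => hβ k (hk.trans (Nat.lt_succ_self i)))
      (add_right_cancel h)) rfl

theorem evalMatrix_zero (v : L) : evalMatrix ℓ β 0 v = 1 := by
  ext w m
  simp [evalMatrix, basis, show w = m from rfl]

theorem evalMatrix_succ (i : ℕ) (v : L) :
    evalMatrix ℓ β (i + 1) v =
      (blockDiagonal (fun u : Fin ℓ => evalMatrix ℓ β i (v + (u : ℕ) * β i)) *
      ((1 : Matrix (Idx ℓ i) (Idx ℓ i) L) ⊗ₖ Matrix.vandermonde fun u : Fin ℓ =>
        (vanishing ℓ β i).eval v + (u : ℕ) * (vanishing ℓ β i).eval (β i)) :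
      Matrix (Idx ℓ i × Fin ℓ) (Idx ℓ i × Fin ℓ) L) := by
  ext ⟨w, u⟩ ⟨m, a⟩
  have h : (blockDiagonal (fun u : Fin ℓ => evalMatrix ℓ β i (v + (u : ℕ) * β i)) *
      ((1 : Matrix (Idx ℓ i) (Idx ℓ i) L) ⊗ₖ Matrix.vandermonde fun u : Fin ℓ =>
        (vanishing ℓ β i).eval v + (u : ℕ) * (vanishing ℓ β i).eval (β i)) :
      Matrix (Idx ℓ i × Fin ℓ) (Idx ℓ i × Fin ℓ) L) (w, u) (m, a) =
      evalMatrix ℓ β i (v + (u : ℕ) * β i) w m *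
        ((vanishing ℓ β i).eval v + (u : ℕ) * (vanishing ℓ β i).eval (β i)) ^ (a : ℕ) := by
    simp [Matrix.mul_apply, Fintype.sum_prod_type, blockDiagonal_apply, Matrix.one_apply,
      vandermonde_apply]
  rw [h]
  simp only [evalMatrix, of_apply, basis, pt, eval_mul, eval_pow, eval_vanishing_add,
    eval_vanishing_pt, eval_vanishing_natCast_mul, zero_add]
  rw [add_right_comm, add_assoc v]

end Vanishing

section Cost

variable {L : Type*} [Field L] {Y : Type*}

/-- A matrix of constants as a matrix of constant functions. -/
def constMat (Y : Type*) {m n : Type*} (M : Matrix m n L) : Matrix m n (Y → L) :=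
  M.map (Pi.constRingHom Y L)

theorem constMat_mulVec {m n : Type*} [Fintype n] (M : Matrix m n L) (v : n → Y → L) (i : m)
    (y : Y) : (constMat Y M *ᵥ v) i y = (M *ᵥ fun j => v j y) i := by
  simp [constMat, mulVec, dotProduct]

theorem constMat_mul {m n o : Type*} [Fintype n] (M : Matrix m n L) (N : Matrix n o L) :
    constMat Y (M * N) = constMat Y M * constMat Y N := Matrix.map_mul

theorem biCost_one {m : Type*} [Fintype m] [DecidableEq m] {G : Set (Y → L)} :
    BiCost G (1 : Matrix m m (Y → L)) 0 := by
  refine ⟨fun v => ?_, fun v => ?_⟩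
  · rw [one_mulVec]
    exact Cost.of_subset Set.subset_union_right
  · rw [transpose_one, one_mulVec]
    exact Cost.of_subset Set.subset_union_right

theorem biCost_one_kronecker {m o : Type*} [Fintype m] [Fintype o] [DecidableEq m]
    {G : Set (Y → L)} (P : Matrix o o L) :
    BiCost G (constMat Y ((1 : Matrix m m L) ⊗ₖ P))
      (Fintype.card o ^ 2 * (4 * Fintype.card m)) := by
  have h : constMat Y ((1 : Matrix m m L) ⊗ₖ P) =
      blocks fun a b => Matrix.diagonal fun _ => Function.const Y (P a b) := by
    ext ⟨i, a⟩ ⟨j, b⟩ y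
    by_cases hij : i = j <;> simp [constMat, blocks, Matrix.diagonal, hij]
  rw [h]
  refine (BiCost.blocks fun a b => BiCost.diagonal_const fun _ => P a b).mono_cost (le_of_eq ?_)
  ring

theorem biCost_constMat_blockDiagonal {m o : Type*} [Fintype m] [Fintype o] [DecidableEq o]
    {G : Set (Y → L)} {c : ℕ} {T : o → Matrix m m L} (h : ∀ a, BiCost G (constMat Y (T a)) c) :
    BiCost G (constMat Y (blockDiagonal T)) (Fintype.card o * c) := by
  rw [constMat, blockDiagonal_map _ _ (map_zero _)]
  exact .blockDiagonal h

variable {ℓ : ℕ} [Fact ℓ.Prime] [CharP L ℓ] {β : ℕ → L}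

theorem biCost_evalMatrix (i : ℕ) (v : L) :
    BiCost ∅ (constMat Y (evalMatrix ℓ β i v)) (4 * i * ℓ ^ (i + 1)) := by
  induction i generalizing v with
  | zero =>
    rw [evalMatrix_zero, constMat, Matrix.map_one _ (map_zero _) (map_one _)]
    exact biCost_one.mono_cost (Nat.zero_le _)
  | succ i ih =>
    rw [evalMatrix_succ]
    have h := constMat_mul (Y := Y)
      (blockDiagonal (fun u : Fin ℓ => evalMatrix ℓ β i (v + (u : ℕ) * β i)))
      ((1 : Matrix (Idx ℓ i) (Idx ℓ i) L) ⊗ₖ Matrix.vandermonde fun u : Fin ℓ =>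
        (vanishing ℓ β i).eval v + (u : ℕ) * (vanishing ℓ β i).eval (β i))
    have h2 := (biCost_constMat_blockDiagonal fun u : Fin ℓ => ih (v + (u : ℕ) * β i)).mul
      (biCost_one_kronecker (m := Idx ℓ i) (Y := Y) (G := ∅)
        (Matrix.vandermonde fun u : Fin ℓ =>
          (vanishing ℓ β i).eval v + (u : ℕ) * (vanishing ℓ β i).eval (β i)))
    rw [← h] at h2
    refine BiCost.mono_cost h2 (le_of_eq ?_)
    rw [Fintype.card_fin, Idx.card]
    ring

theorem exists_evalMatrix_inv (i : ℕ) (hβ : ∀ k < i, (vanishing ℓ β k).eval (β k) ≠ 0) (v : L) :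
    ∃ N : Matrix (Idx ℓ i) (Idx ℓ i) L, N * evalMatrix ℓ β i v = 1 ∧
      BiCost ∅ (constMat Y N) (4 * i * ℓ ^ (i + 1)) := by
  induction i generalizing v with
  | zero =>
    refine ⟨1, by rw [evalMatrix_zero, one_mul], ?_⟩
    rw [constMat, Matrix.map_one _ (map_zero _) (map_one _)]
    exact biCost_one.mono_cost (Nat.zero_le _)
  | succ i ih =>
    choose N hN hcost using fun u : Fin ℓ =>
      ih (fun k hk => hβ k (hk.trans (Nat.lt_succ_self i))) (v + (u : ℕ) * β i)
    set P := Matrix.vandermonde fun u : Fin ℓ =>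
      (vanishing ℓ β i).eval v + (u : ℕ) * (vanishing ℓ β i).eval (β i) with hP
    have hdet : IsUnit P.det := by
      rw [isUnit_iff_ne_zero, hP, det_vandermonde_ne_zero_iff]
      intro u u' h
      exact natCast_fin_injective
        (mul_right_cancel₀ (hβ i (Nat.lt_succ_self i)) (add_left_cancel h))
    refine ⟨(((1 : Matrix (Idx ℓ i) (Idx ℓ i) L) ⊗ₖ P⁻¹) * blockDiagonal N :
      Matrix (Idx ℓ i × Fin ℓ) (Idx ℓ i × Fin ℓ) L), ?_, ?_⟩
    · rw [evalMatrix_succ]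
      change (((1 : Matrix (Idx ℓ i) (Idx ℓ i) L) ⊗ₖ P⁻¹) * blockDiagonal N) *
        (blockDiagonal (fun u : Fin ℓ => evalMatrix ℓ β i (v + (u : ℕ) * β i)) * (1 ⊗ₖ P)) =
        (1 : Matrix (Idx ℓ i × Fin ℓ) (Idx ℓ i × Fin ℓ) L)
      rw [mul_assoc, ← mul_assoc (blockDiagonal N), ← blockDiagonal_mul]
      simp only [hN]
      rw [← Pi.one_def, blockDiagonal_one, one_mul, ← mul_kronecker_mul, one_mul,
        Matrix.nonsing_inv_mul P hdet, one_kronecker_one]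
    · have h := constMat_mul (Y := Y) ((1 : Matrix (Idx ℓ i) (Idx ℓ i) L) ⊗ₖ P⁻¹)
        (blockDiagonal N)
      have h2 := (biCost_one_kronecker (m := Idx ℓ i) (Y := Y) (G := ∅) P⁻¹).mul
        (biCost_constMat_blockDiagonal hcost)
      rw [← h] at h2
      refine BiCost.mono_cost h2 (le_of_eq ?_)
      rw [Fintype.card_fin, Idx.card]
      ring

/-- Interpolation on a coset, in terms of `basis`. -/
theorem eq_sum_basis {i : ℕ} (hβ : ∀ k < i, (vanishing ℓ β k).eval (β k) ≠ 0) {v : L}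
    {N : Matrix (Idx ℓ i) (Idx ℓ i) L} (hN : N * evalMatrix ℓ β i v = 1) {g : L[X]}
    (hg : g.degree < (ℓ ^ i : ℕ)) :
    g = ∑ m, C ((N *ᵥ fun w => g.eval (v + pt ℓ β i w)) m) * basis ℓ β i m := by
  set c := N *ᵥ fun w => g.eval (v + pt ℓ β i w) with hc
  have hVc : evalMatrix ℓ β i v *ᵥ c = fun w => g.eval (v + pt ℓ β i w) := by
    rw [hc, mulVec_mulVec, mul_eq_one_comm.1 hN, one_mulVec]
  refine Polynomial.eq_of_degrees_lt_of_eval_index_eq (v := fun w => v + pt ℓ β i w)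
    Finset.univ ?_ ?_ ?_ ?_
  · exact fun a _ b _ hab => pt_injective i hβ (add_left_cancel hab)
  · simpa [Idx.card] using hg
  · rw [Finset.card_univ, Idx.card]
    refine (degree_sum_le _ _).trans_lt ((Finset.sup_lt_iff (WithBot.bot_lt_coe _)).2 ?_)
    intro m _
    rw [← smul_eq_C_mul]
    refine (degree_smul_le _ _).trans_lt ?_
    obtain ⟨hm, hd⟩ := basis_monic_natDegree (ℓ := ℓ) (β := β) i m
    rw [degree_eq_natDegree hm.ne_zero, hd]
    exact_mod_cast m.num_lt
  · intro w _
    rw [← congrFun hVc w]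
    simp only [eval_finsetSum, eval_mul, eval_C, mulVec, dotProduct, evalMatrix, of_apply]
    exact Finset.sum_congr rfl fun m _ => mul_comm _ _

/-- Extension of the values of a polynomial from one coset to another one. -/
theorem evalMatrix_mul_inv_mulVec {i : ℕ} (hβ : ∀ k < i, (vanishing ℓ β k).eval (β k) ≠ 0)
    {v : L} (v' : L) {N : Matrix (Idx ℓ i) (Idx ℓ i) L} (hN : N * evalMatrix ℓ β i v = 1)
    {g : L[X]} (hg : g.degree < (ℓ ^ i : ℕ)) :
    (evalMatrix ℓ β i v' * N) *ᵥ (fun w => g.eval (v + pt ℓ β i w)) =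
      fun w => g.eval (v' + pt ℓ β i w) := by
  ext w
  rw [← mulVec_mulVec]
  conv_rhs => rw [eq_sum_basis hβ hN hg]
  simp only [eval_finsetSum, eval_mul, eval_C, mulVec, dotProduct, evalMatrix, of_apply]
  exact Finset.sum_congr rfl fun m _ => mul_comm _ _

end Cost

end AdditiveFFT

/-! ### Multiplication by Cauchy matrices -/

namespace AdditiveFFT

open StraightLine Matrix Polynomial

set_option linter.unusedSectionVars false

section Cauchy

variable {L : Type*} [Field L] {Y : Type*} (ℓ : ℕ) (β : ℕ → L)

/-- The values on a coset of the monic polynomial with the roots `s a`. -/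
def nodeProd (i : ℕ) (s : Idx ℓ i → Y → L) (v : L) (w : Idx ℓ i) : Y → L :=
  fun y => ∏ a, (v + pt ℓ β i w - s a y)

/-- The Cauchy matrix of the elements of a coset and the elements `s a`. -/
def cauchy (i : ℕ) (s : Idx ℓ i → Y → L) (v : L) : Matrix (Idx ℓ i) (Idx ℓ i) (Y → L) :=
  Matrix.of fun w a y => (v + pt ℓ β i w - s a y)⁻¹

variable {ℓ β} [Fact ℓ.Prime] [CharP L ℓ]

theorem pt_mem {B : AddSubgroup L} {i : ℕ} (hB : ∀ k < i, β k ∈ B) (w : Idx ℓ i) :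
    pt ℓ β i w ∈ B := by
  induction i with
  | zero => exact B.zero_mem
  | succ i ih =>
    refine B.add_mem (ih (fun k hk => hB k (hk.trans (Nat.lt_succ_self i))) w.1) ?_
    rw [← nsmul_eq_mul]
    exact B.nsmul_mem (hB i (Nat.lt_succ_self i)) _

theorem coset_sub_ne_zero {B : AddSubgroup L} {i : ℕ} (hB : ∀ k < i, β k ∈ B) {v x : L}
    (hv : v ∉ B) (hx : x ∈ B) (w : Idx ℓ i) : v + pt ℓ β i w - x ≠ 0 := by
  intro h
  apply hv
  have : v = x - pt ℓ β i w := by linear_combination h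
  rw [this]
  exact B.sub_mem hx (pt_mem hB w)

theorem degree_prod_erase_lt {i : ℕ} (s : Idx ℓ i → L) (a : Idx ℓ i) :
    (∏ b ∈ Finset.univ.erase a, (X - C (s b))).degree < ((ℓ ^ i : ℕ) : WithBot ℕ) := by
  have hpos : 0 < ℓ ^ i := pow_pos (Fact.out : ℓ.Prime).pos i
  rw [degree_prod]
  simp only [degree_X_sub_C, Finset.sum_const, Finset.card_erase_of_mem (Finset.mem_univ a),
    Finset.card_univ, Idx.card, nsmul_eq_mul, mul_one]
  exact_mod_cast Nat.sub_lt hpos Nat.one_pos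

theorem nodeProd_mul_inv {B : AddSubgroup L} {i : ℕ} (hB : ∀ k < i, β k ∈ B)
    {s : Idx ℓ i → Y → L} (hs : ∀ a y, s a y ∈ B) {v : L} (hv : v ∉ B) (w a : Idx ℓ i) (y : Y) :
    nodeProd ℓ β i s v w y * (v + pt ℓ β i w - s a y)⁻¹ =
      (∏ b ∈ Finset.univ.erase a, (X - C (s b y))).eval (v + pt ℓ β i w) := by
  rw [nodeProd, ← Finset.mul_prod_erase _ _ (Finset.mem_univ a), mul_comm, ← mul_assoc,
    inv_mul_cancel₀ (coset_sub_ne_zero hB hv (hs a y) w), one_mul, eval_prod]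
  simp

variable {B : AddSubgroup L} {i : ℕ} {s : Idx ℓ i → Y → L} {v v' : L}
  {N : Matrix (Idx ℓ i) (Idx ℓ i) L}

theorem cauchy_extend (hB : ∀ k < i, β k ∈ B)
    (hβ : ∀ k < i, (vanishing ℓ β k).eval (β k) ≠ 0) (hs : ∀ a y, s a y ∈ B) (hv : v ∉ B)
    (hv' : v' ∉ B) (hN : N * evalMatrix ℓ β i v = 1) :
    cauchy ℓ β i s v' = Matrix.diagonal (fun w => (nodeProd ℓ β i s v' w)⁻¹) *
      (constMat Y (evalMatrix ℓ β i v' * N) * Matrix.diagonal (nodeProd ℓ β i s v)) *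
      cauchy ℓ β i s v := by
  ext w a y
  rw [mul_assoc, diagonal_mul, mul_assoc, Pi.mul_apply, Pi.inv_apply]
  have h1 : (constMat Y (evalMatrix ℓ β i v' * N) * (Matrix.diagonal (nodeProd ℓ β i s v) *
      cauchy ℓ β i s v)) w a y = nodeProd ℓ β i s v' w y * (v' + pt ℓ β i w - s a y)⁻¹ := by
    rw [nodeProd_mul_inv hB hs hv', ← congrFun (evalMatrix_mul_inv_mulVec hβ v' hN
      (degree_prod_erase_lt (fun b => s b y) a)) w]
    simp only [← nodeProd_mul_inv hB hs hv]
    rw [Matrix.mul_apply, Finset.sum_apply]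
    simp only [mulVec, dotProduct, diagonal_mul]
    rfl
  have h2 : nodeProd ℓ β i s v' w y ≠ 0 :=
    Finset.prod_ne_zero_iff.2 fun b _ => coset_sub_ne_zero hB hv' (hs b y) w
  rw [h1, inv_mul_cancel_left₀ h2]
  rfl

theorem nodeProd_extend (hB : ∀ k < i, β k ∈ B)
    (hβ : ∀ k < i, (vanishing ℓ β k).eval (β k) ≠ 0) (hs : ∀ a y, s a y ∈ B) (hv : v ∉ B)
    (hv' : v' ∉ B) (hN : N * evalMatrix ℓ β i v = 1) (a : Idx ℓ i) (w : Idx ℓ i) :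
    nodeProd ℓ β i s v' w = (Function.const Y (v' + pt ℓ β i w) - s a) *
      (constMat Y (evalMatrix ℓ β i v' * N) *ᵥ fun w =>
        nodeProd ℓ β i s v w * (Function.const Y (v + pt ℓ β i w) - s a)⁻¹) w := by
  ext y
  rw [Pi.mul_apply, constMat_mulVec]
  simp only [Pi.mul_apply, Pi.inv_apply, Pi.sub_apply, Function.const_apply,
    nodeProd_mul_inv hB hs hv]
  rw [evalMatrix_mul_inv_mulVec hβ v' hN (degree_prod_erase_lt (fun b => s b y) a)]
  beta_reduce
  rw [← nodeProd_mul_inv hB hs hv', mul_comm, mul_assoc,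
    inv_mul_cancel₀ (coset_sub_ne_zero hB hv' (hs a y) w), mul_one]

theorem biCost_transfer (hN : BiCost ∅ (constMat Y N) (4 * i * ℓ ^ (i + 1))) (v' : L) :
    BiCost (∅ : Set (Y → L)) (constMat Y (evalMatrix ℓ β i v' * N)) (8 * i * ℓ ^ (i + 1)) := by
  rw [constMat_mul]
  refine ((biCost_evalMatrix i v').mul hN).mono_cost (le_of_eq ?_)
  ring

theorem nodeProd_extend_cost (hB : ∀ k < i, β k ∈ B)
    (hβ : ∀ k < i, (vanishing ℓ β k).eval (β k) ≠ 0) (hs : ∀ a y, s a y ∈ B) (hv : v ∉ B)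
    (hv' : v' ∉ B) (hN : N * evalMatrix ℓ β i v = 1)
    (hNc : BiCost ∅ (constMat Y N) (4 * i * ℓ ^ (i + 1))) :
    Cost (Set.range s ∪ Set.range (nodeProd ℓ β i s v)) (8 * ℓ ^ i + 8 * i * ℓ ^ (i + 1))
      (Set.range (nodeProd ℓ β i s v') ∪
        Set.range fun w => (nodeProd ℓ β i s v' w)⁻¹) := by
  have : NeZero ℓ := ⟨(Fact.out : ℓ.Prime).ne_zero⟩
  set a := Idx.zeros (ℓ := ℓ) i
  set q : Idx ℓ i → Y → L := fun w =>
    nodeProd ℓ β i s v w * (Function.const Y (v + pt ℓ β i w) - s a)⁻¹ with hq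
  set G := Set.range s ∪ Set.range (nodeProd ℓ β i s v)
  have h1 : Cost G (ℓ ^ i * 4) (Set.range q) := by
    rw [← Idx.card]
    exact Cost.range fun w => (Cost.mem (Or.inr ⟨w, rfl⟩)).mul
      (((Cost.const _).sub (Cost.mem (Or.inl ⟨a, rfl⟩))).inv)
  have h2 : Cost G (ℓ ^ i * 4 + 8 * i * ℓ ^ (i + 1))
      (Set.range (constMat Y (evalMatrix ℓ β i v' * N) *ᵥ q)) :=
    h1.trans ((biCost_transfer hNc v').fwd.apply (Set.empty_subset _) fun w => Or.inr ⟨w, rfl⟩)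
  have h3 : Cost G (ℓ ^ i * 4 + 8 * i * ℓ ^ (i + 1) + ℓ ^ i * 3)
      (Set.range (nodeProd ℓ β i s v')) := by
    refine h2.trans ?_
    rw [← Idx.card]
    refine Cost.range fun w => ?_
    rw [nodeProd_extend hB hβ hs hv hv' hN a w]
    exact ((Cost.const _).sub (Cost.mem (Or.inl (Or.inl ⟨a, rfl⟩)))).mul
      (Cost.mem (Or.inr ⟨w, rfl⟩))
  refine (h3.union_trans (T' := Set.range fun w => (nodeProd ℓ β i s v' w)⁻¹)
    (c' := ℓ ^ i * 1) ?_).mono_cost (le_of_eq ?_)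
  · rw [← Idx.card]
    exact Cost.range fun w => (Cost.mem (Or.inr ⟨w, rfl⟩)).inv
  · ring

theorem nodeProd_succ (s : Idx ℓ (i + 1) → Y → L) (w : Idx ℓ i) (u : Fin ℓ) :
    nodeProd ℓ β (i + 1) s v (w, u) =
      ∏ a : Fin ℓ, nodeProd ℓ β i (fun x => s (x, a)) (v + (u : ℕ) * β i) w := by
  ext y
  simp only [nodeProd, Finset.prod_apply, pt]
  rw [Finset.prod_comm, ← Fintype.prod_prod_type']
  refine Finset.prod_congr rfl fun x _ => ?_
  rw [add_right_comm, add_assoc v]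

theorem nodeProd_cost_arith {ℓ : ℕ} (i n : ℕ) (hℓ : 2 ≤ ℓ) :
    ℓ * (12 * (i ^ 2 + 1) * (n * ℓ ^ 2)) + ℓ * (ℓ * (8 * n + 8 * i * (n * ℓ))) +
      n * ℓ * (ℓ + 1) ≤ 12 * ((i + 1) ^ 2 + 1) * (n * ℓ * ℓ ^ 2) := by
  have h1 : 2 * ℓ ≤ ℓ ^ 2 := by nlinarith
  have h2 : 2 * ℓ ^ 2 ≤ ℓ ^ 3 := by nlinarith [sq_nonneg ℓ]
  have h3 : 8 * ℓ ^ 2 + 8 * i * ℓ ^ 3 + ℓ ^ 2 + ℓ ≤ 12 * (2 * i + 1) * ℓ ^ 3 := by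
    nlinarith [Nat.zero_le (i * ℓ ^ 3)]
  nlinarith [Nat.mul_le_mul_left n h3]

theorem cauchy_cost_arith {ℓ : ℕ} (i n : ℕ) (hℓ : 2 ≤ ℓ) :
    ℓ ^ 2 * (n + (8 * i * (n * ℓ) + n) + 2 * n) + ℓ * (12 * (i ^ 2 + 1) * (n * ℓ ^ 2)) ≤
      12 * ((i + 1) ^ 2 + 1) * (n * ℓ * ℓ ^ 2) := by
  have h2 : 2 * ℓ ^ 2 ≤ ℓ ^ 3 := by nlinarith [sq_nonneg ℓ]
  have h3 : 4 * ℓ ^ 2 + 8 * i * ℓ ^ 3 ≤ 12 * (2 * i + 1) * ℓ ^ 3 := by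
    nlinarith [Nat.zero_le (i * ℓ ^ 3)]
  nlinarith [Nat.mul_le_mul_left n h3]

/-- Values of the node polynomial and multiplication by the Cauchy matrix. -/
theorem cauchy_cost (i : ℕ) (hB : ∀ k < i, β k ∈ B)
    (hβ : ∀ k < i, (vanishing ℓ β k).eval (β k) ≠ 0) {s : Idx ℓ i → Y → L}
    (hs : ∀ a y, s a y ∈ B) (hv : v ∉ B) :
    ∃ G, Cost (Set.range s) (12 * (i ^ 2 + 1) * ℓ ^ (i + 2)) G ∧
      (∀ w, nodeProd ℓ β i s v w ∈ G) ∧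
      BiCost G (cauchy ℓ β i s v) (12 * (i ^ 2 + 1) * ℓ ^ (i + 2)) := by
  have hℓ : 2 ≤ ℓ := (Fact.out : ℓ.Prime).two_le
  induction i with
  | zero =>
    have h0 : nodeProd ℓ β 0 s v () = Function.const Y (v + 0) - s () := by
      ext y
      simp [nodeProd, pt]
    have h12 : 12 ≤ 12 * (0 ^ 2 + 1) * ℓ ^ (0 + 2) := by
      have := Nat.one_le_pow 2 ℓ (by omega)
      norm_num
      omega
    have hc : Cost (Set.range s) 2 {nodeProd ℓ β 0 s v ()} := by
      rw [h0]
      exact (Cost.const _).sub (Cost.mem (Set.mem_range_self _))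
    refine ⟨{nodeProd ℓ β 0 s v ()} ∪ {(nodeProd ℓ β 0 s v ())⁻¹},
      (hc.union hc.inv).mono_cost (by omega), fun w => Or.inl rfl, ?_⟩
    have h1 : cauchy ℓ β 0 s v = Matrix.diagonal fun _ => (nodeProd ℓ β 0 s v ())⁻¹ := by
      ext w a y
      simp [cauchy, nodeProd, Matrix.diagonal, show w = a from rfl, show a = () from rfl, pt]
    rw [h1]
    refine (BiCost.diagonal fun _ => Or.inr rfl).mono_cost ?_
    rw [Idx.card, pow_zero]
    omega
  | succ i ih =>
    have hB' : ∀ k < i, β k ∈ B := fun k hk => hB k (hk.trans (Nat.lt_succ_self i))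
    have hβ' : ∀ k < i, (vanishing ℓ β k).eval (β k) ≠ 0 :=
      fun k hk => hβ k (hk.trans (Nat.lt_succ_self i))
    have hvu : ∀ u : Fin ℓ, v + (u : ℕ) * β i ∉ B := fun u h => hv (by
      rw [← nsmul_eq_mul] at h
      simpa using B.sub_mem h (B.nsmul_mem (hB i (Nat.lt_succ_self i)) (u : ℕ)))
    set σ : Fin ℓ → Idx ℓ i → Y → L := fun a x => s (x, a) with hσ
    have hσB : ∀ a x y, σ a x y ∈ B := fun a x y => hs (x, a) y
    choose G hG hD hC using fun a : Fin ℓ => ih hB' hβ' (hσB a)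
    obtain ⟨N, hN, hNc⟩ := exists_evalMatrix_inv (Y := Y) i hβ' v
    set E : Fin ℓ → Fin ℓ → Set (Y → L) := fun a u =>
      Set.range (nodeProd ℓ β i (σ a) (v + (u : ℕ) * β i)) ∪
        Set.range fun w => (nodeProd ℓ β i (σ a) (v + (u : ℕ) * β i) w)⁻¹ with hE
    have hcE : Cost (Set.range s) (ℓ * (12 * (i ^ 2 + 1) * ℓ ^ (i + 2)) +
        ℓ * (ℓ * (8 * ℓ ^ i + 8 * i * ℓ ^ (i + 1)))) ((⋃ a, G a) ∪ ⋃ a, ⋃ u, E a u) := by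
      have h1 := Cost.iUnion (G := Set.range s) fun a => (hG a).mono_left
        (Set.range_subset_iff.2 fun x => ⟨(x, a), rfl⟩)
      rw [Fintype.card_fin] at h1
      refine h1.union_trans ?_
      have h2 := Cost.iUnion (G := Set.range s ∪ ⋃ a, G a) (T := fun a => ⋃ u, E a u) fun a =>
        Cost.iUnion fun u => (nodeProd_extend_cost hB' hβ' (hσB a) hv (hvu u) hN hNc).mono_left
          (Set.union_subset_union (Set.range_subset_iff.2 fun x => ⟨(x, a), rfl⟩)
            (Set.range_subset_iff.2 fun w => Set.mem_iUnion.2 ⟨a, hD a w⟩))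
      rwa [Fintype.card_fin] at h2
    have hcD : Cost ((⋃ a, G a) ∪ ⋃ a, ⋃ u, E a u) (ℓ ^ (i + 1) * (ℓ + 1))
        (Set.range (nodeProd ℓ β (i + 1) s v)) := by
      rw [← Idx.card (i + 1)]
      refine Cost.range fun ⟨w, u⟩ => ?_
      rw [nodeProd_succ]
      refine (Cost.prod (c := 0) Finset.univ fun a _ => Cost.mem (Or.inr ?_)).mono_cost
        (by simp)
      exact Set.mem_iUnion.2 ⟨a, Set.mem_iUnion.2 ⟨u, Or.inl ⟨w, rfl⟩⟩⟩
    refine ⟨_, (hcE.union_trans (hcD.mono_left Set.subset_union_right)).mono_cost ?_,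
      fun w => Or.inr ⟨w, rfl⟩, ?_⟩
    · simpa only [pow_add, pow_one] using nodeProd_cost_arith i (ℓ ^ i) hℓ
    · have h1 : cauchy ℓ β (i + 1) s v = blocks (fun u a : Fin ℓ =>
          Matrix.diagonal (fun w => (nodeProd ℓ β i (σ a) (v + (u : ℕ) * β i) w)⁻¹) *
          (constMat Y (evalMatrix ℓ β i (v + (u : ℕ) * β i) * N) *
            Matrix.diagonal (nodeProd ℓ β i (σ a) v))) *
          blockDiagonal fun a => cauchy ℓ β i (σ a) v := by
        ext ⟨w, u⟩ ⟨x, a⟩ : 2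
        have h2 := congrFun (congrFun (cauchy_extend hB' hβ' (hσB a) hv (hvu u) hN) w) x
        rw [Matrix.mul_apply] at h2 ⊢
        rw [Fintype.sum_prod_type]
        simp only [blockDiagonal_apply, blocks, of_apply, mul_ite, mul_zero, Finset.sum_ite_eq',
          Finset.mem_univ, if_true]
        rw [← h2]
        simp only [cauchy, of_apply, pt, hσ]
        rw [add_right_comm, add_assoc v]
      rw [h1]
      set G' := ((⋃ a, G a) ∪ ⋃ a, ⋃ u, E a u) ∪ Set.range (nodeProd ℓ β (i + 1) s v)
      have h3 := BiCost.blocks (G := G') fun u a : Fin ℓ =>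
        (BiCost.diagonal (d := fun w => (nodeProd ℓ β i (σ a) (v + (u : ℕ) * β i) w)⁻¹)
          fun w => Or.inl (Or.inr (Set.mem_iUnion.2 ⟨a, Set.mem_iUnion.2 ⟨u, Or.inr ⟨w, rfl⟩⟩⟩))).mul
        (((biCost_transfer (β := β) hNc (v + (u : ℕ) * β i)).mono_left (Set.empty_subset _)).mul
          (BiCost.diagonal (d := nodeProd ℓ β i (σ a) v) fun w =>
            Or.inl (Or.inl (Set.mem_iUnion.2 ⟨a, hD a w⟩))))
      have h4 := BiCost.blockDiagonal (G := G') fun a : Fin ℓ => (hC a).mono_left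
        fun f hf => Or.inl (Or.inl (Set.mem_iUnion.2 ⟨a, hf⟩))
      refine BiCost.mono_cost (h3.mul h4) ?_
      simp only [Fintype.card_fin, Idx.card]
      simpa only [pow_add, pow_one] using cauchy_cost_arith i (ℓ ^ i) hℓ

end Cauchy

end AdditiveFFT

/-! ### Conversion to the monomial basis -/

namespace AdditiveFFT

open StraightLine Polynomial

set_option linter.unusedSectionVars false

section Monomial

variable {L : Type*} [Field L] {Y : Type*} {ℓ : ℕ} {β : ℕ → L}

theorem horner_cost {G : Set (Y → L)} (g : ℕ → Y → L[X]) (z : ℕ → L) (i D : ℕ)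
    (hg : ∀ k, ∀ N < D, Cost G 1 {fun y => (g k y).coeff N}) (k : ℕ) :
    Cost G (k * (D * (3 * i + 6)) + 1) (Set.range fun (N : Fin D) y =>
      (∑ b ∈ Finset.range k, g b y *
        (∑ e ∈ Finset.range (i + 1), C (z e) * X ^ ℓ ^ e) ^ (k - 1 - b)).coeff N) := by
  induction k with
  | zero =>
    refine ((Cost.const (G := G) 0).mono_right (T := {Function.const Y 0}) ?_).mono_cost
      (by simp)
    rintro _ ⟨N, rfl⟩
    simp
    rfl
  | succ k ih =>
    set Z : L[X] := ∑ e ∈ Finset.range (i + 1), C (z e) * X ^ ℓ ^ e with hZ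
    set H : Y → L[X] := fun y => ∑ b ∈ Finset.range k, g b y * Z ^ (k - 1 - b) with hH
    have hrec : ∀ y, ∑ b ∈ Finset.range (k + 1), g b y * Z ^ (k + 1 - 1 - b) =
        (∑ e ∈ Finset.range (i + 1), C (z e) * (H y * X ^ ℓ ^ e)) + g k y := by
      intro y
      rw [Finset.sum_range_succ]
      congr 1
      · have : H y * Z = ∑ e ∈ Finset.range (i + 1), C (z e) * (H y * X ^ ℓ ^ e) := by
          rw [hZ, Finset.mul_sum]
          exact Finset.sum_congr rfl fun e _ => by ring
        rw [← this, hH, Finset.sum_mul]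
        refine Finset.sum_congr rfl fun b hb => ?_
        have hb := Finset.mem_range.1 hb
        rw [mul_assoc, ← pow_succ]
        congr 2
        omega
      · simp
    have hcost : k * (D * (3 * i + 6)) + 1 + D * (3 * i + 6) =
        (k + 1) * (D * (3 * i + 6)) + 1 := by ring
    rw [← hcost]
    refine ih.trans ?_
    have := Cost.range (ι := Fin D) (c := 3 * i + 6)
      (G := G ∪ Set.range fun (N : Fin D) y => (H y).coeff N)
      (f := fun N y => (∑ b ∈ Finset.range (k + 1), g b y * Z ^ (k + 1 - 1 - b)).coeff N) ?_
    · rwa [Fintype.card_fin] at this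
    intro N
    have hN : (fun y => (∑ b ∈ Finset.range (k + 1), g b y * Z ^ (k + 1 - 1 - b)).coeff N) =
        (∑ e ∈ Finset.range (i + 1), fun y => z e * (H y * X ^ ℓ ^ e).coeff N) +
          fun y => (g k y).coeff N := by
      ext y
      rw [hrec, coeff_add, finsetSum_coeff, Pi.add_apply, Finset.sum_apply]
      simp only [coeff_C_mul]
    rw [hN]
    refine (Cost.add (Cost.sum (c := 2) _ fun e _ => ?_)
      ((hg k N N.2).mono_left Set.subset_union_left)).mono_cost ?_
    · by_cases he : ℓ ^ e ≤ (N : ℕ)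
      · simp only [coeff_mul_X_pow', if_pos he]
        exact (Cost.const (z e)).mul (g := fun y => (H y).coeff (N - ℓ ^ e))
          (Cost.mem (Or.inr ⟨⟨N - ℓ ^ e, (Nat.sub_le _ _).trans_lt N.2⟩, rfl⟩))
      · simp only [coeff_mul_X_pow', if_neg he, mul_zero]
        exact (Cost.const 0).mono_cost (by norm_num)
    · rw [Finset.card_range]
      omega

variable [Fact ℓ.Prime] [CharP L ℓ]

theorem exists_vanishing_eq_sum (i : ℕ) : ∃ z : ℕ → L,
    vanishing ℓ β i = ∑ e ∈ Finset.range (i + 1), C (z e) * X ^ ℓ ^ e := by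
  induction i with
  | zero => exact ⟨fun _ => 1, by simp [vanishing]⟩
  | succ i ih =>
    obtain ⟨z, hz⟩ := ih
    set d := (vanishing ℓ β i).eval (β i) ^ (ℓ - 1) with hd
    refine ⟨fun e => (if e = 0 then 0 else z (e - 1) ^ ℓ) - (if e = i + 1 then 0 else d * z e), ?_⟩
    rw [vanishing, ← hd, hz, sum_pow_char]
    simp only [C_sub, sub_mul, Finset.sum_sub_distrib]
    congr 1
    · rw [Finset.sum_range_succ' _ (i + 1)]
      simp only [if_true, C_0, zero_mul, add_zero]
      refine Finset.sum_congr rfl fun e _ => ?_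
      rw [mul_pow, ← C_pow, ← pow_mul, ← pow_succ]
      simp
    · rw [Finset.sum_range_succ _ (i + 1)]
      simp only [if_true, C_0, zero_mul, add_zero]
      rw [Finset.mul_sum]
      refine Finset.sum_congr rfl fun e he => ?_
      rw [if_neg (Finset.mem_range.1 he).ne, C_mul, mul_assoc]

theorem coeff_cost (i : ℕ) (c : Idx ℓ i → Y → L) :
    Cost (Set.range c) (7 * i ^ 2 * ℓ ^ (i + 1)) (Set.range fun (N : Fin (ℓ ^ i)) y =>
      (∑ m, C (c m y) * basis ℓ β i m).coeff N) := by
  have hℓ : 1 ≤ ℓ := (Fact.out : ℓ.Prime).one_le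
  induction i with
  | zero =>
    refine (Cost.of_subset ?_).mono_cost (Nat.zero_le _)
    rintro _ ⟨N, rfl⟩
    refine ⟨(), ?_⟩
    ext y
    have hN : (N : ℕ) = 0 := Nat.lt_one_iff.1 N.2
    have : ∑ m : Idx ℓ 0, C (c m y) * basis ℓ β 0 m = C (c () y) := by
      simp [basis]
    beta_reduce
    rw [this, hN, coeff_C_zero]
  | succ i ih =>
    set f : Fin ℓ → Y → L[X] := fun a y => ∑ m, C (c (m, a) y) * basis ℓ β i m with hf
    set G : Set (Y → L) := ⋃ a, Set.range fun (N : Fin (ℓ ^ i)) y => (f a y).coeff N with hG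
    have h1 : Cost (Set.range c) (ℓ * (7 * i ^ 2 * ℓ ^ (i + 1))) G := by
      have := Cost.iUnion (G := Set.range c) fun a : Fin ℓ =>
        (ih fun m => c (m, a)).mono_left (Set.range_subset_iff.2 fun m => ⟨(m, a), rfl⟩)
      rwa [Fintype.card_fin] at this
    have hdeg : ∀ a y, ∀ N ≥ ℓ ^ i, (f a y).coeff N = 0 := by
      intro a y N hN
      rw [hf, finsetSum_coeff]
      refine Finset.sum_eq_zero fun m _ => ?_
      obtain ⟨_, hd⟩ := basis_monic_natDegree (ℓ := ℓ) (β := β) i m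
      rw [coeff_C_mul, coeff_eq_zero_of_natDegree_lt, mul_zero]
      rw [hd]
      exact m.num_lt.trans_le hN
    obtain ⟨z, hz⟩ := exists_vanishing_eq_sum (ℓ := ℓ) (β := β) i
    have h2 := horner_cost (ℓ := ℓ) (G := Set.range c ∪ G)
      (fun k y => if h : ℓ - 1 - k < ℓ then f ⟨ℓ - 1 - k, h⟩ y else 0) z i (ℓ ^ (i + 1)) ?_ ℓ
    · refine ((h1.trans h2).mono_cost ?_).mono_right ?_
      · have h3 : 1 ≤ ℓ ^ (i + 2) := Nat.one_le_pow _ _ hℓ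
        calc _ ≤ ℓ * (7 * i ^ 2 * ℓ ^ (i + 1)) + (ℓ * (ℓ ^ (i + 1) * (3 * i + 6)) + ℓ ^ (i + 2)) :=
            by omega
          _ = ℓ ^ (i + 2) * (7 * i ^ 2 + 3 * i + 7) := by ring
          _ ≤ ℓ ^ (i + 2) * (7 * (i + 1) ^ 2) := Nat.mul_le_mul_left _ (by nlinarith)
          _ = _ := by ring
      · rintro _ ⟨N, rfl⟩
        refine ⟨N, ?_⟩
        ext y
        dsimp only
        congr 1
        rw [← hz, ← Finset.sum_range_reflect]
        rw [Finset.sum_range]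
        have : ∑ m : Idx ℓ (i + 1), C (c m y) * basis ℓ β (i + 1) m =
            ∑ a : Fin ℓ, f a y * vanishing ℓ β i ^ (a : ℕ) := by
          refine (Fintype.sum_prod_type_right _).trans ?_
          refine Finset.sum_congr rfl fun a _ => ?_
          rw [hf, Finset.sum_mul]
          exact Finset.sum_congr rfl fun m _ => by rw [basis, mul_assoc]
        rw [this]
        refine Finset.sum_congr rfl fun a _ => ?_
        have ha : ℓ - 1 - (ℓ - 1 - (a : ℕ)) = a := by omega
        simp only [ha, a.2, dif_pos]
    · intro k N _
      have hk : ℓ - 1 - k < ℓ := by omega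
      simp only [hk, dif_pos]
      by_cases hN : N < ℓ ^ i
      · have hmem : (fun y => (f ⟨ℓ - 1 - k, hk⟩ y).coeff N) ∈ G :=
          Set.mem_iUnion.2 ⟨_, ⟨N, hN⟩, rfl⟩
        exact (Cost.mem (Or.inr hmem)).mono_cost zero_le_one
      · simp only [hdeg _ _ N (not_lt.1 hN)]
        exact Cost.const 0

end Monomial

end AdditiveFFT

/-! ### Interpolation through given points by a polynomial with free parameters -/

namespace AdditiveFFT

open StraightLine Matrix Polynomial

set_option linter.unusedSectionVars false

@[to_additive]
theorem Idx.prod_dite {M : Type*} [CommMonoid M] {ℓ i j : ℕ} (hj : j ≤ ℓ ^ i) (f : Fin j → M)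
    (c : M) : ∏ a : Idx ℓ i, (if h : a.num < j then f ⟨a.num, h⟩ else c) =
      (∏ x, f x) * c ^ (ℓ ^ i - j) := by
  have h1 : ∏ a : Idx ℓ i, (if h : a.num < j then f ⟨a.num, h⟩ else c) =
      ∏ x ∈ Finset.range (ℓ ^ i), (if h : x < j then f ⟨x, h⟩ else c) :=
    Finset.prod_nbij Idx.num (fun a _ => Finset.mem_range.2 a.num_lt)
      Idx.num_injective.injOn
      (fun n hn => by
        obtain ⟨w, hw⟩ := Idx.exists_num_eq (Finset.mem_range.1 hn)
        exact ⟨w, Finset.mem_coe.2 (Finset.mem_univ w), hw⟩) fun _ _ => rfl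
  rw [h1, ← Finset.prod_range_mul_prod_Ico _ hj]
  congr 1
  · rw [Finset.prod_range]
    exact Finset.prod_congr rfl fun x _ => by rw [dif_pos x.2]
  · rw [Finset.prod_congr rfl fun x hx => dif_neg (not_lt.2 (Finset.mem_Ico.1 hx).1)]
    simp

section Solution

variable {K : Type*} [Field K] {j k : ℕ}

/-- The monic polynomial with the roots `s i`. -/
noncomputable def rootPoly (s : Fin j → K) : K[X] := ∏ i, (X - C (s i))

/-- The monic polynomial with the roots `s i'` for `i' ≠ i`. -/
noncomputable def coPoly (s : Fin j → K) (i : Fin j) : K[X] :=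
  ∏ i' ∈ Finset.univ.erase i, (X - C (s i'))

theorem rootPoly_eq (s : Fin j → K) (i : Fin j) :
    rootPoly s = (X - C (s i)) * coPoly s i :=
  (Finset.mul_prod_erase _ (fun i => X - C (s i)) (Finset.mem_univ i)).symm

theorem eval_rootPoly_self (s : Fin j → K) (i : Fin j) : (rootPoly s).eval (s i) = 0 := by
  simp [rootPoly_eq s i]

theorem eval_coPoly_of_ne (s : Fin j → K) {i i' : Fin j} (h : i' ≠ i) :
    (coPoly s i).eval (s i') = 0 := by
  rw [coPoly, eval_prod]
  exact Finset.prod_eq_zero (Finset.mem_erase.2 ⟨h, Finset.mem_univ i'⟩) (by simp)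

theorem eval_coPoly_self_ne_zero {s : Fin j → K} (hs : Function.Injective s) (i : Fin j) :
    (coPoly s i).eval (s i) ≠ 0 := by
  rw [coPoly, eval_prod]
  refine Finset.prod_ne_zero_iff.2 fun i' hi' => ?_
  simpa [sub_eq_zero] using fun h => (Finset.mem_erase.1 hi').1 (hs h).symm

theorem rootPoly_ne_zero (s : Fin j → K) : rootPoly s ≠ 0 :=
  (monic_prod_of_monic _ _ fun i _ => monic_X_sub_C (s i)).ne_zero

theorem degree_rootPoly (s : Fin j → K) : (rootPoly s).degree = j := by
  simp [rootPoly, degree_prod]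

theorem degree_coPoly_lt (s : Fin j → K) (i : Fin j) : (coPoly s i).degree < j := by
  rw [coPoly, degree_prod]
  simp only [degree_X_sub_C, Finset.sum_const, Finset.card_erase_of_mem (Finset.mem_univ i),
    Finset.card_univ, Fintype.card_fin, nsmul_eq_mul, mul_one]
  exact_mod_cast Nat.sub_lt i.pos Nat.one_pos

variable (ℓ : ℕ) (β : ℕ → K) (m : ℕ)

/-- The coefficients in `basis` of the free part of the solution. -/
def freeCoeff (v : Fin k → K) (a : Idx ℓ m) : K :=
  if h : a.num < k - j then v ⟨j + a.num, by omega⟩ else 0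

/-- The free part of the solution. -/
noncomputable def freePoly (v : Fin k → K) : K[X] :=
  ∑ a, C (freeCoeff (j := j) ℓ m v a) * basis ℓ β m a

variable (hjk : j ≤ k)

/-- The polynomial with the values `v i` at the points `s i` for `i < j` and with the free
parameters `v i` for `j ≤ i < k`. -/
noncomputable def solution (s : Fin j → K) (v : Fin k → K) : K[X] :=
  ∑ i, C (v (Fin.castLE hjk i) * ((coPoly s i).eval (s i))⁻¹) * coPoly s i +
    rootPoly s * freePoly (j := j) ℓ β m v

variable {ℓ β m}

theorem eval_solution {s : Fin j → K} (hs : Function.Injective s) (v : Fin k → K) (i : Fin j) :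
    (solution ℓ β m hjk s v).eval (s i) = v (Fin.castLE hjk i) := by
  rw [solution, eval_add, eval_mul, eval_rootPoly_self, zero_mul, add_zero, eval_finsetSum,
    Finset.sum_eq_single i]
  · rw [eval_mul, eval_C, inv_mul_cancel_right₀ (eval_coPoly_self_ne_zero hs i)]
  · intro i' _ h
    rw [eval_mul, eval_coPoly_of_ne s h.symm, mul_zero]
  · simp

variable [Fact ℓ.Prime]

theorem degree_freePoly_lt (v : Fin k → K) :
    (freePoly (j := j) ℓ β m v).degree < ((k - j : ℕ) : WithBot ℕ) := by
  refine (degree_sum_le _ _).trans_lt ((Finset.sup_lt_iff (WithBot.bot_lt_coe _)).2 fun a _ => ?_)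
  by_cases ha : a.num < k - j
  · rw [← smul_eq_C_mul]
    refine (degree_smul_le _ _).trans_lt ?_
    obtain ⟨hm, hd⟩ := basis_monic_natDegree (ℓ := ℓ) (β := β) m a
    rw [degree_eq_natDegree hm.ne_zero, hd]
    exact_mod_cast ha
  · rw [freeCoeff, dif_neg ha, C_0, zero_mul, degree_zero]
    exact WithBot.bot_lt_coe _

theorem degree_solution_lt (s : Fin j → K) (v : Fin k → K) :
    (solution ℓ β m hjk s v).degree < (k : WithBot ℕ) := by
  have hjk' : (j : WithBot ℕ) ≤ k := by exact_mod_cast hjk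
  refine (degree_add_le _ _).trans_lt (max_lt ?_ ?_)
  · refine (degree_sum_le _ _).trans_lt
      ((Finset.sup_lt_iff (WithBot.bot_lt_coe _)).2 fun i _ => ?_)
    rw [← smul_eq_C_mul]
    exact (degree_smul_le _ _).trans_lt ((degree_coPoly_lt s i).trans_le hjk')
  · rw [degree_mul, degree_rootPoly]
    have h2 : (k : WithBot ℕ) = (j : WithBot ℕ) + ((k - j : ℕ) : WithBot ℕ) := by
      exact_mod_cast (Nat.add_sub_cancel' hjk).symm
    rw [h2]
    exact WithBot.add_lt_add_left (WithBot.natCast_ne_bot j) (degree_freePoly_lt v)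

variable [CharP K ℓ]

theorem solution_injective (hβ : ∀ i < m, (vanishing ℓ β i).eval (β i) ≠ 0) (hk : k ≤ ℓ ^ m)
    {s : Fin j → K} (hs : Function.Injective s) :
    Function.Injective (solution (k := k) ℓ β m hjk s) := by
  intro v v' h
  have h1 : ∀ i : Fin j, v (Fin.castLE hjk i) = v' (Fin.castLE hjk i) := fun i => by
    rw [← eval_solution hjk hs v i, h, eval_solution hjk hs v' i]
  have h2 : freePoly (j := j) ℓ β m v = freePoly (j := j) ℓ β m v' := by
    simp only [solution, h1] at h
    exact mul_left_cancel₀ (rootPoly_ne_zero s) (add_left_cancel h)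
  obtain ⟨N, hN, -⟩ := exists_evalMatrix_inv (Y := Unit) m hβ 0
  have h3 : evalMatrix ℓ β m 0 *ᵥ freeCoeff (j := j) ℓ m v =
      evalMatrix ℓ β m 0 *ᵥ freeCoeff (j := j) ℓ m v' := by
    ext w
    have h4 := congrArg (fun p => p.eval (0 + pt ℓ β m w)) h2
    simp only [freePoly, eval_finsetSum, eval_mul, eval_C] at h4
    simp only [mulVec, dotProduct, evalMatrix, of_apply]
    simpa only [mul_comm] using h4
  have h5 := congrArg (fun x => N *ᵥ x) h3
  simp only [mulVec_mulVec, hN, one_mulVec] at h5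
  ext i
  by_cases hi : (i : ℕ) < j
  · exact h1 ⟨i, hi⟩
  · have hi' : (i : ℕ) - j < k - j := by omega
    obtain ⟨w, hw⟩ := Idx.exists_num_eq (ℓ := ℓ) (i := m) (n := i - j) (by omega)
    have h6 := congrFun h5 w
    rw [← hw] at hi'
    simp only [freeCoeff, dif_pos hi'] at h6
    have h7 : (⟨j + w.num, by omega⟩ : Fin k) = i := Fin.ext (by simp only; omega)
    rwa [h7] at h6

end Solution

section Vanishing

variable {L : Type*} [Field L] {Y : Type*} {ℓ : ℕ} [Fact ℓ.Prime] {β : ℕ → L}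

theorem eval_vanishing_cost {G : Set (Y → L)} {f : Y → L} (hf : f ∈ G) (i : ℕ) :
    Cost G (i * (ℓ + 4)) {fun y => (vanishing ℓ β i).eval (f y)} := by
  induction i with
  | zero => simpa [vanishing] using Cost.mem hf
  | succ i ih =>
    rw [Nat.succ_mul]
    refine ih.trans ?_
    set g : Y → L := fun y => (vanishing ℓ β i).eval (f y)
    have h : (fun y => (vanishing ℓ β (i + 1)).eval (f y)) = (∏ _u : Fin ℓ, g) -
        Function.const Y ((vanishing ℓ β i).eval (β i) ^ (ℓ - 1)) * g := by
      ext y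
      rw [eval_vanishing_succ]
      simp [g]
    rw [h]
    have hg : Cost (G ∪ {g}) 0 {g} := Cost.mem (Or.inr rfl)
    refine ((Cost.prod Finset.univ fun _ _ => hg).sub ((Cost.const _).mul hg)).mono_cost ?_
    simp

variable [CharP L ℓ]

theorem vanishing_eq_prod {i : ℕ} (hβ : ∀ k < i, (vanishing ℓ β k).eval (β k) ≠ 0) :
    vanishing ℓ β i = ∏ w, (X - C (pt ℓ β i w)) := by
  obtain ⟨hm, hd⟩ := vanishing_monic_natDegree (ℓ := ℓ) (β := β) i
  have hm' : (∏ w, (X - C (pt ℓ β i w))).Monic :=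
    monic_prod_of_monic _ _ fun w _ => monic_X_sub_C _
  have hd' : (∏ w, (X - C (pt ℓ β i w))).degree = ((ℓ ^ i : ℕ) : WithBot ℕ) := by
    rw [degree_prod]
    simp [Idx.card]
  have hdd : (vanishing ℓ β i).degree = (∏ w, (X - C (pt ℓ β i w))).degree := by
    rw [hd', degree_eq_natDegree hm.ne_zero, hd]
  refine Polynomial.eq_of_degree_sub_lt_of_eval_index_eq (v := pt ℓ β i) Finset.univ
    (pt_injective i hβ).injOn ?_ ?_
  · refine (degree_sub_lt_left hdd hm.ne_zero (by rw [hm, hm'])).trans_le ?_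
    rw [hdd, hd', Finset.card_univ, Idx.card]
  · intro w _
    rw [eval_vanishing_pt, eval_prod, Finset.prod_eq_zero (Finset.mem_univ w)]
    simp

/-- Evaluation of a polynomial, given by its values on a coset, by the transposed Cauchy matrix. -/
theorem eval_eq_cauchy {i : ℕ} (hβ : ∀ k < i, (vanishing ℓ β k).eval (β k) ≠ 0) {v x : L}
    (hx : ∀ w, v + pt ℓ β i w - x ≠ 0) {g : L[X]} (hg : g.degree < ((ℓ ^ i : ℕ) : WithBot ℕ)) :
    g.eval x = (vanishing ℓ β i).eval (x - v) *
      ∑ w, (v + pt ℓ β i w - x)⁻¹ *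
        (-Lagrange.nodalWeight Finset.univ (fun w => v + pt ℓ β i w) w *
          g.eval (v + pt ℓ β i w)) := by
  have hinj : Function.Injective fun w => v + pt ℓ β i w :=
    fun a b hab => pt_injective i hβ (add_left_cancel hab)
  rw [Lagrange.eq_interpolate (s := Finset.univ) (f := g) hinj.injOn
    (by simpa [Idx.card] using hg), Lagrange.eval_interpolate_not_at_node]
  · congr 1
    · rw [vanishing_eq_prod hβ, Lagrange.eval_nodal, eval_prod]
      simp only [eval_sub, eval_X, eval_C, sub_sub]
    · refine Finset.sum_congr rfl fun w _ => ?_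
      rw [Lagrange.eval_interpolate_at_node _ hinj.injOn (Finset.mem_univ w), ← neg_sub x,
        inv_neg]
      ring
  · intro w _ h
    exact hx w (by rw [h, sub_self])

end Vanishing

end AdditiveFFT

/-! ### The cost of the interpolation -/

namespace AdditiveFFT

open StraightLine Matrix Polynomial

set_option linter.unusedSectionVars false

section Map

variable {K L : Type*} [Field K] [Field L] [Algebra K L] {ℓ : ℕ} {β : ℕ → K}

theorem vanishing_map (i : ℕ) : (vanishing ℓ β i).map (algebraMap K L) =
    vanishing ℓ (fun i => algebraMap K L (β i)) i := by
  induction i with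
  | zero => simp [vanishing]
  | succ i ih =>
    rw [vanishing, vanishing, Polynomial.map_sub, Polynomial.map_mul, Polynomial.map_pow, ih,
      map_C, map_pow, ← ih, eval_map_algebraMap, aeval_algebraMap_apply]
    simp

theorem basis_map (i : ℕ) (w : Idx ℓ i) : (basis ℓ β i w).map (algebraMap K L) =
    basis ℓ (fun i => algebraMap K L (β i)) i w := by
  induction i with
  | zero => simp [basis]
  | succ i ih =>
    rw [basis, basis, Polynomial.map_mul, Polynomial.map_pow, ih, vanishing_map]

end Map

section Solve

variable {K L : Type*} [Field K] [Field L] [Algebra K L] {ℓ : ℕ} {β : ℕ → K} {m j k : ℕ} {t : L}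

local notation "φ" => algebraMap K L

variable (L ℓ m) in
/-- The points `s i`, followed by zeros. -/
def slots (s : Fin j → K) (a : Idx ℓ m) : L := if h : a.num < j then φ (s ⟨a.num, h⟩) else 0

variable (ℓ m t) in
/-- The elements of the coset of `t`. -/
def node (β : ℕ → K) (w : Idx ℓ m) : L := t + pt ℓ (fun i => φ (β i)) m w

variable [Fact ℓ.Prime]

theorem prod_node_sub_slots (hj : j ≤ ℓ ^ m) (s : Fin j → K) (x : L) :
    ∏ a : Idx ℓ m, (x - slots L ℓ m s a) =
      ((rootPoly s).map φ).eval x * x ^ (ℓ ^ m - j) := by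
  have h := Idx.prod_dite (ℓ := ℓ) (i := m) hj (fun i => x - φ (s i)) x
  rw [rootPoly, Polynomial.map_prod, eval_prod]
  simp only [Polynomial.map_sub, map_X, map_C, eval_sub, eval_X, eval_C]
  rw [← h]
  refine Finset.prod_congr rfl fun a _ => ?_
  by_cases ha : a.num < j <;> simp [slots, ha]

theorem eval_rootPoly_mul_inv (s : Fin j → K) (i : Fin j) {x : L} (hx : x - φ (s i) ≠ 0) :
    ((rootPoly s).map φ).eval x * (x - φ (s i))⁻¹ = ((coPoly s i).map φ).eval x := by
  rw [rootPoly_eq s i, Polynomial.map_mul, eval_mul]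
  simp only [Polynomial.map_sub, map_X, map_C, eval_sub, eval_X, eval_C]
  rw [mul_comm (x - φ (s i)), mul_inv_cancel_right₀ hx]

theorem rootPoly_mul_sum_cauchy (hj : j ≤ ℓ ^ m) (s : Fin j → K) (c : Fin j → L) {x : L}
    (hx : ∀ i, x - φ (s i) ≠ 0) :
    ((rootPoly s).map φ).eval x * ∑ a : Idx ℓ m, (x - slots L ℓ m s a)⁻¹ *
      (if h : a.num < j then c ⟨a.num, h⟩ else 0) =
      ∑ i, c i * ((coPoly s i).map φ).eval x := by
  have h := Idx.sum_dite (ℓ := ℓ) (i := m) hj (fun i => (x - φ (s i))⁻¹ * c i) 0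
  rw [smul_zero, add_zero] at h
  have h2 : ∑ a : Idx ℓ m, (x - slots L ℓ m s a)⁻¹ *
      (if h : a.num < j then c ⟨a.num, h⟩ else 0) = ∑ i, (x - φ (s i))⁻¹ * c i := by
    rw [← h]
    refine Finset.sum_congr rfl fun a _ => ?_
    by_cases ha : a.num < j <;> simp [slots, ha]
  rw [h2, Finset.mul_sum]
  refine Finset.sum_congr rfl fun i _ => ?_
  rw [← eval_rootPoly_mul_inv s i (hx i)]
  ring

theorem eval_sum_coPoly (s : Fin j → K) (i : Fin j) :
    (∑ i', (coPoly s i').map φ).eval (φ (s i)) = φ ((coPoly s i).eval (s i)) := by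
  rw [eval_finsetSum, Finset.sum_eq_single i]
  · rw [eval_map_algebraMap, aeval_algebraMap_apply]
    simp
  · intro i' _ h
    rw [eval_map_algebraMap, aeval_algebraMap_apply]
    simp [eval_coPoly_of_ne s h.symm]
  · simp

theorem solution_map (hjk : j ≤ k) (s : Fin j → K) (v : Fin k → K) (x : L)
    (hx : ∀ i, x - φ (s i) ≠ 0) (hj : j ≤ ℓ ^ m) :
    ((solution ℓ β m hjk s v).map φ).eval x = ((rootPoly s).map φ).eval x *
      (∑ a : Idx ℓ m, (x - slots L ℓ m s a)⁻¹ * (if h : a.num < j then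
        φ (v (Fin.castLE hjk ⟨a.num, h⟩)) * (φ ((coPoly s ⟨a.num, h⟩).eval (s ⟨a.num, h⟩)))⁻¹
        else 0) +
      ∑ a : Idx ℓ m, (basis ℓ (fun i => φ (β i)) m a).eval x *
        φ (freeCoeff (j := j) ℓ m v a)) := by
  rw [mul_add, rootPoly_mul_sum_cauchy hj s (fun i => φ (v (Fin.castLE hjk i)) *
    (φ ((coPoly s i).eval (s i)))⁻¹) hx, solution, Polynomial.map_add, eval_add,
    Polynomial.map_mul, eval_mul]
  congr 1
  · rw [Polynomial.map_sum, eval_finsetSum]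
    refine Finset.sum_congr rfl fun i _ => ?_
    rw [Polynomial.map_mul, eval_mul, map_C, eval_C, map_mul, map_inv₀]
  · rw [freePoly, Polynomial.map_sum, eval_finsetSum]
    congr 1
    refine Finset.sum_congr rfl fun a _ => ?_
    rw [Polynomial.map_mul, eval_mul, map_C, eval_C, basis_map, mul_comm]

variable [CharP K ℓ] [CharP L ℓ]

theorem node_sub_ne_zero (ht : t ∉ (φ).range) (w : Idx ℓ m) (x : K) :
    node ℓ m t β w - φ x ≠ 0 :=
  coset_sub_ne_zero (B := (φ).range.toAddSubgroup) (β := fun i => φ (β i))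
    (fun i _ => ⟨β i, rfl⟩) ht ⟨x, rfl⟩ w

theorem slots_mem (s : Fin j → K) (a : Idx ℓ m) : slots L ℓ m s a ∈ (φ).range := by
  by_cases ha : a.num < j
  · simp [slots, ha]
  · simp [slots, ha]

theorem eval_vanishing_map_ne_zero (hβ : ∀ i < m, (vanishing ℓ β i).eval (β i) ≠ 0) :
    ∀ i < m, (vanishing ℓ (fun i => φ (β i)) i).eval (φ (β i)) ≠ 0 := by
  intro i hi
  rw [← vanishing_map, eval_map_algebraMap, aeval_algebraMap_apply]
  simpa using hβ i hi

theorem solution_cost_arith {ℓ j : ℕ} (m : ℕ) (hℓ : 2 ≤ ℓ) (hj : j ≤ ℓ ^ m) :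
    2 + 12 * (m ^ 2 + 1) * ℓ ^ (m + 2) + ℓ ^ m * 2 + (12 * (m ^ 2 + 1) * ℓ ^ (m + 2) + ℓ ^ m * 1) +
      (ℓ ^ m * 2 + 12 * (m ^ 2 + 1) * ℓ ^ (m + 2)) + j * (m * (ℓ + 4) + 5) +
      (12 * (m ^ 2 + 1) * ℓ ^ (m + 2) + 4 * m * ℓ ^ (m + 1) + ℓ ^ m * 2) +
      (4 * m * ℓ ^ (m + 1) + 7 * m ^ 2 * ℓ ^ (m + 1)) ≤ 100 * (m ^ 2 + 1) * ℓ ^ (m + 2) := by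
  have hn : 1 ≤ ℓ ^ m := Nat.one_le_pow _ _ (by omega)
  have h1 : j * (m * (ℓ + 4) + 5) ≤ ℓ ^ m * (m * (ℓ + 4) + 5) := Nat.mul_le_mul_right _ hj
  have h2 : 2 * m ≤ m ^ 2 + 1 := by nlinarith [sq_nonneg ((m : ℤ) - 1)]
  have h3 : ℓ ≤ ℓ ^ 2 := by nlinarith
  have h4 : 4 ≤ ℓ ^ 2 := by nlinarith
  have h5 : 9 + m * (ℓ + 4) + 5 + 8 * m * ℓ + 7 * m ^ 2 * ℓ ≤ 52 * (m ^ 2 + 1) * ℓ ^ 2 := by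
    have : m * ℓ ≤ (m ^ 2 + 1) * ℓ ^ 2 := Nat.mul_le_mul (by omega) h3
    have : m * 4 ≤ (m ^ 2 + 1) * ℓ ^ 2 := Nat.mul_le_mul (by omega) h4
    have : m ^ 2 * ℓ ≤ (m ^ 2 + 1) * ℓ ^ 2 := Nat.mul_le_mul (by omega) h3
    have : 1 * 4 ≤ (m ^ 2 + 1) * ℓ ^ 2 := Nat.mul_le_mul (by omega) h4
    nlinarith
  have h6 := Nat.mul_le_mul_left (ℓ ^ m) h5
  have h7 : ℓ ^ (m + 2) = ℓ ^ m * ℓ ^ 2 := pow_add _ _ _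
  have h8 : ℓ ^ (m + 1) = ℓ ^ m * ℓ := pow_succ _ _
  rw [h7, h8]
  nlinarith

theorem solution_cost (hjk : j ≤ k) (hk : k ≤ ℓ ^ m)
    (hβ : ∀ i < m, (vanishing ℓ β i).eval (β i) ≠ 0) (ht : t ∉ (φ).range) :
    Cost (Set.range (fun i (y : (Fin j → K) × (Fin k → K)) => φ (y.1 i)) ∪
      Set.range fun i (y : (Fin j → K) × (Fin k → K)) => φ (y.2 i))
      (100 * (m ^ 2 + 1) * ℓ ^ (m + 2))
      (Set.range fun (N : Fin k) (y : (Fin j → K) × (Fin k → K)) =>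
        φ ((solution ℓ β m hjk y.1 y.2).coeff N)) := by
  set Y := (Fin j → K) × (Fin k → K)
  have hℓ : 2 ≤ ℓ := (Fact.out : ℓ.Prime).two_le
  have hj : j ≤ ℓ ^ m := hjk.trans hk
  set βL : ℕ → L := fun i => φ (β i) with hβL
  have hβ' := eval_vanishing_map_ne_zero (L := L) hβ
  set G0 : Set (Y → L) := Set.range (fun i (y : Y) => φ (y.1 i)) ∪ Set.range fun i (y : Y) => φ (y.2 i)
  -- zero and one
  set G1 : Set (Y → L) := G0 ∪ ({Function.const Y 0} ∪ {Function.const Y 1}) with hG1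
  have c1 : Cost G0 2 G1 :=
    (Cost.of_subset subset_rfl).union ((Cost.const 0).union (Cost.const 1))
  set σ : Idx ℓ m → Y → L := fun a y => slots L ℓ m y.1 a with hσ
  have hσG : ∀ a, σ a ∈ G1 := by
    intro a
    by_cases ha : a.num < j
    · exact Or.inl (Or.inl ⟨⟨a.num, ha⟩, by ext y; simp [hσ, slots, ha]⟩)
    · exact Or.inr (Or.inl (by ext y; simp [hσ, slots, ha]))
  obtain ⟨T, hT, hD, hC⟩ := cauchy_cost (Y := Y) (β := βL) (v := t)
    (B := (φ).range.toAddSubgroup) m (fun i _ => ⟨β i, rfl⟩) hβ' (s := σ)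
    (fun a y => slots_mem y.1 a) ht
  set c := 12 * (m ^ 2 + 1) * ℓ ^ (m + 2) with hc
  set G2 := G1 ∪ T with hG2
  have c2 : Cost G0 (2 + c) G2 :=
    c1.union_trans (hT.mono_left ((Set.range_subset_iff.2 hσG).trans Set.subset_union_right))
  -- values of the polynomial with the roots `s i`
  set z : Idx ℓ m → Y → L := fun w y => ((rootPoly y.1).map φ).eval (node ℓ m t β w) with hz
  set G3 := G2 ∪ Set.range z with hG3
  have c3 : Cost G0 (2 + c + ℓ ^ m * 2) G3 := by
    refine c2.union_trans (Cost.mono_left (G := G2) ?_ Set.subset_union_right)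
    rw [← Idx.card]
    refine Cost.range fun w => ?_
    have hn : node ℓ m t β w ≠ 0 := by
      simpa using node_sub_ne_zero (K := K) (β := β) (m := m) ht w 0
    have : z w = nodeProd ℓ βL m σ t w *
        Function.const Y (node ℓ m t β w ^ (ℓ ^ m - j))⁻¹ := by
      ext y
      have h := prod_node_sub_slots (L := L) hj y.1 (node ℓ m t β w)
      change _ = (∏ a, (node ℓ m t β w - slots L ℓ m y.1 a)) * _
      rw [h, Function.const_apply, mul_inv_cancel_right₀ (pow_ne_zero _ hn)]
    rw [this]
    exact (Cost.mem (Or.inr (hD w))).mul (Cost.const _)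
  have hCmul : ∀ (r : Fin j → Y → L) (w : Idx ℓ m) (y : Y),
      z w y * (cauchy ℓ βL m σ t *ᵥ
        fun a => if h : a.num < j then r ⟨a.num, h⟩ else Function.const Y 0) w y =
      ∑ i, r i y * ((coPoly y.1 i).map φ).eval (node ℓ m t β w) := by
    intro r w y
    rw [← rootPoly_mul_sum_cauchy hj y.1 (fun i => r i y)
      fun i => node_sub_ne_zero ht w (y.1 i)]
    simp only [mulVec, dotProduct, Finset.sum_apply, Pi.mul_apply]
    congr 1
    refine Finset.sum_congr rfl fun a _ => ?_
    by_cases ha : a.num < j <;> simp [ha, cauchy, node, hσ, hβL]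
  -- values of the polynomial with the values `∏ i' ≠ i, (s i - s i')`
  set one : Idx ℓ m → Y → L :=
    fun a => if h : a.num < j then (fun _ => Function.const Y 1 : Fin j → Y → L) ⟨a.num, h⟩
      else Function.const Y 0 with hone
  have honeG : ∀ a, one a ∈ G1 := by
    intro a
    by_cases ha : a.num < j
    · exact Or.inr (Or.inr (by simp [hone, ha]))
    · exact Or.inr (Or.inl (by simp [hone, ha]))
  set C := cauchy ℓ βL m σ t with hCdef
  set g : Idx ℓ m → Y → L := fun w => z w * (C *ᵥ one) w with hgdef
  have hg : ∀ w y, g w y = (∑ i, (coPoly y.1 i).map φ).eval (node ℓ m t β w) := by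
    intro w y
    refine (hCmul (fun _ => Function.const Y 1) w y).trans ?_
    rw [eval_finsetSum]
    simp
  set G4 := G3 ∪ Set.range g with hG4
  have c4 : Cost G0 (2 + c + ℓ ^ m * 2 + (c + ℓ ^ m * 1)) G4 := by
    refine c3.union_trans (Cost.mono_left (G := G3) ?_ Set.subset_union_right)
    refine (hC.fwd.apply (G' := G3) (v := one) (fun f hf => Or.inl (Or.inr hf))
      fun a => Or.inl (Or.inl (honeG a))).trans ?_
    rw [← Idx.card]
    exact Cost.range fun w =>
      (Cost.mem (Or.inl (Or.inr ⟨w, rfl⟩))).mul (Cost.mem (Or.inr ⟨w, rfl⟩))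
  set wt : Idx ℓ m → L := fun w => -Lagrange.nodalWeight Finset.univ (node ℓ m t β) w with hwt
  set e : Idx ℓ m → Y → L := Cᵀ *ᵥ fun w => Function.const Y (wt w) * g w with he
  set G5 := G4 ∪ Set.range e with hG5
  have c5 : Cost G0 (2 + c + ℓ ^ m * 2 + (c + ℓ ^ m * 1) + (ℓ ^ m * 2 + c)) G5 := by
    refine c4.union_trans (Cost.mono_left (G := G4) ?_ Set.subset_union_right)
    refine Cost.trans (T := Set.range fun w => Function.const Y (wt w) * g w) ?_
      (hC.bwd.apply (fun f hf => Or.inl (Or.inl (Or.inl (Or.inr hf)))) fun w => Or.inr ⟨w, rfl⟩)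
    rw [← Idx.card]
    exact Cost.range fun w => (Cost.const _).mul (Cost.mem (Or.inr ⟨w, rfl⟩))
  -- the coefficients of the interpolation
  choose idx hidx using fun i : Fin j =>
    Idx.exists_num_eq (ℓ := ℓ) (i := m) (n := i) (i.2.trans_le hj)
  have heval : ∀ i y, φ ((coPoly y.1 i).eval (y.1 i)) =
      (vanishing ℓ βL m).eval (φ (y.1 i) - t) * e (idx i) y := by
    intro i y
    have hdeg : (∑ i, (coPoly y.1 i).map φ).degree < ((ℓ ^ m : ℕ) : WithBot ℕ) := by
      refine (degree_sum_le _ _).trans_lt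
        ((Finset.sup_lt_iff (WithBot.bot_lt_coe _)).2 fun i _ => ?_)
      rw [degree_map]
      exact (degree_coPoly_lt y.1 i).trans_le (by exact_mod_cast hj)
    rw [← eval_sum_coPoly, eval_eq_cauchy hβ' (v := t)
      (fun w => node_sub_ne_zero ht w (y.1 i)) hdeg]
    congr 1
    simp only [he, mulVec, dotProduct, Finset.sum_apply, Pi.mul_apply, transpose_apply]
    refine Finset.sum_congr rfl fun w _ => ?_
    have hslot : σ (idx i) y = φ (y.1 i) := by simp [hσ, slots, hidx]
    rw [hg]
    simp only [hCdef, cauchy, of_apply, hslot]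
    rfl
  set r : Fin j → Y → L := fun i y => φ (y.2 (Fin.castLE hjk i)) *
    (φ ((coPoly y.1 i).eval (y.1 i)))⁻¹ with hr
  set G6 := G5 ∪ Set.range r with hG6
  have c6 : Cost G0 (2 + c + ℓ ^ m * 2 + (c + ℓ ^ m * 1) + (ℓ ^ m * 2 + c) +
      j * (m * (ℓ + 4) + 5)) G6 := by
    refine c5.union_trans (Cost.mono_left (G := G5) ?_ Set.subset_union_right)
    have := Cost.range (ι := Fin j) (G := G5) (c := m * (ℓ + 4) + 5) (f := r) fun i => ?_
    · rwa [Fintype.card_fin] at this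
    set x : Y → L := (fun y => φ (y.1 i)) - Function.const Y t with hx
    have hx0 : Cost G5 2 {x} := (Cost.mem (by
      exact Or.inl (Or.inl (Or.inl (Or.inl (Or.inl (Or.inl ⟨i, rfl⟩))))))).sub (Cost.const t)
    have hri : r i = (fun y => φ (y.2 (Fin.castLE hjk i))) *
        ((fun y => (vanishing ℓ βL m).eval (x y)) * e (idx i))⁻¹ := by
      ext y
      simp only [hr, heval, Pi.mul_apply, Pi.inv_apply, hx, Pi.sub_apply, Function.const_apply]
    rw [hri]
    refine (hx0.trans ((Cost.mem ?_).mul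
      (((eval_vanishing_cost (Or.inr rfl) m).mul (Cost.mem ?_)).inv))).mono_cost (by omega)
    · exact Or.inl (Or.inl (Or.inl (Or.inl (Or.inl (Or.inl (Or.inr ⟨_, rfl⟩))))))
    · exact Or.inl (Or.inr ⟨_, rfl⟩)
  -- values of the solution
  set r' : Idx ℓ m → Y → L :=
    fun a => if h : a.num < j then r ⟨a.num, h⟩ else Function.const Y 0 with hr'
  have hr'G : ∀ a, r' a ∈ G6 := by
    intro a
    by_cases ha : a.num < j
    · exact Or.inr ⟨⟨a.num, ha⟩, by simp [hr', ha]⟩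
    · exact Or.inl (Or.inl (Or.inl (Or.inl (Or.inl (Or.inr (Or.inl (by simp [hr', ha])))))))
  set ρ : Idx ℓ m → Y → L := fun a y => φ (freeCoeff (j := j) ℓ m y.2 a) with hρ
  have hρG : ∀ a, ρ a ∈ G6 := by
    intro a
    by_cases ha : a.num < k - j
    · exact Or.inl (Or.inl (Or.inl (Or.inl (Or.inl (Or.inl (Or.inr
        ⟨⟨j + a.num, by omega⟩, by ext y; simp [hρ, freeCoeff, ha]⟩))))))
    · exact Or.inl (Or.inl (Or.inl (Or.inl (Or.inl (Or.inr (Or.inl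
        (by ext y; simp [hρ, freeCoeff, ha])))))))
  set F : Idx ℓ m → Y → L := fun w => z w *
    ((C *ᵥ r') w + (constMat Y (evalMatrix ℓ βL m t) *ᵥ ρ) w) with hFdef
  have hF : ∀ w y, F w y = ((solution ℓ β m hjk y.1 y.2).map φ).eval (node ℓ m t β w) := by
    intro w y
    rw [solution_map hjk _ _ _ (fun i => node_sub_ne_zero ht w (y.1 i)) hj]
    change z w y * ((C *ᵥ r') w y + (constMat Y (evalMatrix ℓ βL m t) *ᵥ ρ) w y) = _
    rw [constMat_mulVec]
    congr 2
    simp only [mulVec, dotProduct, Finset.sum_apply, Pi.mul_apply]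
    refine Finset.sum_congr rfl fun a _ => ?_
    by_cases ha : a.num < j <;> simp [ha, hCdef, cauchy, node, hσ, hβL, hr', hr]
  set G7 := G6 ∪ Set.range F with hG7
  have c7 : Cost G0 (2 + c + ℓ ^ m * 2 + (c + ℓ ^ m * 1) + (ℓ ^ m * 2 + c) +
      j * (m * (ℓ + 4) + 5) + (c + 4 * m * ℓ ^ (m + 1) + ℓ ^ m * 2)) G7 := by
    refine c6.union_trans (Cost.mono_left (G := G6) ?_ Set.subset_union_right)
    refine ((hC.fwd.apply (G' := G6) (v := r')
      (fun f hf => Or.inl (Or.inl (Or.inl (Or.inl (Or.inr hf))))) hr'G).union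
      ((biCost_evalMatrix (β := βL) m t).fwd.apply (G' := G6) (v := ρ) (Set.empty_subset _) hρG)).trans ?_
    rw [← Idx.card]
    exact Cost.range fun w => (Cost.mem (Or.inl (Or.inl (Or.inl (Or.inl (Or.inr ⟨w, rfl⟩)))))).mul
      ((Cost.mem (Or.inr (Or.inl ⟨w, rfl⟩))).add (Cost.mem (Or.inr (Or.inr ⟨w, rfl⟩))))
  -- interpolation and conversion to the monomial basis
  obtain ⟨N, hN, hNc⟩ := exists_evalMatrix_inv (Y := Y) m hβ' t
  have hsol : ∀ y : Y, ∑ a, Polynomial.C ((constMat Y N *ᵥ F) a y) * basis ℓ βL m a =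
      (solution ℓ β m hjk y.1 y.2).map φ := by
    intro y
    have hdeg : ((solution ℓ β m hjk y.1 y.2).map φ).degree < ((ℓ ^ m : ℕ) : WithBot ℕ) := by
      rw [degree_map]
      exact (degree_solution_lt hjk y.1 y.2).trans_le (by exact_mod_cast hk)
    rw [eq_sum_basis hβ' hN hdeg]
    refine Finset.sum_congr rfl fun a _ => ?_
    rw [constMat_mulVec]
    simp only [hF]
    rfl
  have c8 := (c7.trans ((hNc.fwd.apply (Set.empty_subset _) fun w => Or.inr (Or.inr ⟨w, rfl⟩)).trans
    ((coeff_cost (β := βL) m (constMat Y N *ᵥ F)).mono_left Set.subset_union_right)))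
  refine (c8.mono_cost ?_).mono_right ?_
  · exact solution_cost_arith m hℓ hj
  · rintro _ ⟨n, rfl⟩
    refine ⟨⟨n, n.2.trans_le hk⟩, ?_⟩
    ext y
    beta_reduce
    rw [hsol, coeff_map]

end Solve

end AdditiveFFT

/-! ### Simulation of a quadratic extension -/

namespace StraightLine

set_option linter.unusedSectionVars false

theorem Cost.comp {F X X' : Type*} [Field F] {G T : Set (X → F)} {c : ℕ} (h : Cost G c T)
    (π : X' → X) : Cost ((fun f => f ∘ π) '' G) c ((fun f => f ∘ π) '' T) := by
  obtain ⟨d, hd, H, hH, hT⟩ := h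
  refine ⟨d, hd, (fun f => f ∘ π) '' H, ?_, Set.image_mono hT⟩
  clear hd hT
  induction hH with
  | refl => exact .refl
  | @step d H f _ hf ih =>
    rw [Set.image_insert_eq]
    refine .step ih ?_
    cases hf with
    | const c => exact .const c
    | @add f g a b => exact .add (f := f ∘ π) (g := g ∘ π) ⟨f, a, rfl⟩ ⟨g, b, rfl⟩
    | @sub f g a b => exact .sub (f := f ∘ π) (g := g ∘ π) ⟨f, a, rfl⟩ ⟨g, b, rfl⟩
    | @mul f g a b => exact .mul (f := f ∘ π) (g := g ∘ π) ⟨f, a, rfl⟩ ⟨g, b, rfl⟩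
    | @inv f a => exact .inv (f := f ∘ π) ⟨f, a, rfl⟩

section Quadratic

variable {K X : Type*} [Field K] {a b : K} [Fact (∀ r : K, r ^ 2 ≠ a + b * r)]

/-- The components of functions with values in a quadratic extension. -/
def components (G : Set (X → QuadraticAlgebra K a b)) : Set (X → K) :=
  (fun f x => (f x).re) '' G ∪ (fun f x => (f x).im) '' G

theorem Step.simulate {H : Set (X → QuadraticAlgebra K a b)} {f : X → QuadraticAlgebra K a b}
    (h : Step H f) :
    Cost (components H) 30 ({fun x => (f x).re} ∪ {fun x => (f x).im}) := by
  have hre : ∀ {f}, f ∈ H → Cost (components H) 0 {fun x => (f x).re} :=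
    fun hf => Cost.mem (Or.inl ⟨_, hf, rfl⟩)
  have him : ∀ {f}, f ∈ H → Cost (components H) 0 {fun x => (f x).im} :=
    fun hf => Cost.mem (Or.inr ⟨_, hf, rfl⟩)
  cases h with
  | const c => exact ((Cost.const c.re).union (Cost.const c.im)).mono_cost (by norm_num)
  | @add f g hf hg =>
    exact (((hre hf).add (hre hg)).union ((him hf).add (him hg))).mono_cost (by norm_num)
  | @sub f g hf hg =>
    exact (((hre hf).sub (hre hg)).union ((him hf).sub (him hg))).mono_cost (by norm_num)
  | @mul f g hf hg =>
    have h1 := ((hre hf).mul (hre hg)).add (((Cost.const a).mul (him hf)).mul (him hg))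
    have h2 := (((hre hf).mul (him hg)).add ((him hf).mul (hre hg))).add
      (((Cost.const b).mul (him hf)).mul (him hg))
    refine ((h1.union h2).mono_cost (by norm_num)).mono_right (le_of_eq ?_)
    congr 2
  | @inv f hf =>
    have hn := ((((hre hf).mul (hre hf)).add (((Cost.const b).mul (hre hf)).mul (him hf))).sub
      (((Cost.const a).mul (him hf)).mul (him hf))).inv
    have h1 := hn.mul ((hre hf).add ((Cost.const b).mul (him hf)))
    have h2 := hn.mul ((Cost.const 0).sub (him hf))
    refine ((h1.union h2).mono_cost (by norm_num)).mono_right (le_of_eq ?_)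
    congr 2
    ext x
    simp [QuadraticAlgebra.norm_def, QuadraticAlgebra.im_inv]

theorem Cost.simulate {G T : Set (X → QuadraticAlgebra K a b)} {c : ℕ} (h : Cost G c T) :
    Cost (components G) (c * 30) (components T) := by
  obtain ⟨d, hd, H, hH, hT⟩ := h
  refine Cost.mono_cost ?_ (Nat.mul_le_mul_right 30 hd)
  refine Cost.mono_right ?_ (Set.union_subset_union (Set.image_mono hT) (Set.image_mono hT))
  change Cost _ _ (components H)
  clear hd hT
  induction hH with
  | refl => exact (Cost.of_subset subset_rfl).mono_cost (Nat.zero_le _)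
  | @step d H f _ hf ih =>
    rw [Nat.succ_mul]
    refine (ih.union_trans (hf.simulate.mono_left Set.subset_union_right)).mono_right ?_
    simp only [components, Set.image_insert_eq]
    rintro g ((rfl | hg) | (rfl | hg))
    · exact Or.inr (Or.inl rfl)
    · exact Or.inl (Or.inl hg)
    · exact Or.inr (Or.inr rfl)
    · exact Or.inl (Or.inr hg)

end Quadratic

end StraightLine

namespace AdditiveFFT

open StraightLine Polynomial

section Exists

variable {K : Type*} [Field K] {ℓ : ℕ}

theorem vanishing_congr {β β' : ℕ → K} {i : ℕ} (h : ∀ k < i, β k = β' k) :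
    vanishing ℓ β i = vanishing ℓ β' i := by
  induction i with
  | zero => rfl
  | succ i ih =>
    rw [vanishing, vanishing, ih fun k hk => h k (hk.trans (Nat.lt_succ_self i)),
      h i (Nat.lt_succ_self i)]

variable [Fintype K]

theorem exists_flag [Fact ℓ.Prime] {m : ℕ} (hm : ℓ ^ m ≤ Fintype.card K) :
    ∃ β : ℕ → K, ∀ i < m, (vanishing ℓ β i).eval (β i) ≠ 0 := by
  have hℓ : 1 < ℓ := (Fact.out : ℓ.Prime).one_lt
  induction m with
  | zero => exact ⟨fun _ => 0, fun i hi => absurd hi (Nat.not_lt_zero i)⟩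
  | succ m ih =>
    have hlt : ℓ ^ m < ℓ ^ (m + 1) := Nat.pow_lt_pow_right hℓ (Nat.lt_succ_self m)
    obtain ⟨β, hβ⟩ := ih (hlt.le.trans hm)
    obtain ⟨hmon, hdeg⟩ := vanishing_monic_natDegree (ℓ := ℓ) (β := β) m
    obtain ⟨x, hx⟩ : ∃ x, (vanishing ℓ β m).eval x ≠ 0 :=
      exists_eval_ne_zero_of_natDegree_lt_card _ hmon.ne_zero (by
        rw [hdeg, Cardinal.mk_fintype]
        exact_mod_cast hlt.trans_le hm)
    have hc : ∀ i ≤ m, vanishing ℓ (Function.update β m x) i = vanishing ℓ β i :=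
      fun i hi => vanishing_congr fun k hk =>
        Function.update_of_ne (hk.trans_le hi).ne _ _
    refine ⟨Function.update β m x, fun i hi => ?_⟩
    rcases (Nat.lt_succ_iff.1 hi).lt_or_eq with h | rfl
    · rw [hc i h.le, Function.update_of_ne h.ne]
      exact hβ i h
    · rw [hc i le_rfl, Function.update_self]
      exact hx

theorem exists_quadratic : ∃ a : K, ∀ r : K, r ^ 2 ≠ a + 1 * r := by
  have h : ¬ Function.Surjective fun r : K => r ^ 2 - r := by
    rw [← Finite.injective_iff_surjective]
    intro h
    exact zero_ne_one (h (by simp : (0 : K) ^ 2 - 0 = 1 ^ 2 - 1))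
  rw [Function.Surjective] at h
  push Not at h
  obtain ⟨a, ha⟩ := h
  refine ⟨a, fun r hr => ha r ?_⟩
  rw [hr]
  ring

/-- Interpolation with free parameters, for at most `|K|` coefficients. -/
theorem exists_solver_of_le_card [Fact ℓ.Prime] [CharP K ℓ] {j k : ℕ} (hjk : j ≤ k)
    (hk : k ≤ Fintype.card K) :
    ∃ Φ : (Fin j → K) → (Fin k → K) → Fin k → K,
      Cost (Set.range (fun i (y : (Fin j → K) × (Fin k → K)) => y.1 i) ∪
        Set.range fun i (y : (Fin j → K) × (Fin k → K)) => y.2 i)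
        (3000 * (Nat.clog ℓ k ^ 2 + 1) * ℓ ^ (Nat.clog ℓ k + 2) + 1)
        (Set.range fun N (y : (Fin j → K) × (Fin k → K)) => Φ y.1 y.2 N) ∧
      ∀ s, Function.Injective s → Function.Injective (Φ s) ∧
        ∀ v i, ∑ N : Fin k, s i ^ (N : ℕ) * Φ s v N = v (Fin.castLE hjk i) := by
  have hℓ : 1 < ℓ := (Fact.out : ℓ.Prime).one_lt
  set m := Nat.clog ℓ k with hm
  have hkm : k ≤ ℓ ^ m := Nat.le_pow_clog hℓ k
  have hmK : ℓ ^ m ≤ Fintype.card K := by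
    obtain ⟨e, -, he⟩ := FiniteField.card K ℓ
    rw [he] at hk ⊢
    exact Nat.pow_le_pow_right hℓ.le (Nat.clog_le_of_le_pow hk)
  obtain ⟨β, hβ⟩ := exists_flag (K := K) hmK
  obtain ⟨a, ha⟩ := exists_quadratic (K := K)
  have : Fact (∀ r : K, r ^ 2 ≠ a + 1 * r) := ⟨ha⟩
  set L := QuadraticAlgebra K a 1
  have : CharP L ℓ := charP_of_injective_algebraMap (algebraMap K L).injective ℓ
  have ht : (QuadraticAlgebra.omega : L) ∉ (algebraMap K L).range := by
    rintro ⟨x, hx⟩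
    have := congrArg QuadraticAlgebra.im hx
    simp [L] at this
  refine ⟨fun s v N => (solution ℓ β m hjk s v).coeff N, ?_, fun s hs => ⟨?_, fun v i => ?_⟩⟩
  · have h1 := (solution_cost (L := L) hjk hkm hβ ht).simulate
    set G := Set.range (fun i (y : (Fin j → K) × (Fin k → K)) => y.1 i) ∪
        Set.range fun i (y : (Fin j → K) × (Fin k → K)) => y.2 i with hG
    have h2 : Cost G 1 (G ∪ {Function.const _ 0}) :=
      ((Cost.of_subset (c := 0) subset_rfl).union (Cost.const 0)).mono_cost (by norm_num)
    have h3 := (h2.trans (h1.mono_left ?_)).mono_cost (c' := 3000 * (m ^ 2 + 1) * ℓ ^ (m + 2) + 1)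
      (le_of_eq (by ring))
    refine h3.mono_right ?_
    swap
    · rintro f (⟨_, (⟨i, rfl⟩ | ⟨i, rfl⟩), rfl⟩ | ⟨_, (⟨i, rfl⟩ | ⟨i, rfl⟩), rfl⟩)
      · exact Or.inr (Or.inl (Or.inl ⟨i, rfl⟩))
      · exact Or.inr (Or.inl (Or.inr ⟨i, rfl⟩))
      · exact Or.inr (Or.inr rfl)
      · exact Or.inr (Or.inr rfl)
    · rintro _ ⟨N, rfl⟩
      exact Or.inl ⟨_, ⟨N, rfl⟩, rfl⟩
  · intro v v' h
    refine solution_injective hjk hβ hkm hs ?_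
    ext N
    by_cases hN : N < k
    · exact congrFun h ⟨N, hN⟩
    · have hN' : (k : WithBot ℕ) ≤ N := by exact_mod_cast not_lt.1 hN
      rw [coeff_eq_zero_of_degree_lt ((degree_solution_lt hjk s v).trans_le hN'),
        coeff_eq_zero_of_degree_lt ((degree_solution_lt hjk s v').trans_le hN')]
  · rw [← eval_solution (ℓ := ℓ) (β := β) (m := m) hjk hs v i]
    rcases Nat.eq_zero_or_pos k with h0 | h0
    · exact absurd i.2 (by omega)
    have hdeg : (solution ℓ β m hjk s v).natDegree < k := by
      by_cases hz : solution ℓ β m hjk s v = 0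
      · rw [hz, natDegree_zero]
        exact h0
      · rw [← Nat.cast_lt (α := WithBot ℕ), ← degree_eq_natDegree hz]
        exact degree_solution_lt hjk s v
    rw [eval_eq_sum_range' hdeg, Finset.sum_range]
    exact Finset.sum_congr rfl fun N _ => mul_comm _ _

/-- Interpolation with free parameters. -/
theorem exists_solver [Fact ℓ.Prime] [CharP K ℓ] {j k : ℕ} (hjk : j ≤ k)
    (hj : j ≤ Fintype.card K) :
    ∃ Φ : (Fin j → K) → (Fin k → K) → Fin k → K,
      Cost (Set.range (fun i (y : (Fin j → K) × (Fin k → K)) => y.1 i) ∪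
        Set.range fun i (y : (Fin j → K) × (Fin k → K)) => y.2 i)
        (3000 * (Nat.clog ℓ k ^ 2 + 1) * ℓ ^ (Nat.clog ℓ k + 2) + 1 + 3 * k)
        (Set.range fun N (y : (Fin j → K) × (Fin k → K)) => Φ y.1 y.2 N) ∧
      ∀ s, Function.Injective s → Function.Injective (Φ s) ∧
        ∀ v i, ∑ N : Fin k, s i ^ (N : ℕ) * Φ s v N = v (Fin.castLE hjk i) := by
  rcases le_total k (Fintype.card K) with hk | hk
  · obtain ⟨Φ, hΦ, h⟩ := exists_solver_of_le_card (ℓ := ℓ) hjk hk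
    exact ⟨Φ, hΦ.mono_cost (Nat.le_add_right _ _), h⟩
  obtain ⟨Ψ, hΨ, h⟩ := exists_solver_of_le_card (K := K) (ℓ := ℓ) hj le_rfl
  have hq : 1 < Fintype.card K := Fintype.one_lt_card
  have hclog : Nat.clog ℓ (Fintype.card K) ≤ Nat.clog ℓ k := Nat.clog_mono_right ℓ hk
  have hcard : ∀ x : K, x ^ Fintype.card K = x := FiniteField.pow_card
  have hℓ : 1 ≤ ℓ := (Fact.out : ℓ.Prime).one_le
  generalize Fintype.card K = q at *
  obtain ⟨d, rfl⟩ := Nat.exists_eq_add_of_le hk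
  set low : (Fin (q + d) → K) → Fin q → K := fun v i => v (Fin.castAdd d i) with hlow
  set f : (Fin j → K) → (Fin (q + d) → K) → Fin (q + d) → K :=
    fun s v => Fin.append (Ψ s (low v)) fun i => v (Fin.natAdd q i) with hf
  set g : (Fin (q + d) → K) → Fin (q + d) → K := fun v N =>
    if h : 1 ≤ (N : ℕ) ∧ (N : ℕ) - 1 < d then v (Fin.natAdd q ⟨N - 1, h.2⟩) else 0 with hg
  refine ⟨fun s v N => f s v N - g v N, ?_, fun s hs => ⟨?_, fun v i => ?_⟩⟩
  · set Y := (Fin j → K) × (Fin (q + d) → K)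
    set G : Set (Y → K) := Set.range (fun i (y : Y) => y.1 i) ∪
      Set.range fun i (y : Y) => y.2 i with hG
    have h1 := (hΨ.comp fun y : Y => (y.1, low y.2)).mono_left (G' := G) ?_
    · refine (h1.trans (c' := (q + d) * 3) ?_).mono_cost ?_
      · have := Cost.range (ι := Fin (q + d)) (c := 3)
          (G := G ∪ (fun f => f ∘ fun y : Y => (y.1, low y.2)) ''
            Set.range fun N (y : (Fin j → K) × (Fin q → K)) => Ψ y.1 y.2 N)
          (f := fun N (y : Y) => f y.1 y.2 N - g y.2 N) fun N => ?_
        · rwa [Fintype.card_fin] at this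
        refine (Cost.sub (c := 0) (c' := 1) (f := fun y : Y => f y.1 y.2 N) (g := fun y : Y => g y.2 N)
          (Cost.mem ?_) ?_).mono_cost (by norm_num)
        · refine Fin.addCases (fun N => ?_) (fun N => ?_) N
          · refine Or.inr ⟨_, ⟨N, rfl⟩, ?_⟩
            ext y
            simp [hf]
          · refine Or.inl (Or.inr ⟨Fin.natAdd q N, ?_⟩)
            ext y
            simp [hf]
        · by_cases hN : 1 ≤ (N : ℕ) ∧ (N : ℕ) - 1 < d
          · simp only [hg, dif_pos hN]
            exact (Cost.mem (Or.inl (Or.inr ⟨_, rfl⟩))).mono_cost zero_le_one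
          · simp only [hg, dif_neg hN]
            exact Cost.const 0
      · have h2 := Nat.pow_le_pow_left hclog 2
        have h3 := Nat.pow_le_pow_right hℓ (Nat.add_le_add_right hclog 2)
        have h4 := Nat.mul_le_mul (Nat.mul_le_mul_left 3000 (Nat.add_le_add_right h2 1)) h3
        omega
    · rintro _ ⟨_, ⟨i, rfl⟩ | ⟨i, rfl⟩, rfl⟩
      · exact Or.inl ⟨i, rfl⟩
      · exact Or.inr ⟨Fin.castAdd d i, rfl⟩
  · intro v v' hvv
    have key : ∀ n : ℕ, ∀ i : Fin d, d - (i : ℕ) = n → v (Fin.natAdd q i) = v' (Fin.natAdd q i) := by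
      intro n
      induction n using Nat.strong_induction_on with
      | _ n ih =>
        intro i hi
        have h1 := congrFun hvv (Fin.natAdd q i)
        simp only [hf, Fin.append_right, hg] at h1
        by_cases hN : 1 ≤ ((Fin.natAdd q i : Fin (q + d)) : ℕ) ∧
            ((Fin.natAdd q i : Fin (q + d)) : ℕ) - 1 < d
        · rw [dif_pos hN, dif_pos hN, ih _ ?_ ⟨_, hN.2⟩ rfl] at h1
          · exact sub_left_injective h1
          · simp only [Fin.val_natAdd] at hN ⊢
            omega
        · rwa [dif_neg hN, dif_neg hN, sub_zero, sub_zero] at h1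
    have hgg : g v = g v' := by
      ext N
      simp only [hg, key _ _ rfl]
    have hlow' : low v = low v' := by
      refine (h s hs).1 (funext fun i => ?_)
      have h1 := congrFun hvv (Fin.castAdd d i)
      simp only [hgg, hf, Fin.append_left] at h1
      exact sub_left_injective h1
    ext N
    refine Fin.addCases (fun i => congrFun hlow' i) (fun i => key _ i rfl) N
  · have h1 := (h s hs).2 (low v) i
    have h2 : ∑ N : Fin (q + d), s i ^ (N : ℕ) * g v N =
        ∑ x : Fin d, s i ^ ((x : ℕ) + 1) * v (Fin.natAdd q x) := by
      symm
      refine Finset.sum_of_injOn (fun x : Fin d => (⟨x + 1, by omega⟩ : Fin (q + d))) ?_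
        (by simp) ?_ ?_
      · intro x _ x' _ hxx
        simpa [Fin.ext_iff] using hxx
      · intro N _ hN
        have : ¬ (1 ≤ (N : ℕ) ∧ (N : ℕ) - 1 < d) := by
          intro hN'
          refine hN ⟨⟨N - 1, hN'.2⟩, by simp, Fin.ext ?_⟩
          simp only
          omega
        simp only [hg, dif_neg this, mul_zero]
      · intro x _
        have : 1 ≤ (x : ℕ) + 1 ∧ (x : ℕ) + 1 - 1 < d := ⟨by omega, by omega⟩
        simp only [hg, dif_pos this]
        rfl
    simp only [mul_sub, Finset.sum_sub_distrib]
    rw [h2, Fin.sum_univ_add]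
    simp only [hf, Fin.append_left, Fin.append_right, Fin.val_castAdd, Fin.val_natAdd, pow_add,
      hcard, h1]
    simp only [pow_one, mul_comm (s i), add_sub_cancel_right]
    rfl

end Exists

end AdditiveFFT

/-! ### The distribution of the encoding -/

namespace DPSet

set_option linter.unusedSectionVars false

open Matrix

section Solutions

variable {K U : Type*} [Field K]

theorem linearIndependent_vandermondeRow (ι : U ↪ K) (k : ℕ) (T : Finset U) (hT : T.card ≤ k) :
    LinearIndependent K (fun s : T => vandermondeRow ι k s) := by
  rw [← linearIndependent_equiv T.equivFin.symm]
  refine LinearIndependent.of_comp (LinearMap.funLeft K K (Fin.castLE hT)) ?_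
  have hdet : (Matrix.vandermonde fun i => ι (T.equivFin.symm i)).det ≠ 0 := by
    rw [det_vandermonde_ne_zero_iff]
    exact ι.injective.comp (Subtype.val_injective.comp T.equivFin.symm.injective)
  exact Matrix.linearIndependent_rows_of_det_ne_zero hdet

variable [Fintype K] {m : ℕ} {row : U → Fin m → K} {T : Finset U}

open Classical in
theorem card_solutions (hT : LinearIndependent K (fun s : T => row s)) (b : U → K) :
    (Finset.univ.filter fun x : Fin m → K => ∀ s ∈ T, row s ⬝ᵥ x = b s).card *
      Fintype.card K ^ T.card = Fintype.card K ^ m := by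
  set f : (Fin m → K) →ₗ[K] (T → K) := Matrix.mulVecLin (Matrix.of fun s : T => row s) with hf
  have hsurj : Function.Surjective f := by
    rw [← LinearMap.range_eq_top]
    refine Submodule.eq_top_of_finrank_eq ?_
    have h1 : (Matrix.of fun s : T => row s).rank = Fintype.card T :=
      LinearIndependent.rank_matrix hT
    rw [Matrix.rank] at h1
    rw [h1]
    simp
  have hfib : ∀ y : T → K, (Finset.univ.filter fun x => f x = y).card =
      (Finset.univ.filter fun x : Fin m → K => ∀ s ∈ T, row s ⬝ᵥ x = b s).card := by
    intro y
    have h1 := AddMonoidHom.card_fiber_eq_of_mem_range f (hsurj y) (hsurj fun s => b s)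
    rw [h1]
    congr 1
    ext x
    simp only [Finset.mem_filter, Finset.mem_univ, true_and, funext_iff, Subtype.forall]
    rfl
  have h2 := Finset.card_eq_sum_card_fiberwise (f := f) (s := Finset.univ) (t := Finset.univ)
    fun _ _ => Finset.mem_coe.2 (Finset.mem_univ _)
  simp only [hfib] at h2
  simpa [mul_comm] using h2.symm

theorem solve_apply_none (hT : LinearIndependent K (fun s : T => row s)) (b : U → K) :
    solve row T b none = 0 := by
  classical
  have hpos : 0 < Fintype.card K ^ m := pow_pos Fintype.card_pos m
  have hne : (Finset.univ.filter fun x : Fin m → K => ∀ s ∈ T, row s ⬝ᵥ x = b s).Nonempty := by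
    rw [← Finset.card_pos]
    rw [← card_solutions hT b] at hpos
    exact Nat.pos_of_mul_pos_right hpos
  have h : LinearIndependent K (fun s : T => row s) ∧
      (Finset.univ.filter fun x : Fin m → K => ∀ s ∈ T, row s ⬝ᵥ x = b s).Nonempty := ⟨hT, hne⟩
  rw [solve, dif_pos (by convert h)]
  simp [PMF.map_apply]

open Classical in
theorem solve_apply_some (hT : LinearIndependent K (fun s : T => row s)) (b : U → K)
    (x : Fin m → K) :
    solve row T b (some x) = (Fintype.card K ^ m : ℝ≥0∞)⁻¹ *
      ∏ s ∈ T, (if row s ⬝ᵥ x = b s then (Fintype.card K : ℝ≥0∞) else 0) := by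
  have hpos : 0 < Fintype.card K ^ m := pow_pos Fintype.card_pos m
  have hcard := card_solutions hT b
  set sols := Finset.univ.filter fun x : Fin m → K => ∀ s ∈ T, row s ⬝ᵥ x = b s with hsols
  have hne : sols.Nonempty := by
    rw [← Finset.card_pos]
    rw [← hcard] at hpos
    exact Nat.pos_of_mul_pos_right hpos
  have h : LinearIndependent K (fun s : T => row s) ∧ sols.Nonempty := ⟨hT, hne⟩
  have h1 : solve row T b (some x) = PMF.uniformOfFinset sols hne x := by
    rw [solve, dif_pos (by convert h), PMF.map_apply, tsum_eq_single x]
    · simp only [if_true]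
      congr!
    · intro y hy
      rw [if_neg]
      simpa using hy.symm
  rw [h1, PMF.uniformOfFinset_apply]
  by_cases hx : x ∈ sols
  · have hx' : ∀ s ∈ T, row s ⬝ᵥ x = b s := (Finset.mem_filter.1 hx).2
    rw [if_pos hx, Finset.prod_congr rfl fun s hs => if_pos (hx' s hs), Finset.prod_const]
    have h3 : (sols.card : ℝ≥0∞) * (Fintype.card K : ℝ≥0∞) ^ T.card =
        (Fintype.card K : ℝ≥0∞) ^ m := by exact_mod_cast hcard
    have hK : (Fintype.card K : ℝ≥0∞) ^ T.card ≠ 0 :=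
      pow_ne_zero _ (by exact_mod_cast Fintype.card_ne_zero)
    have hK' : (Fintype.card K : ℝ≥0∞) ^ T.card ≠ ⊤ := ENNReal.pow_ne_top (by simp)
    rw [← h3, ENNReal.mul_inv (Or.inr hK') (Or.inr hK), mul_assoc, ENNReal.inv_mul_cancel hK hK',
      mul_one]
  · have : ∃ s ∈ T, row s ⬝ᵥ x ≠ b s := by
      by_contra hcon
      push Not at hcon
      exact hx (Finset.mem_filter.2 ⟨Finset.mem_univ x, hcon⟩)
    obtain ⟨s, hs, hne'⟩ := this
    rw [if_neg hx, Finset.prod_eq_zero hs (if_neg hne'), mul_zero]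

end Solutions

section Density

variable {K U : Type*} [Field K] [Fintype K] [Fintype U] {m : ℕ} (A : Finset K)
  (hA : A.Nonempty) (p : ℝ≥0) (hp : p ≤ 1) (row : U → Fin m → K)

open Classical in
/-- The density, relative to the uniform distribution, that one element of the represented set
contributes to the distribution of the encoding. -/
noncomputable def weight (v : K) : ℝ≥0∞ :=
  p + if v ∈ A then ((1 - p : ℝ≥0) : ℝ≥0∞) * (Fintype.card K / A.card) else 0

/-- The distribution of the result of the solver for a given hash function. -/
noncomputable def solverLaw (h : U → K) (S : Finset U) : PMF (Option (Fin m → K)) :=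
  open Classical in
  (subsample p hp S).bind fun T =>
  (PMF.uniformOfFinset (Fintype.piFinset fun _ : U => A)
    (Fintype.piFinset_nonempty.2 fun _ => hA)).bind fun a =>
  solve row T (fun s => h s + a s)

open Classical in
theorem encode_eq (S : Finset U) :
    encode A hA p hp row S = (PMF.uniformOfFintype (U → K)).bind fun h =>
      (solverLaw A hA p hp row h S).map fun r =>
        match r with
        | some x => Sum.inl (x, h)
        | none => Sum.inr S := by
  simp only [encode, solverLaw, PMF.map_bind]

open Classical in
theorem subsample_apply {S T : Finset U} (hT : T ∈ S.powerset) :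
    subsample p hp S T = (((1 - p) ^ T.card * p ^ (S.card - T.card) : ℝ≥0) : ℝ≥0∞) := by
  rw [subsample, PMF.ofFinset_apply, if_pos hT]

variable {A hA p hp row} {S : Finset U}

theorem solverLaw_none (hS : ∀ T ⊆ S, LinearIndependent K (fun s : T => row s)) (h : U → K) :
    solverLaw A hA p hp row h S none = 0 := by
  classical
  rw [solverLaw, PMF.bind_apply, ENNReal.tsum_eq_zero]
  intro T
  by_cases hT : T ∈ S.powerset
  · rw [PMF.bind_apply]
    simp [solve_apply_none (hS T (Finset.mem_powerset.1 hT))]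
  · rw [subsample, PMF.ofFinset_apply, if_neg hT, zero_mul]

theorem solverLaw_some (hS : ∀ T ⊆ S, LinearIndependent K (fun s : T => row s)) (h : U → K)
    (x : Fin m → K) :
    solverLaw A hA p hp row h S (some x) = (Fintype.card K ^ m : ℝ≥0∞)⁻¹ *
      ∏ s ∈ S, weight A p (row s ⬝ᵥ x - h s) := by
  classical
  have hA0 : (A.card : ℝ≥0∞) ≠ 0 := by exact_mod_cast hA.card_ne_zero
  have hAt : (A.card : ℝ≥0∞) ≠ ⊤ := ENNReal.natCast_ne_top _
  have h1 : ∀ T ⊆ S, ((PMF.uniformOfFinset (Fintype.piFinset fun _ : U => A)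
      (Fintype.piFinset_nonempty.2 fun _ => hA)).bind fun a =>
      solve row T (fun s => h s + a s)) (some x) = (Fintype.card K ^ m : ℝ≥0∞)⁻¹ *
      ∏ s ∈ T, (if row s ⬝ᵥ x - h s ∈ A then (Fintype.card K / A.card : ℝ≥0∞) else 0) := by
    intro T hT
    rw [PMF.bind_apply, tsum_eq_sum (s := Fintype.piFinset fun _ : U => A)]
    · have h2 : ∀ a ∈ Fintype.piFinset fun _ : U => A,
          PMF.uniformOfFinset (Fintype.piFinset fun _ : U => A)
            (Fintype.piFinset_nonempty.2 fun _ => hA) a *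
            solve row T (fun s => h s + a s) (some x) = (Fintype.card K ^ m : ℝ≥0∞)⁻¹ *
          ∏ u : U, (A.card : ℝ≥0∞)⁻¹ * (if u ∈ T then
            if row u ⬝ᵥ x - h u = a u then (Fintype.card K : ℝ≥0∞) else 0 else 1) := by
        intro a ha
        rw [solve_apply_some (hS T hT), PMF.uniformOfFinset_apply_of_mem _ ha,
          Fintype.card_piFinset, Finset.prod_const, Finset.prod_mul_distrib, Finset.prod_const,
          Finset.prod_ite_mem, Finset.univ_inter, Nat.cast_pow, ENNReal.inv_pow]
        simp only [sub_eq_iff_eq_add']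
        ring
      rw [Finset.sum_congr rfl h2, ← Finset.mul_sum, ← Finset.prod_univ_sum (fun _ => A)
        (fun u y => (A.card : ℝ≥0∞)⁻¹ * (if u ∈ T then
            if row u ⬝ᵥ x - h u = y then (Fintype.card K : ℝ≥0∞) else 0 else 1))]
      congr 1
      have h3 : ∀ f : U → ℝ≥0∞, ∏ u ∈ T, f u = ∏ u, if u ∈ T then f u else 1 := fun f => by
        rw [Finset.prod_ite_mem, Finset.univ_inter]
      rw [h3]
      refine Finset.prod_congr rfl fun u _ => ?_
      rw [← Finset.mul_sum]
      by_cases hu : u ∈ T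
      · rw [if_pos hu, Finset.sum_congr rfl fun y _ => if_pos hu, mul_comm]
        by_cases hv : row u ⬝ᵥ x - h u ∈ A
        · rw [if_pos hv, Finset.sum_eq_single_of_mem _ hv fun y _ hy => if_neg hy.symm,
            if_pos rfl, div_eq_mul_inv]
        · rw [if_neg hv, Finset.sum_eq_zero, zero_mul]
          exact fun y hy => if_neg fun h => hv (by rwa [h])
      · simp [hu, ENNReal.inv_mul_cancel hA0 hAt]
    · intro a ha
      rw [PMF.uniformOfFinset_apply_of_notMem _ ha, zero_mul]
  rw [solverLaw, PMF.bind_apply, tsum_eq_sum (s := S.powerset)]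
  · simp only [weight, add_comm (p : ℝ≥0∞), Finset.prod_add]
    rw [Finset.mul_sum]
    refine Finset.sum_congr rfl fun T hT => ?_
    have hT' := Finset.mem_powerset.1 hT
    rw [h1 T hT', subsample_apply p hp hT, Finset.prod_const, Finset.card_sdiff_of_subset hT']
    simp only [← mul_ite_zero]
    rw [Finset.prod_mul_distrib, Finset.prod_const, ENNReal.coe_mul, ENNReal.coe_pow,
      ENNReal.coe_pow]
    ring
  · intro T hT
    rw [subsample, PMF.ofFinset_apply, if_neg hT, zero_mul]

theorem encode_inr (hS : ∀ T ⊆ S, LinearIndependent K (fun s : T => row s)) (S' : Finset U) :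
    encode A hA p hp row S (Sum.inr S') = 0 := by
  classical
  rw [encode_eq, PMF.bind_apply, ENNReal.tsum_eq_zero]
  intro h
  rw [PMF.map_apply, ENNReal.tsum_eq_zero.2, mul_zero]
  rintro (_ | x)
  · rw [solverLaw_none hS, ite_self]
  · simp

open Classical in
theorem encode_inl (hS : ∀ T ⊆ S, LinearIndependent K (fun s : T => row s))
    (x : Fin m → K) (h : U → K) :
    encode A hA p hp row S (Sum.inl (x, h)) =
      (Fintype.card (U → K) : ℝ≥0∞)⁻¹ * ((Fintype.card K ^ m : ℝ≥0∞)⁻¹ *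
        ∏ s ∈ S, weight A p (row s ⬝ᵥ x - h s)) := by
  rw [encode_eq, PMF.bind_apply, tsum_eq_single h, PMF.uniformOfFintype_apply, PMF.map_apply,
    tsum_eq_single (some x), if_pos rfl, solverLaw_some hS]
  · rintro (_ | y) hy
    · simp
    · rw [if_neg]
      simpa using fun h' => hy (by rw [h'])
  · intro g hg
    rw [PMF.map_apply, ENNReal.tsum_eq_zero.2, mul_zero]
    rintro (_ | y)
    · simp
    · rw [if_neg]
      simpa using fun _ h => hg h.symm

theorem exists_eq_inl_of_mem_support (hS : ∀ T ⊆ S, LinearIndependent K (fun s : T => row s))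
    {e : Encoding K U m} (he : e ∈ (encode A hA p hp row S).support) :
    ∃ (x : Fin m → K) (h : U → K), e = Sum.inl (x, h) := by
  rcases e with ⟨x, h⟩ | S'
  · exact ⟨x, h, rfl⟩
  · exact absurd (encode_inr hS S') he

/-- The mechanism is private as soon as adding one element to the represented set changes the
density by a factor between `exp (-ε)` and `exp ε`. -/
theorem mechanism_isDP {k : ℕ} {ε : ℝ}
    (hS : ∀ T : Finset U, T.card ≤ k → LinearIndependent K (fun s : T => row s))
    (h1 : ∀ v, weight A p v ≤ ENNReal.ofReal (Real.exp ε))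
    (h2 : ∀ v, 1 ≤ ENNReal.ofReal (Real.exp ε) * weight A p v) :
    (mechanism A hA p hp row).IsDP k ε 0 := by
  classical
  intro S T hSk hTk hST R
  have hS' : ∀ X ⊆ S, LinearIndependent K (fun s : X => row s) := fun X hX =>
    hS X ((Finset.card_le_card hX).trans hSk)
  have hT' : ∀ X ⊆ T, LinearIndependent K (fun s : X => row s) := fun X hX =>
    hS X ((Finset.card_le_card hX).trans hTk)
  have hprod : ∀ w : U → ℝ≥0∞, (∀ u, w u ≤ ENNReal.ofReal (Real.exp ε)) →
      (∀ u, 1 ≤ ENNReal.ofReal (Real.exp ε) * w u) →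
      ∏ s ∈ S, w s ≤ ENNReal.ofReal (Real.exp ε) * ∏ s ∈ T, w s := by
    intro w hw1 hw2
    rw [← Finset.prod_sdiff (Finset.inter_subset_left : S ∩ T ⊆ S),
      ← Finset.prod_sdiff (Finset.inter_subset_right : S ∩ T ⊆ T), ← mul_assoc,
      Finset.sdiff_inter_self_left, Finset.sdiff_inter_self_right]
    refine mul_le_mul_left ?_ _
    have hcard : (S \ T).card + (T \ S).card = 1 := by
      rw [← Finset.card_union_of_disjoint disjoint_sdiff_sdiff]
      exact hST
    rcases Nat.eq_zero_or_pos (S \ T).card with h0 | h0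
    · obtain ⟨u, hu⟩ := Finset.card_eq_one.1 (show (T \ S).card = 1 by omega)
      rw [Finset.card_eq_zero.1 h0, hu, Finset.prod_empty, Finset.prod_singleton]
      exact hw2 u
    · obtain ⟨u, hu⟩ := Finset.card_eq_one.1 (show (S \ T).card = 1 by omega)
      rw [Finset.card_eq_zero.1 (show (T \ S).card = 0 by omega), hu, Finset.prod_empty,
        Finset.prod_singleton, mul_one]
      exact hw1 u
  rw [ENNReal.ofReal_zero, add_zero, PMF.toOuterMeasure_apply, PMF.toOuterMeasure_apply,
    ← ENNReal.tsum_mul_left]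
  refine ENNReal.tsum_le_tsum fun e => ?_
  by_cases he : e ∈ R
  · rw [Set.indicator_of_mem he, Set.indicator_of_mem he]
    change encode A hA p hp row S e ≤ _ * encode A hA p hp row T e
    rcases e with ⟨x, h⟩ | S'
    · rw [encode_inl hS', encode_inl hT']
      calc _ ≤ (Fintype.card (U → K) : ℝ≥0∞)⁻¹ * ((Fintype.card K ^ m : ℝ≥0∞)⁻¹ *
            (ENNReal.ofReal (Real.exp ε) * ∏ s ∈ T, weight A p (row s ⬝ᵥ x - h s))) := by
            gcongr
            exact hprod _ (fun _ => h1 _) fun _ => h2 _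
        _ = _ := by ring
    · rw [encode_inr hS']
      exact zero_le
  · rw [Set.indicator_of_notMem he]
    exact zero_le

theorem sum_weight (hA : A.Nonempty) (hp : p ≤ 1) : ∑ v, weight A p v = Fintype.card K := by
  classical
  have hA0 : (A.card : ℝ≥0∞) ≠ 0 := by exact_mod_cast hA.card_ne_zero
  have hAt : (A.card : ℝ≥0∞) ≠ ⊤ := ENNReal.natCast_ne_top _
  simp only [weight]
  rw [Finset.sum_add_distrib, Finset.sum_const, Finset.sum_ite_mem, Finset.univ_inter,
    Finset.sum_const, nsmul_eq_mul, nsmul_eq_mul, mul_left_comm, ENNReal.mul_div_cancel hA0 hAt,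
    Finset.card_univ, mul_comm, ← add_mul, ← ENNReal.coe_add, add_tsub_cancel_of_le hp,
    ENNReal.coe_one, one_mul]

open Classical in
theorem mechanism_hasError {k : ℕ} {α : ℝ}
    (hS : ∀ T : Finset U, T.card ≤ k → LinearIndependent K (fun s : T => row s))
    (h1 : (A.card : ℝ≥0∞) ≤ ENNReal.ofReal α * Fintype.card K)
    (h2 : ∑ v, (if v ∈ A then 0 else weight A p v) ≤ ENNReal.ofReal α * Fintype.card K) :
    (mechanism A hA p hp row).HasError k α := by
  classical
  intro S hSk Q
  have hS' : ∀ X ⊆ S, LinearIndependent K (fun s : X => row s) := fun X hX =>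
    hS X ((Finset.card_le_card hX).trans hSk)
  have hq0 : (Fintype.card K : ℝ≥0∞) ≠ 0 := by exact_mod_cast Fintype.card_ne_zero
  have hqt : (Fintype.card K : ℝ≥0∞) ≠ ⊤ := ENNReal.natCast_ne_top _
  set f : U → K → ℝ≥0∞ := fun u v => (if u ∈ Q then if ¬(v ∈ A ↔ u ∈ S) then 1 else 0 else 1) *
    (if u ∈ S then weight A p v else 1) with hf
  have hfsum : ∀ u, (Fintype.card K : ℝ≥0∞)⁻¹ * ∑ v, f u v ≤
      if u ∈ Q then ENNReal.ofReal α else 1 := by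
    intro u
    rw [mul_comm, ← div_eq_mul_inv]
    refine ENNReal.div_le_of_le_mul ?_
    by_cases hQ : u ∈ Q <;> by_cases hu : u ∈ S
    · simpa [hf, hQ, hu] using h2
    · simpa [hf, hQ, hu] using h1
    · simp [hf, hQ, hu, sum_weight hA hp]
    · simp [hf, hQ, hu]
  have hpt : ∀ (x : Fin m → K) (h : U → K), Set.indicator
      {e | ∀ q ∈ Q, (mechanism A hA p hp row).decode e q ≠ decide (q ∈ S)}
      ((mechanism A hA p hp row).encode S) (Sum.inl (x, h)) =
      (Fintype.card K ^ m : ℝ≥0∞)⁻¹ *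
        ∏ u, (Fintype.card K : ℝ≥0∞)⁻¹ * f u (row u ⬝ᵥ x - h u) := by
    intro x h
    have hQ : ∏ u, (if u ∈ Q then if ¬(row u ⬝ᵥ x - h u ∈ A ↔ u ∈ S) then (1 : ℝ≥0∞) else 0
        else 1) =
        if (Sum.inl (x, h) : Encoding K U m) ∈
          {e | ∀ q ∈ Q, (mechanism A hA p hp row).decode e q ≠ decide (q ∈ S)} then 1 else 0 := by
      rw [Finset.prod_ite_mem, Finset.univ_inter, Finset.prod_boole]
      congr 1
      simp [mechanism, decode]
    simp only [hf]
    rw [Finset.prod_mul_distrib, Finset.prod_mul_distrib, Finset.prod_const, hQ,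
      Finset.prod_ite_mem, Finset.univ_inter, Set.indicator_apply]
    split_ifs
    · change encode A hA p hp row S _ = _
      rw [encode_inl hS', Fintype.card_fun, Nat.cast_pow, ENNReal.inv_pow, Finset.card_univ,
        one_mul]
      ring
    · simp
  rw [PMF.toOuterMeasure_apply, tsum_fintype, Fintype.sum_sum_type, Fintype.sum_prod_type]
  have hinr : ∑ S', Set.indicator
      {e | ∀ q ∈ Q, (mechanism A hA p hp row).decode e q ≠ decide (q ∈ S)}
      ((mechanism A hA p hp row).encode S) (Sum.inr S') = 0 :=
    Finset.sum_eq_zero fun S' _ => Set.indicator_apply_eq_zero.2 fun _ =>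
      encode_inr (hA := hA) (hp := hp) hS' S'
  rw [hinr, add_zero]
  calc _ ≤ ∑ x : Fin m → K, (Fintype.card K ^ m : ℝ≥0∞)⁻¹ * ENNReal.ofReal α ^ Q.card := by
        refine Finset.sum_le_sum fun x _ => ?_
        rw [Finset.sum_congr rfl fun h _ => hpt x h, ← Finset.mul_sum]
        gcongr
        rw [← Fintype.piFinset_univ, ← Finset.prod_univ_sum (fun _ => Finset.univ)
          (fun u v => (Fintype.card K : ℝ≥0∞)⁻¹ * f u (row u ⬝ᵥ x - v))]
        calc _ ≤ ∏ u, if u ∈ Q then ENNReal.ofReal α else 1 := by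
              refine Finset.prod_le_prod' fun u _ => ?_
              rw [← Finset.mul_sum]
              have hsub := Equiv.sum_comp (Equiv.subLeft (row u ⬝ᵥ x)) (f u)
              simp only [Equiv.subLeft_apply] at hsub
              rw [hsub]
              exact hfsum u
          _ = _ := by rw [Finset.prod_ite_mem, Finset.univ_inter, Finset.prod_const]
    _ = _ := by
        rw [Finset.sum_const, nsmul_eq_mul, Finset.card_univ, Fintype.card_fun, Fintype.card_fin,
          Nat.cast_pow, ← mul_assoc,
          ENNReal.mul_inv_cancel (pow_ne_zero _ hq0) (ENNReal.pow_ne_top hqt), one_mul]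

theorem exclusion_eq {ε : ℝ} (hp : (p : ℝ) =
    (1 / (Real.exp ε + 1)) / (1 - 1 / (Real.exp ε + 1))) : (p : ℝ) = (Real.exp ε)⁻¹ := by
  have hE := Real.exp_pos ε
  rw [hp]
  have : 1 - 1 / (Real.exp ε + 1) = Real.exp ε / (Real.exp ε + 1) := by field_simp; ring
  rw [this]
  field_simp

open Classical in
theorem weight_eq (hA : A.Nonempty) {ε : ℝ} (hp1 : p ≤ 1)
    (hAK : (A.card : ℝ) * (Real.exp ε + 1) = Fintype.card K)
    (hp : (p : ℝ) = (Real.exp ε)⁻¹) (v : K) :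
    weight A p v = ENNReal.ofReal (if v ∈ A then Real.exp ε else (Real.exp ε)⁻¹) := by
  have hE := Real.exp_pos ε
  have hA0 : (0 : ℝ) < A.card := by exact_mod_cast hA.card_pos
  have hp' : (p : ℝ≥0∞) = ENNReal.ofReal (Real.exp ε)⁻¹ := by
    rw [← hp, ENNReal.ofReal_coe_nnreal]
  rw [weight]
  split_ifs with hv
  · have h1 : ((1 - p : ℝ≥0) : ℝ≥0∞) = ENNReal.ofReal (1 - (Real.exp ε)⁻¹) := by
      rw [← hp, ← NNReal.coe_one, ← NNReal.coe_sub hp1, ENNReal.ofReal_coe_nnreal]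
    have h2 : (Fintype.card K / A.card : ℝ≥0∞) = ENNReal.ofReal (Real.exp ε + 1) := by
      rw [← ENNReal.ofReal_natCast, ← ENNReal.ofReal_natCast, ← ENNReal.ofReal_div_of_pos hA0,
        ← hAK, mul_div_cancel_left₀ _ hA0.ne']
    have h3 : (0 : ℝ) ≤ 1 - (Real.exp ε)⁻¹ := by
      rw [← hp, sub_nonneg]
      exact_mod_cast hp1
    rw [h1, h2, hp', ← ENNReal.ofReal_mul h3, ← ENNReal.ofReal_add (by positivity) (by positivity)]
    congr 1
    field_simp
    ring
  · rw [add_zero, hp']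

/-- The mechanism with `|A| = |K| / (exp ε + 1)` and `p = exp (-ε)`: privacy and utility. -/
theorem mechanism_isDP_and_hasError {k : ℕ} {ε : ℝ} (hε : 0 ≤ ε)
    (hS : ∀ T : Finset U, T.card ≤ k → LinearIndependent K (fun s : T => row s))
    (hAK : (A.card : ℝ) * (Real.exp ε + 1) = Fintype.card K) (hpε : (p : ℝ) = (Real.exp ε)⁻¹) :
    (mechanism A hA p hp row).IsDP k ε 0 ∧
      (mechanism A hA p hp row).HasError k (1 / (Real.exp ε + 1)) := by
  classical
  have hE := Real.exp_pos ε
  have hE1 := Real.one_le_exp hε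
  have hw := weight_eq hA hp hAK hpε
  refine ⟨mechanism_isDP hS (fun v => ?_) fun v => ?_, mechanism_hasError hS ?_ ?_⟩
  · rw [hw]
    refine ENNReal.ofReal_le_ofReal ?_
    split_ifs
    · exact le_rfl
    · exact (inv_le_one_of_one_le₀ hE1).trans hE1
  · rw [hw, ← ENNReal.ofReal_mul hE.le, ENNReal.one_le_ofReal]
    split_ifs
    · nlinarith
    · rw [mul_inv_cancel₀ hE.ne']
  · rw [← ENNReal.ofReal_natCast, ← ENNReal.ofReal_natCast, ← ENNReal.ofReal_mul (by positivity),
      ← hAK]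
    refine ENNReal.ofReal_le_ofReal (le_of_eq ?_)
    field_simp
  · have h1 : ∀ v, (if v ∈ A then 0 else weight A p v) =
        if v ∈ Aᶜ then ENNReal.ofReal (Real.exp ε)⁻¹ else 0 := by
      intro v
      by_cases hv : v ∈ A <;> simp [hv, hw]
    have h2 : ((Aᶜ.card : ℕ) : ℝ) = A.card * Real.exp ε := by
      rw [Finset.card_compl, Nat.cast_sub (Finset.card_le_univ A), ← hAK]
      ring
    rw [Finset.sum_congr rfl fun v _ => h1 v, Finset.sum_ite_mem, Finset.univ_inter,
      Finset.sum_const, nsmul_eq_mul, ← ENNReal.ofReal_natCast, ← ENNReal.ofReal_natCast,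
      ← ENNReal.ofReal_mul (by positivity), ← ENNReal.ofReal_mul (by positivity), h2, ← hAK]
    refine ENNReal.ofReal_le_ofReal (le_of_eq ?_)
    field_simp

end Density

end DPSet

/-! ### Computation trees for decoding and encoding -/

namespace CompTree

set_option linter.unusedSectionVars false

open StraightLine

variable {K β : Type*} [Field K] [Fintype K] {A : Finset K} {hA : A.Nonempty} {H : K → K}

/-- The bias of a coin toss. -/
noncomputable def coinLaw (p : ℝ≥0) (hp : p ≤ 1) : PMF Bool :=
  PMF.ofFintype (fun b : Bool => ((cond b p (1 - p) : ℝ≥0) : ℝ≥0∞)) (by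
    simp only [Fintype.sum_bool, cond_true, cond_false]
    rw [← ENNReal.coe_add, add_tsub_cancel_of_le hp, ENNReal.coe_one])

/-- Arithmetic steps can be carried out by a program that uses one fresh register for each. -/
theorem exists_program {X Y : Type*} {G T : Set (X → K)} {c : ℕ} (h : Reach G c T) (π : Y → X)
    (N : ℕ) (μ : Y → ℕ → K) (hG : ∀ f ∈ G, ∃ n < N, ∀ y, μ y n = f (π y)) :
    ∃ (μ' : Y → ℕ → K) (P : CompTree K β → CompTree K β),
      (∀ t, (P t).cost = t.cost + c) ∧
      (∀ (A : Finset K) (hA : A.Nonempty) (H : K → K) (t : CompTree K β) (y : Y),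
        (P t).run A hA H (μ y) = t.run A hA H (μ' y)) ∧
      ∀ f ∈ T, ∃ n < N + c, ∀ y, μ' y n = f (π y) := by
  induction h with
  | refl => exact ⟨μ, id, fun _ => rfl, fun _ _ _ _ _ => rfl, hG⟩
  | @step c T f _ hf ih =>
    obtain ⟨μ', P, hc, hP, hT⟩ := ih
    have key : ∃ ins : Instr K, ∀ (A : Finset K) (hA : A.Nonempty) (H : K → K) (y : Y),
        ins.eval A hA H (μ' y) = PMF.pure (f (π y)) := by
      cases hf with
      | const a => exact ⟨.const a, fun _ _ _ _ => rfl⟩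
      | add hf hg =>
        obtain ⟨i, -, hi⟩ := hT _ hf
        obtain ⟨i', -, hi'⟩ := hT _ hg
        exact ⟨.add i i', fun _ _ _ y => by simp [Instr.eval, hi, hi']⟩
      | sub hf hg =>
        obtain ⟨i, -, hi⟩ := hT _ hf
        obtain ⟨i', -, hi'⟩ := hT _ hg
        exact ⟨.sub i i', fun _ _ _ y => by simp [Instr.eval, hi, hi']⟩
      | mul hf hg =>
        obtain ⟨i, -, hi⟩ := hT _ hf
        obtain ⟨i', -, hi'⟩ := hT _ hg
        exact ⟨.mul i i', fun _ _ _ y => by simp [Instr.eval, hi, hi']⟩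
      | inv hf =>
        obtain ⟨i, -, hi⟩ := hT _ hf
        exact ⟨.inv i, fun _ _ _ y => by simp [Instr.eval, hi]⟩
    obtain ⟨ins, hins⟩ := key
    refine ⟨fun y => Function.update (μ' y) (N + c) (f (π y)),
      fun t => P (exec (N + c) ins t), fun t => ?_, fun A hA H t y => ?_, ?_⟩
    · rw [hc, cost]
      ring
    · rw [hP, run, hins, PMF.pure_bind]
    · rintro g (rfl | hg)
      · exact ⟨N + c, by omega, fun y => Function.update_self _ _ _⟩
      · obtain ⟨n, hn, hn'⟩ := hT g hg
        exact ⟨n, by omega, fun y => (Function.update_of_ne hn.ne _ _).trans (hn' y)⟩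

/-! #### Horner's scheme -/

/-- Horner's scheme for the polynomial with the coefficients in registers `0, …, n - 1` at the point
in register `k`, with the accumulator in register `k + 1`. -/
def horner (k : ℕ) : ℕ → CompTree K β → CompTree K β
  | 0, t => t
  | n + 1, t => exec (k + 1) (.mul (k + 1) k) (exec (k + 1) (.add (k + 1) n) (horner k n t))

theorem cost_horner (k n : ℕ) (t : CompTree K β) : (horner k n t).cost = t.cost + 2 * n := by
  induction n with
  | zero => rfl
  | succ n ih => simp only [horner, cost, ih]; ring

theorem run_horner {k n : ℕ} (hn : n ≤ k) (t : CompTree K β) (μ : ℕ → K) :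
    (horner k n t).run A hA H μ = t.run A hA H (Function.update μ (k + 1)
      (μ (k + 1) * μ k ^ n + ∑ i ∈ Finset.range n, μ i * μ k ^ i)) := by
  induction n generalizing μ with
  | zero => simp [horner]
  | succ n ih =>
    rw [horner, run, Instr.eval, PMF.pure_bind, run, Instr.eval, PMF.pure_bind, ih (by omega)]
    rw [Function.update_idem, Function.update_idem]
    have h1 : ∀ i < k + 1, ∀ (a b : K), Function.update (Function.update μ (k + 1) a) (k + 1) b i =
        μ i := fun i hi a b => by
      rw [Function.update_of_ne hi.ne, Function.update_of_ne hi.ne]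
    rw [Finset.sum_range_succ, Function.update_self, h1 k (by omega), Function.update_self,
      Function.update_of_ne (by omega : n ≠ k + 1), Finset.sum_congr rfl fun i hi => by
        rw [h1 i (by have := Finset.mem_range.1 hi; omega)]]
    congr 2
    ring

/-! #### Evaluating the hash function, drawing random elements -/

/-- Write the hash values of registers `0, …, n - 1` into the registers from `j` on. -/
def hashes (j : ℕ) : ℕ → CompTree K β → CompTree K β
  | 0, t => t
  | n + 1, t => hashes j n (exec (j + n) (.hash n) t)

theorem cost_hashes (j n : ℕ) (t : CompTree K β) : (hashes j n t).cost = t.cost + n := by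
  induction n generalizing t with
  | zero => rfl
  | succ n ih => simp only [hashes, cost, ih]; ring

/-- The register contents `μ`, with `v` written into the registers from `d` on. -/
def fill (d : ℕ) (μ : ℕ → K) {n : ℕ} (v : Fin n → K) : ℕ → K :=
  fun r => if h : d ≤ r ∧ r - d < n then v ⟨r - d, h.2⟩ else μ r

theorem fill_of_lt {d r : ℕ} (μ : ℕ → K) {n : ℕ} (v : Fin n → K) (h : r < d) :
    fill d μ v r = μ r := dif_neg fun h' => by omega

theorem fill_add {d : ℕ} (μ : ℕ → K) {n : ℕ} (v : Fin n → K) (i : Fin n) :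
    fill d μ v (d + i) = v i := by
  rw [fill, dif_pos (by omega)]
  congr 1
  ext
  simp

theorem fill_zero {d : ℕ} (μ : ℕ → K) (v : Fin 0 → K) : fill d μ v = μ :=
  funext fun r => dif_neg fun h => by omega

theorem update_fill {d : ℕ} (μ : ℕ → K) {n : ℕ} (v : Fin n → K) (a : K) :
    Function.update (fill d μ v) (d + n) a = fill d μ (Fin.snoc (α := fun _ => K) v a) := by
  funext r
  rcases lt_trichotomy r (d + n) with h | rfl | h
  · rw [Function.update_of_ne h.ne]
    by_cases hr : d ≤ r
    · rw [fill, fill, dif_pos (by omega), dif_pos (by omega)]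
      simp [Fin.snoc, show r - d < n by omega]
    · rw [fill_of_lt _ _ (by omega), fill_of_lt _ _ (by omega)]
  · rw [Function.update_self]
    have := fill_add (d := d) μ (Fin.snoc (α := fun _ => K) v a) (Fin.last n)
    simpa using this.symm
  · rw [Function.update_of_ne h.ne', fill, fill, dif_neg (by omega), dif_neg (by omega)]

theorem run_hashes {j n : ℕ} (hn : n ≤ j) (t : CompTree K β) (μ : ℕ → K) :
    (hashes j n t).run A hA H μ =
      t.run A hA H (fill j μ fun i : Fin n => H (μ i)) := by
  induction n generalizing t with
  | zero => rw [hashes, fill_zero]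
  | succ n ih =>
    rw [hashes, ih (by omega), run, Instr.eval, PMF.pure_bind, update_fill,
      fill_of_lt _ _ (by omega)]
    congr 2
    funext i
    refine Fin.lastCases ?_ (fun i => ?_) i <;> simp

/-- The distribution of `n` independent field elements. -/
noncomputable def piLaw : (n : ℕ) → (Fin n → PMF K) → PMF (Fin n → K)
  | 0, _ => PMF.pure Fin.elim0
  | n + 1, d => (piLaw n fun i => d i.castSucc).bind fun v =>
      (d (Fin.last n)).bind fun a => PMF.pure (Fin.snoc (α := fun _ => K) v a)

theorem piLaw_apply {n : ℕ} (d : Fin n → PMF K) (v : Fin n → K) :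
    piLaw n d v = ∏ i, d i (v i) := by
  classical
  induction n with
  | zero => rw [piLaw, PMF.pure_apply, if_pos (Subsingleton.elim _ _)]; simp
  | succ n ih =>
    rw [piLaw, PMF.bind_apply, tsum_eq_single (Fin.init v), PMF.bind_apply,
      tsum_eq_single (v (Fin.last n)), ih, Fin.prod_univ_castSucc, PMF.pure_apply,
      if_pos (Fin.snoc_init_self v).symm, mul_one]
    · rfl
    · intro a ha
      rw [PMF.pure_apply, if_neg, mul_zero]
      exact fun h => ha (by rw [h]; simp)
    · intro w hw
      rw [PMF.bind_apply, ENNReal.tsum_eq_zero.2, mul_zero]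
      intro a
      rw [PMF.pure_apply, if_neg, mul_zero]
      rintro rfl
      exact hw (by simp)

/-- The distribution of one coordinate of the right-hand side, for an element with hash value `b`:
uniform with probability `p`, otherwise `b` plus a uniformly random element of `A`. -/
noncomputable def targetLaw (hA : A.Nonempty) (p : ℝ≥0) (hp : p ≤ 1) (b : K) : PMF K :=
  (coinLaw p hp).bind fun c =>
    if c = true then PMF.uniformOfFintype K
    else (PMF.uniformOfFinset A hA).bind fun a => PMF.pure (a + b)

theorem targetLaw_apply (p : ℝ≥0) (hp : p ≤ 1) (b v : K) :
    targetLaw hA p hp b v = (Fintype.card K : ℝ≥0∞)⁻¹ * DPSet.weight A p (v - b) := by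
  classical
  have hq0 : (Fintype.card K : ℝ≥0∞) ≠ 0 := by exact_mod_cast Fintype.card_ne_zero
  have hqt : (Fintype.card K : ℝ≥0∞) ≠ ⊤ := ENNReal.natCast_ne_top _
  have h1 : ((PMF.uniformOfFinset A hA).bind fun a => PMF.pure (a + b)) v =
      if v - b ∈ A then (A.card : ℝ≥0∞)⁻¹ else 0 := by
    rw [PMF.bind_apply, tsum_eq_single (v - b), PMF.pure_apply, if_pos (sub_add_cancel v b).symm,
      mul_one, PMF.uniformOfFinset_apply]
    intro a ha
    rw [PMF.pure_apply, if_neg, mul_zero]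
    rintro rfl
    simp at ha
  rw [targetLaw, PMF.bind_apply, tsum_bool, if_neg (by simp), if_pos rfl, h1,
    PMF.uniformOfFintype_apply, DPSet.weight, mul_add, add_comm]
  congr 1
  · exact mul_comm _ _
  · change ((1 - p : ℝ≥0) : ℝ≥0∞) * _ = _
    split_ifs
    · rw [mul_left_comm, div_eq_mul_inv, ← mul_assoc _ _ (A.card : ℝ≥0∞)⁻¹,
        ENNReal.inv_mul_cancel hq0 hqt, one_mul]
    · simp

/-- Draw the `i`-th coordinate of the right-hand side into register `2 * j + i`; the hash value of
the `i`-th element is in register `j + i`. -/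
noncomputable def draw (p : ℝ≥0) (hp : p ≤ 1) (j i : ℕ) (t : CompTree K β) : CompTree K β :=
  if i < j then
    coin p hp (exec (2 * j + i) .rand t)
      (exec (2 * j + i) .randTarget (exec (2 * j + i) (.add (2 * j + i) (j + i)) t))
  else exec (2 * j + i) .rand t

/-- The distribution of the `i`-th coordinate of the right-hand side. -/
noncomputable def drawLaw (hA : A.Nonempty) (p : ℝ≥0) (hp : p ≤ 1) (j i : ℕ) (b : K) : PMF K :=
  if i < j then targetLaw hA p hp b else PMF.uniformOfFintype K

theorem cost_draw_le (p : ℝ≥0) (hp : p ≤ 1) (j i : ℕ) (t : CompTree K β) :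
    (draw p hp j i t).cost ≤ t.cost + 3 := by
  rw [draw]
  split_ifs <;> simp only [cost] <;> omega

theorem run_draw (p : ℝ≥0) (hp : p ≤ 1) (j i : ℕ) (t : CompTree K β) (μ : ℕ → K) :
    (draw p hp j i t).run A hA H μ = (drawLaw hA p hp j i (μ (j + i))).bind fun v =>
      t.run A hA H (Function.update μ (2 * j + i) v) := by
  rw [draw, drawLaw]
  split_ifs with hi
  · rw [targetLaw, PMF.bind_bind]
    change (coinLaw p hp).bind _ = _
    congr 1
    funext c
    cases c
    · have h1 : ∀ v, Function.update μ (2 * j + i) v (j + i) = μ (j + i) := fun v =>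
        Function.update_of_ne (by omega) _ _
      simp [run, Instr.eval, PMF.bind_bind, PMF.pure_bind, h1]
    · simp [run, Instr.eval]
  · rfl

/-- Draw the first `n` coordinates of the right-hand side. -/
noncomputable def draws (p : ℝ≥0) (hp : p ≤ 1) (j : ℕ) : ℕ → CompTree K β → CompTree K β
  | 0, t => t
  | n + 1, t => draws p hp j n (draw p hp j n t)

theorem cost_draws_le (p : ℝ≥0) (hp : p ≤ 1) (j n : ℕ) (t : CompTree K β) :
    (draws p hp j n t).cost ≤ t.cost + 3 * n := by
  induction n generalizing t with
  | zero => exact le_rfl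
  | succ n ih =>
    have := ih (draw p hp j n t)
    have := cost_draw_le p hp j n t
    rw [draws]
    omega

theorem run_draws (p : ℝ≥0) (hp : p ≤ 1) (j n : ℕ) (t : CompTree K β) (μ : ℕ → K) :
    (draws p hp j n t).run A hA H μ =
      (piLaw n fun i => drawLaw hA p hp j i (μ (j + i))).bind fun v =>
        t.run A hA H (fill (2 * j) μ v) := by
  induction n generalizing t with
  | zero => rw [draws, piLaw, PMF.pure_bind, fill_zero]
  | succ n ih =>
    rw [draws, ih, piLaw, PMF.bind_bind]
    congr 1
    funext v
    rw [run_draw, PMF.bind_bind]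
    have h1 : drawLaw hA p hp j n (fill (2 * j) μ v (j + n)) = drawLaw hA p hp j n (μ (j + n)) := by
      rw [drawLaw, drawLaw]
      split_ifs with h
      · rw [fill_of_lt _ _ (by omega)]
      · rfl
    simp only [h1, PMF.pure_bind, update_fill]
    rfl

end CompTree

namespace DPSet

set_option linter.unusedSectionVars false

open CompTree StraightLine Matrix

variable {K U : Type*} [Field K] [Fintype K] [Fintype U] {A : Finset K} {hA : A.Nonempty}
  {p : ℝ≥0} {hp : p ≤ 1} {k : ℕ}

theorem load_apply {j : ℕ} (v : Fin j → K) (i : Fin j) : load v i = v i := by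
  rw [load, dif_pos i.2]

/-- Decoding takes a linear number of steps. -/
theorem exists_decode_tree (ι : U ↪ K) :
    ∃ t : CompTree K Bool,
      ComputesDecode A hA ι (mechanism A hA p hp (vandermondeRow ι k)) t ∧ t.cost ≤ 2 * k + 4 := by
  classical
  refine ⟨exec (k + 1) (.const 0) (horner k k (exec (k + 2) (.hash k)
    (exec (k + 1) (.sub (k + 1) (k + 2)) (ifTarget (k + 1) (ret true) (ret false))))), ?_, ?_⟩
  · intro x h u
    set μ := load (Fin.snoc (α := fun _ => K) x (ι u)) with hμ
    have hk : μ k = ι u := by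
      have := load_apply (Fin.snoc (α := fun _ => K) x (ι u)) (Fin.last k)
      rwa [Fin.snoc_last] at this
    have hx : ∀ i : Fin k, μ i = x i := fun i => by
      have := load_apply (Fin.snoc (α := fun _ => K) x (ι u)) i.castSucc
      rwa [Fin.snoc_castSucc] at this
    have hrow : vandermondeRow ι k u ⬝ᵥ x = ∑ i ∈ Finset.range k, μ i * μ k ^ i := by
      rw [Finset.sum_range, dotProduct]
      exact Finset.sum_congr rfl fun i _ => by rw [hx, hk, vandermondeRow, mul_comm]
    have hsum : ∀ a : K, ∑ i ∈ Finset.range k, Function.update μ (k + 1) a i * μ k ^ i =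
        ∑ i ∈ Finset.range k, μ i * μ k ^ i := fun a =>
      Finset.sum_congr rfl fun i hi => by
        have := Finset.mem_range.1 hi
        rw [Function.update_of_ne (by omega)]
    have hor : oracle ι h (μ k) = h u := by
      rw [hk, oracle, ι.injective.extend_apply]
    change _ = PMF.pure (decode A (vandermondeRow ι k) (Sum.inl (x, h)) u)
    rw [decode, run, Instr.eval, PMF.pure_bind, run_horner le_rfl]
    simp only [run, Instr.eval, PMF.pure_bind, Function.update_idem, Function.update_self,
      ne_eq, show k ≠ k + 1 by omega, show k + 1 ≠ k + 2 by omega,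
      not_false_eq_true, Function.update_of_ne, zero_mul, zero_add, hsum, hor, ← hrow]
    split_ifs with hmem
    · simp [PMF.pure_map, hmem]
    · simp [PMF.pure_map, hmem]
  · simp only [cost, cost_horner]
    omega

theorem run_encode_law (ι : U ↪ K) {j : ℕ} (hjk : j ≤ k) (s : Fin j ↪ U) (h : U → K)
    (Φ : (Fin k → K) → Fin k → K) (hinj : Function.Injective Φ)
    (hΦ : ∀ v i, ∑ N : Fin k, ι (s i) ^ (N : ℕ) * Φ v N = v (Fin.castLE hjk i))
    (d : Fin k → PMF K) (hd : ∀ i : Fin k, d i =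
      if hi : (i : ℕ) < j then targetLaw hA p hp (h (s ⟨i, hi⟩)) else PMF.uniformOfFintype K) :
    (piLaw k d).map (fun v => some (Φ v)) =
      solverLaw A hA p hp (vandermondeRow ι k) h (Finset.univ.map s) := by
  classical
  have hS : ∀ T ⊆ Finset.univ.map s, LinearIndependent K fun u : T => vandermondeRow ι k u :=
    fun T hT => linearIndependent_vandermondeRow ι k T <|
      (Finset.card_le_card hT).trans (by simpa using hjk)
  ext r
  rcases r with _ | x
  · rw [solverLaw_none hS, PMF.map_apply]
    simp
  · obtain ⟨v, rfl⟩ := Finite.surjective_of_injective hinj x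
    rw [solverLaw_some hS, PMF.map_apply, tsum_eq_single v, if_pos rfl, piLaw_apply,
      Finset.prod_map]
    · have h1 : ∀ i : Fin k, d i (v i) = (Fintype.card K : ℝ≥0∞)⁻¹ *
          if hi : (i : ℕ) < j then weight A p (v i - h (s ⟨i, hi⟩)) else 1 := by
        intro i
        rw [hd]
        split_ifs
        · rw [targetLaw_apply]
        · rw [PMF.uniformOfFintype_apply, mul_one]
      rw [Finset.prod_congr rfl fun i _ => h1 i, Finset.prod_mul_distrib, Finset.prod_const,
        Finset.card_univ, Fintype.card_fin, ENNReal.inv_pow]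
      congr 1
      have h2 : ∀ i : Fin j, vandermondeRow ι k (s i) ⬝ᵥ Φ v = v (Fin.castLE hjk i) := hΦ v
      simp only [h2]
      symm
      refine Finset.prod_of_injOn (Fin.castLE hjk) (Fin.castLE_injective hjk).injOn
        (fun _ _ => Finset.mem_coe.2 (Finset.mem_univ _)) (fun i _ hi => ?_) fun i _ => ?_
      · refine dif_neg fun hij => hi ⟨⟨i, hij⟩, Finset.mem_coe.2 (Finset.mem_univ _), rfl⟩
      · simp
    · intro w hw
      rw [if_neg]
      exact fun h => hw (hinj (Option.some.inj h)).symm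

/-- Encoding takes as many steps as solving the linear system, up to a linear number of steps. -/
theorem exists_encode_tree (ι : U ↪ K) {j c : ℕ} (hjk : j ≤ k)
    (Φ : (Fin j → K) → (Fin k → K) → Fin k → K)
    (hcost : Cost (Set.range (fun i (y : (Fin j → K) × (Fin k → K)) => y.1 i) ∪
      Set.range fun i (y : (Fin j → K) × (Fin k → K)) => y.2 i) c
      (Set.range fun N (y : (Fin j → K) × (Fin k → K)) => Φ y.1 y.2 N))
    (hΦ : ∀ s, Function.Injective s → Function.Injective (Φ s) ∧
      ∀ v i, ∑ N : Fin k, s i ^ (N : ℕ) * Φ s v N = v (Fin.castLE hjk i)) :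
    ∃ t : CompTree K (Fin k → ℕ),
      ComputesEncode A hA ι (mechanism A hA p hp (vandermondeRow ι k)) j t ∧
        t.cost ≤ c + 4 * k := by
  classical
  obtain ⟨c', hc', T, hT, hTΦ⟩ := hcost
  set μ : ((Fin j → K) × (Fin k → K)) × (Fin j → K) → ℕ → K := fun y =>
    fill (2 * j) (fill j (load y.1.1) y.2) y.1.2 with hμ
  obtain ⟨μ', P, hPc, hPr, hPT⟩ := exists_program (β := Fin k → ℕ) hT Prod.fst (2 * j + k) μ (by
    rintro f (⟨i, rfl⟩ | ⟨i, rfl⟩)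
    · refine ⟨i, by omega, fun y => ?_⟩
      rw [hμ]
      dsimp only
      rw [fill_of_lt _ _ (by omega), fill_of_lt _ _ i.2, load_apply]
    · exact ⟨2 * j + i, by omega, fun y => fill_add _ _ i⟩)
  choose addr _ haddr using fun N => hPT _ (hTΦ (Set.mem_range_self N))
  refine ⟨hashes j j (draws p hp j k (P (ret addr))), fun s => ?_, ?_⟩
  · change _ = encode A hA p hp (vandermondeRow ι k) (Finset.univ.map s)
    rw [encode_eq]
    congr 1
    funext h
    set σ : Fin j → K := fun i => ι (s i) with hσ
    obtain ⟨hinj, hsol⟩ := hΦ σ (ι.injective.comp s.injective)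
    have horacle : ∀ i : Fin j, oracle ι h (load σ i) = h (s i) := fun i => by
      rw [load_apply, oracle, ι.injective.extend_apply]
    rw [← run_encode_law (hA := hA) (hp := hp) ι hjk s h (Φ σ) hinj hsol
      (fun i => drawLaw hA p hp j i (fill j (load σ) (fun i : Fin j => oracle ι h (load σ i))
        (j + i))) ?_]
    · rw [run_hashes le_rfl, run_draws, PMF.map_comp, PMF.map_bind, ← PMF.bind_pure_comp]
      congr 1
      funext v
      have := hPr A hA (oracle ι h) (ret addr) ((σ, v), fun i : Fin j => oracle ι h (load σ i))
      rw [this, run]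
      simp [haddr, PMF.pure_map]
    · intro i
      rw [drawLaw]
      split_ifs with hi
      · have := fill_add (d := j) (load σ) (fun i : Fin j => oracle ι h (load σ i)) ⟨i, hi⟩
        rw [this, horacle]
      · rfl
  · rw [cost_hashes]
    have := cost_draws_le p hp j k (P (ret addr))
    rw [hPc, cost] at this
    omega

end DPSet

/-! ### The theorem -/

theorem Nat.solver_steps_le {ℓ k : ℕ} (hℓ : 2 ≤ ℓ) :
    ((3000 * (Nat.clog ℓ k ^ 2 + 1) * ℓ ^ (Nat.clog ℓ k + 2) + 1 + 3 * k + 4 * k : ℕ) : ℝ) ≤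
      (15000 * (ℓ : ℝ) ^ 3 + 8) * (k * Real.logb 2 k ^ 2 + 1) := by
  have hℓ' : (2 : ℝ) ≤ ℓ := by exact_mod_cast hℓ
  have h23 : (ℓ : ℝ) ^ 2 ≤ (ℓ : ℝ) ^ 3 := pow_le_pow_right₀ (by linarith) (by norm_num)
  rcases Nat.lt_or_ge k 2 with hk | hk
  · have hclog : Nat.clog ℓ k = 0 := Nat.clog_of_right_le_one (by omega) _
    have hk1 : (k : ℝ) ≤ 1 := by exact_mod_cast (by omega : k ≤ 1)
    have hL : 0 ≤ (k : ℝ) * Real.logb 2 k ^ 2 := by positivity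
    rw [hclog]
    push_cast
    nlinarith [mul_nonneg (by positivity : (0 : ℝ) ≤ 15000 * (ℓ : ℝ) ^ 3 + 8) hL,
      (by positivity : (0 : ℝ) ≤ (ℓ : ℝ) ^ 3)]
  · set m := Nat.clog ℓ k with hm
    set L := Real.logb 2 k with hL
    have hk' : (2 : ℝ) ≤ k := by exact_mod_cast hk
    have hL1 : 1 ≤ L := by
      rw [hL, Real.le_logb_iff_rpow_le (by norm_num) (by linarith)]
      simpa using hk'
    have hm0 : 0 < m := Nat.clog_pos (by omega) hk
    have hlt : ℓ ^ (m - 1) < k := Nat.pow_pred_clog_lt_self (by omega) (by omega)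
    have hlt' : (ℓ : ℝ) ^ (m - 1) ≤ k := by exact_mod_cast hlt.le
    have hmL : (m : ℝ) ≤ 2 * L := by
      have h1 : ((m - 1 : ℕ) : ℝ) ≤ L := by
        rw [hL, Real.le_logb_iff_rpow_le (by norm_num) (by linarith), Real.rpow_natCast]
        exact (pow_le_pow_left₀ (by norm_num) hℓ' _).trans hlt'
      rw [Nat.cast_sub hm0, Nat.cast_one] at h1
      linarith
    have hpow : (ℓ : ℝ) ^ (m + 2) ≤ (ℓ : ℝ) ^ 3 * k := by
      have : m + 2 = 3 + (m - 1) := by omega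
      rw [this, pow_add]
      gcongr
    have hsq : (m : ℝ) ^ 2 + 1 ≤ 5 * L ^ 2 := by
      have : (m : ℝ) ^ 2 ≤ (2 * L) ^ 2 := pow_le_pow_left₀ (by positivity) hmL 2
      nlinarith
    have hL2 : 1 ≤ L ^ 2 := one_le_pow₀ hL1
    push_cast
    have hmain : 3000 * ((m : ℝ) ^ 2 + 1) * (ℓ : ℝ) ^ (m + 2) ≤
        3000 * (5 * L ^ 2) * ((ℓ : ℝ) ^ 3 * k) := by gcongr
    have hlin : (k : ℝ) ≤ k * L ^ 2 := le_mul_of_one_le_right (by positivity) hL2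
    have h3 : (0 : ℝ) ≤ (ℓ : ℝ) ^ 3 := by positivity
    nlinarith

theorem theorem3p5 :
    ∃ (c : ℝ) (C : ℕ → ℝ),
      ∀ (ε : ℝ), 0 < ε →
      ∀ (K U : Type*) [Field K] [Fintype K] [Fintype U] (ι : U ↪ K)
        (A : Finset K) (hA : A.Nonempty)
        (_ : (A.card : ℝ) * (Real.exp ε + 1) = Fintype.card K)
        (p : ℝ≥0) (hp : p ≤ 1)
        (_ : (p : ℝ) = (1 / (Real.exp ε + 1)) / (1 - 1 / (Real.exp ε + 1)))
        (k : ℕ) (M : SetMechanism U (DPSet.Encoding K U k))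
        (_ : M = DPSet.mechanism A hA p hp (DPSet.vandermondeRow ι k)),
        -- the linear systems are always solvable, and the encoder never fails
        (∀ T : Finset U, T.card ≤ k →
          LinearIndependent K (fun s : T => DPSet.vandermondeRow ι k s)) ∧
        (∀ S : Finset U, S.card ≤ k → ∀ e ∈ (M.encode S).support,
          ∃ (x : Fin k → K) (h : U → K), e = Sum.inl (x, h)) ∧
        -- pure differential privacy and utility
        M.IsDP k ε 0 ∧
        M.HasError k (1 / (Real.exp ε + 1)) ∧
        -- encoding time
        (∀ j ≤ k, ∃ t : CompTree K (Fin k → ℕ), DPSet.ComputesEncode A hA ι M j t ∧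
          (t.cost : ℝ) ≤ C (ringChar K) * (k * Real.logb 2 k ^ 2 + 1)) ∧
        -- decoding time
        (∃ t : CompTree K Bool, DPSet.ComputesDecode A hA ι M t ∧
          (t.cost : ℝ) ≤ c * (k + 1)) := by
  refine ⟨4, fun ℓ => 15000 * (ℓ : ℝ) ^ 3 + 8, ?_⟩
  intro ε hε K U _ _ _ ι A hA hAK p hp hpε k M hM
  subst hM
  have hind := DPSet.linearIndependent_vandermondeRow (K := K) ι k
  obtain ⟨hDP, hErr⟩ := DPSet.mechanism_isDP_and_hasError (hA := hA) (hp := hp) (m := k) hε.le hind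
    hAK (DPSet.exclusion_eq hpε)
  refine ⟨hind, fun S hS e he => ?_, hDP, hErr, fun j hjk => ?_, ?_⟩
  · exact DPSet.exists_eq_inl_of_mem_support (hA := hA) (hp := hp)
      (fun T hT => hind T ((Finset.card_le_card hT).trans hS)) he
  · have hprime : (ringChar K).Prime := CharP.char_is_prime K (ringChar K)
    have : Fact (ringChar K).Prime := ⟨hprime⟩
    by_cases hj : j ≤ Fintype.card K
    · obtain ⟨Φ, hcost, hΦ⟩ := AdditiveFFT.exists_solver (K := K) (ℓ := ringChar K) hjk hj
      obtain ⟨t, ht, htc⟩ := DPSet.exists_encode_tree (A := A) (hA := hA) (p := p) (hp := hp) ι hjk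
        Φ hcost hΦ
      exact ⟨t, ht, (Nat.cast_le.2 htc).trans (Nat.solver_steps_le hprime.two_le)⟩
    · refine ⟨.ret fun _ => 0, fun s => ?_, ?_⟩
      · have := Fintype.card_le_of_embedding (s.trans ι)
        rw [Fintype.card_fin] at this
        exact absurd this hj
      · simp only [CompTree.cost, Nat.cast_zero]
        positivity
  · obtain ⟨t, ht, htc⟩ := DPSet.exists_decode_tree (A := A) (hA := hA) (p := p) (hp := hp)
      (k := k) ι
    refine ⟨t, ht, (Nat.cast_le.2 htc).trans ?_⟩
    push_cast
    nlinarith [(Nat.cast_nonneg k : (0 : ℝ) ≤ k)]
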